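/- A \emph{$t\Delta$-set} is a presheaf on Verity's category $t\Delta$, with objects $[m]$ ($m\ge 0$) and $[m]_t$ ($m\ge1$), generated by cofaces $d^i$, codegeneracies $s^i\colon[m]\to[m-1]$, maps $\varphi\colon[m]\to[m]_t$ and $\zeta^i\colon[m]_t\to[m-1]$ subject to the cosimplicial identities, $\zeta^i\varphi=s^i$ and $s^i\zeta^{j+1}=s^j\zeta^i$ for $i\le j$; that is, a simplicial set $X$ with a set of labels for every simplex of positive dimension and a chosen label for every degenerate one. A simplex is marked if it has a label. A stratified simplicial set is a $t\Delta$-set in which every simplex has at most one label. The \emph{elementary anodyne extensions} (for $n=2$) are the canonical maps of stratified simplicial sets - $\Lambda^k[m]\to\Delta^k[m]$ for $m\ge1$, $0\le k\le m$, where a nondegenerate simplex of $\Delta^k[m]$ is marked iff it contains the vertices $\{k-1,k,k+1\}\cap[m]$, and the horn carries the induced marking; - $\Delta^k[m]'\to\Delta^k[m]''$ for $m\ge2$, $0\le k\le m$, where $\Delta^k[m]'$ is $\Delta^k[m]$ with the $(k-1)$-st and $(k+1)$-st faces (those that exist) marked in addition, and in $\Delta^k[m]''$ the $k$-th face is marked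 as well; - $\Delta[l]\to\Delta[l]_t$ for $l>2$, where in $\Delta[l]_t$ the top simplex is marked as well; - $\Delta[l]\star\Delta[3]_{eq}\to\Delta[l]\star\Delta[3]^\sharp$ for $l\ge-1$, where in $\Delta[3]_{eq}$ the marked nondegenerate simplices are all $2$- and $3$-simplices and the edges $[02]$ and $[13]$, in $\Delta[3]^\sharp$ all simplices of positive dimension are marked, and a simplex of a join is marked iff one of its two components is. An \emph{anodyne extension} is a retract of a transfinite composition of pushouts of elementary anodyne extensions. A \emph{$2$-precomplicial set} is a $t\Delta$-set with the right lifting property against the elementary anodyne extensions. These are the fibrant objects of the model structure for $(\infty,2)$-categories on $t\Delta$-sets, whose cofibrations are the monomorphisms. A map $f\colon X\to Y$ is a weak equivalence in it iff for every $2$-precomplicial set $Z$ composition with $f$ is a bijection $[Y,Z]\to[X,Z]$ of homotopy classes of maps, where homotopies are generated by maps $X\times J\to Z$ and $J$ has as $m$-simplices all sequences of $m+1$ elements of $\{0,1\}$, all of positive dimension marked once. Let $\mathcal C$ be a (small, strict) $2$-category. Its Street–Duskin nerve is the $3$-coskeletal simplicial set with $0$-simplices the objects, $1$-simplices the $1$-morphisms,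 $2$-simplices the $2$-morphisms $f_{02}\Rightarrow f_{12}f_{01}$, and $3$-simplices the quadruples of $2$-morphisms whose two pasting composites agree. The \emph{Roberts–Street nerve} $N^{RS}_2(\mathcal C)$ is this simplicial set with the following simplices marked, once each: the $1$-simplices given by identities, the $2$-simplices given by identity $2$-morphisms, and all $m$-simplices with $m>2$. The \emph{natural nerve} $N^\natural_2(\mathcal C)$ is the same simplicial set in which the labels of a $1$-simplex $f$ are the completions $(f,g,\eta,\epsilon)$ of $f$ to an adjoint equivalence, a $2$-simplex is marked, once, iff its $2$-morphism is invertible, and all $m$-simplices with $m>2$ are marked once. The canonical map $N^{RS}_2(\mathcal C)\to N^\natural_2(\mathcal C)$ is the identity on simplices and sends the label of an identity $1$-morphism to the identity adjoint equivalence. \textbf{Theorem.} Let $\mathcal C$ be a $2$-category. 1. $N^{RS}_2(\mathcal C)$ is fibrant, i.e. a $2$-precomplicial set, if and only if every $1$-morphism of $\mathcal C$ with a strict inverse is an identity and every invertible $2$-morphism of $\mathcal C$ is an identity. 2. $N^\natural_2(\mathcal C)$ is fibrant, i.e. a $2$-precomplicial set. 3. The canonical map $N^{RS}_2(\mathcal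 C)\to N^\natural_2(\mathcal C)$ is an anodyne extension, and is a weak equivalence in the model structure for $(\infty,2)$-categories; with (2), $N^\natural_2(\mathcal C)$ is a fibrant replacement of $N^{RS}_2(\mathcal C)$. -/

import Mathlib

open CategoryTheory Opposite
open scoped Bicategory

universe w v u

/-! ## The category `tΔ` and prestratified simplicial sets -/

/-- Objects of `tΔ`: `plain m` is `[m]` for `m ≥ 0`, and `marked m` is `[m+1]_t`
(so that the marked objects are the `[k]_t` with `k ≥ 1`). -/
inductive TDelta : Type
  | plain (m : ℕ)
  | marked (m : ℕ)

namespace TDelta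

/-- The underlying finite ordinal of an object of `tΔ`. -/
def base : TDelta → SimplexCategory
  | plain m => SimplexCategory.mk m
  | marked m => SimplexCategory.mk (m + 1)

/-- The objects `[m]_t`. -/
def IsMarked : TDelta → Prop
  | plain _ => False
  | marked _ => True

/-- Morphisms of `tΔ`. In the presentation of `tΔ` by cofaces, codegeneracies,
`φ : [m] ⟶ [m]_t` and `ζⁱ : [m+1]_t ⟶ [m]` (with `ζⁱ φ = sⁱ` and
`sⁱ ζʲ⁺¹ = sʲ ζⁱ` for `i ≤ j`), every morphism is determined by its underlying monotone map.
All monotone maps occur as morphisms out of `[m]`. The morphisms out of `[m]_t` are the identity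
of `[m]_t` and the morphisms that factor through some `ζⁱ`, i.e. those whose underlying monotone
map is not injective. (An injective monotone map from an ordinal to itself is the identity.) -/
def Hom (a b : TDelta) : Type :=
  {θ : a.base ⟶ b.base // a.IsMarked → Function.Injective θ.toOrderHom → a = b}

theorem eq_id_of_injective {n : SimplexCategory} (θ : n ⟶ n)
    (h : Function.Injective θ.toOrderHom) : θ = 𝟙 n := by
  have : Mono θ := SimplexCategory.mono_iff_injective.2 h
  exact SimplexCategory.eq_id_of_mono θ

instance : Category TDelta where
  Hom := Hom
  id a := ⟨𝟙 _, fun _ _ => rfl⟩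
  comp {a b c} θ ψ := ⟨θ.1 ≫ ψ.1, fun ha hinj => by
    obtain ⟨θ, hθ⟩ := θ
    obtain ⟨ψ, hψ⟩ := ψ
    have h1 : Function.Injective θ.toOrderHom := by
      intro x y hxy
      apply hinj
      simp only [SimplexCategory.comp_toOrderHom, OrderHom.comp_coe, Function.comp_apply, hxy]
    obtain rfl := hθ ha h1
    obtain rfl := eq_id_of_injective θ h1
    exact hψ ha (by simpa using hinj)⟩
  id_comp θ := Subtype.ext (Category.id_comp _)
  comp_id θ := Subtype.ext (Category.comp_id _)
  assoc θ ψ χ := Subtype.ext (Category.assoc _ _ _)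

/-- The monotone map underlying a morphism of `tΔ`. -/
def Hom.val {a b : TDelta} (θ : a ⟶ b) : a.base ⟶ b.base := Subtype.val θ

theorem Hom.prop {a b : TDelta} (θ : a ⟶ b) (ha : a.IsMarked)
    (h : Function.Injective (Hom.val θ).toOrderHom) : a = b := Subtype.property θ ha h

end TDelta

/-- Prestratified simplicial sets (`tΔ`-sets): presheaves on `tΔ`. -/
abbrev TDeltaSet : Type (u + 1) := TDeltaᵒᵖ ⥤ Type u

/-! ## Simplicial sets with labels

A `tΔ`-set amounts to a simplicial set together with a set of labels for each simplex of positive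
dimension, and a chosen label for each degenerate simplex. -/

/-- A simplicial set `X` with a set of labels for each simplex of positive dimension and a
distinguished label for each degenerate simplex. -/
structure LabelledSSet : Type (u + 1) where
  X : SSet.{u}
  Label : ∀ {m : ℕ}, X.obj (op (.mk (m + 1))) → Type u
  deg : ∀ {m : ℕ} (x : X.obj (op (.mk (m + 1)))), x ∈ X.degenerate (m + 1) → Label x

namespace LabelledSSet

variable (S : LabelledSSet.{u})

/-- The set of labelled simplices of shape `a`. -/
def obj : TDelta → Type u
  | .plain m => S.X.obj (op (.mk m))
  | .marked m => Σ x : S.X.obj (op (.mk (m + 1))), S.Label x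

variable {S} in
/-- The underlying simplex. -/
def under : ∀ {a : TDelta}, S.obj a → S.X.obj (op a.base)
  | .plain _, x => x
  | .marked _, x => x.1

theorem degenerate_of_not_injective (X : SSet.{u}) {m : ℕ} {n : SimplexCategory}
    (θ : SimplexCategory.mk (m + 1) ⟶ n) (hθ : ¬ Function.Injective θ.toOrderHom) (x : X.obj (op n)) :
    X.map θ.op x ∈ X.degenerate (m + 1) := by
  obtain ⟨i, θ', rfl⟩ := SimplexCategory.eq_σ_comp_of_not_injective θ hθ
  exact ⟨m, Nat.lt_succ_self m, SimplexCategory.σ i, X.map θ'.op x, by simp⟩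

open Classical in
/-- The action of a morphism of `tΔ`. -/
noncomputable def map : ∀ {a b : TDelta}, (a ⟶ b) → S.obj b → S.obj a
  | .plain _, _, θ, x => S.X.map (TDelta.Hom.val θ).op (under x)
  | .marked _, _, θ, x =>
      if h : Function.Injective (TDelta.Hom.val θ).toOrderHom then
        cast (congrArg S.obj (TDelta.Hom.prop θ trivial h).symm) x
      else
        ⟨S.X.map (TDelta.Hom.val θ).op (under x),
          S.deg _ (degenerate_of_not_injective S.X _ h _)⟩

theorem map_of_not_injective {m : ℕ} {b : TDelta} (θ : TDelta.marked m ⟶ b)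
    (h : ¬ Function.Injective (TDelta.Hom.val θ).toOrderHom) (x : S.obj b) :
    S.map θ x = (⟨S.X.map (TDelta.Hom.val (a := .marked m) θ).op (under x),
      S.deg _ (degenerate_of_not_injective S.X _ h _)⟩ :
        Σ x : S.X.obj (op (.mk (m + 1))), S.Label x) :=
  dif_neg h

theorem map_eq_self {a : TDelta} (θ : a ⟶ a) (h : TDelta.Hom.val θ = 𝟙 _) (x : S.obj a) :
    S.map θ x = x := by
  cases a with
  | plain m =>
    change S.X.map (TDelta.Hom.val θ).op x = x
    rw [h, op_id, S.X.map_id]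
    rfl
  | marked m =>
    have h' : Function.Injective (TDelta.Hom.val θ).toOrderHom := by
      rw [h]; exact fun _ _ h => h
    exact dif_pos h'

theorem under_map {a b : TDelta} (θ : a ⟶ b) (x : S.obj b) :
    under (S.map θ x) = S.X.map (TDelta.Hom.val θ).op (under x) := by
  cases a with
  | plain m => rfl
  | marked m =>
    by_cases h : Function.Injective (TDelta.Hom.val θ).toOrderHom
    · obtain rfl := TDelta.Hom.prop θ trivial h
      have e := TDelta.eq_id_of_injective _ h
      rw [S.map_eq_self θ e, e, op_id, S.X.map_id]
      rfl
    · rw [S.map_of_not_injective θ h]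
      rfl

variable {S} in
theorem deg_congr {m : ℕ} {x y : S.X.obj (op (.mk (m + 1)))} (h : x = y)
    (hx : x ∈ S.X.degenerate (m + 1)) (hy : y ∈ S.X.degenerate (m + 1)) :
    (⟨x, S.deg x hx⟩ : Σ x : S.X.obj (op (.mk (m + 1))), S.Label x) = ⟨y, S.deg y hy⟩ := by
  subst h
  rfl

theorem map_comp' {a b c : TDelta} (θ : a ⟶ b) (ψ : b ⟶ c) (x : S.obj c) :
    S.map (θ ≫ ψ) x = S.map θ (S.map ψ x) := by
  have key : S.X.map (TDelta.Hom.val (θ ≫ ψ)).op (under x) =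
      S.X.map (TDelta.Hom.val θ).op (under (S.map ψ x)) := by
    rw [under_map]
    change S.X.map (TDelta.Hom.val θ ≫ TDelta.Hom.val ψ).op (under x) = _
    rw [op_comp, S.X.map_comp]
    rfl
  cases a with
  | plain m => exact key
  | marked m =>
    by_cases h1 : Function.Injective (TDelta.Hom.val θ).toOrderHom
    · obtain rfl := TDelta.Hom.prop θ trivial h1
      have e := TDelta.eq_id_of_injective _ h1
      obtain rfl : θ = 𝟙 _ := Subtype.ext e
      rw [Category.id_comp, map_eq_self S (𝟙 _) e]
    · have h2 : ¬ Function.Injective (TDelta.Hom.val (θ ≫ ψ)).toOrderHom := by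
        intro h
        apply h1
        intro x y hxy
        apply h
        exact congrArg (TDelta.Hom.val ψ).toOrderHom hxy
      rw [map_of_not_injective _ _ h1, map_of_not_injective _ _ h2]
      exact deg_congr key _ _

/-- The `tΔ`-set given by a simplicial set with labels: `[m]` is sent to the set of `m`-simplices
and `[m]_t` to the set of pairs of an `m`-simplex and one of its labels. -/
noncomputable def toTDeltaSet : TDeltaSet.{u} where
  obj a := S.obj a.unop
  map θ := ↾ S.map θ.unop
  map_id a := by
    ext x
    exact S.map_eq_self _ rfl x
  map_comp θ ψ := by
    ext x
    exact S.map_comp' _ _ x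

variable {S} in
/-- Maps of simplicial sets with labels, preserving the distinguished labels. -/
structure Hom (S T : LabelledSSet.{u}) where
  f : S.X ⟶ T.X
  l : ∀ {m : ℕ} (x : S.X.obj (op (.mk (m + 1)))), S.Label x → T.Label (f.app _ x)
  l_deg : ∀ {m : ℕ} (x : S.X.obj (op (.mk (m + 1)))) (hx : x ∈ S.X.degenerate (m + 1))
    (hy : f.app _ x ∈ T.X.degenerate (m + 1)), l x (S.deg x hx) = T.deg _ hy

variable {S} {T : LabelledSSet.{u}}

/-- The components of the map of `tΔ`-sets induced by a map of labelled simplicial sets. -/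
def Hom.app (F : Hom S T) : ∀ {a : TDelta}, S.obj a → T.obj a
  | .plain _, x => F.f.app _ x
  | .marked _, x => ⟨F.f.app _ x.1, F.l x.1 x.2⟩

theorem Hom.under_app (F : Hom S T) {a : TDelta} (x : S.obj a) :
    under (F.app x) = F.f.app _ (under x) := by
  cases a <;> rfl

theorem Hom.app_map (F : Hom S T) {a b : TDelta} (θ : a ⟶ b) (x : S.obj b) :
    F.app (S.map θ x) = T.map θ (F.app x) := by
  cases a with
  | plain m =>
    change F.f.app _ (S.X.map (TDelta.Hom.val θ).op (under x)) =
      T.X.map (TDelta.Hom.val θ).op (under (F.app x))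
    rw [F.under_app]
    exact NatTrans.naturality_apply F.f _ _
  | marked m =>
    by_cases h : Function.Injective (TDelta.Hom.val θ).toOrderHom
    · obtain rfl := TDelta.Hom.prop θ trivial h
      have e := TDelta.eq_id_of_injective _ h
      rw [map_eq_self _ _ e, map_eq_self _ _ e]
    · have key : F.f.app _ (S.X.map (TDelta.Hom.val θ).op (under x)) =
          T.X.map (TDelta.Hom.val θ).op (under (F.app x)) := by
        rw [F.under_app]
        exact NatTrans.naturality_apply F.f _ _
      have hd := degenerate_of_not_injective T.X (TDelta.Hom.val θ) h (under (F.app x))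
      rw [map_of_not_injective _ _ h, map_of_not_injective _ _ h]
      refine Eq.trans ?_ (deg_congr key (key ▸ hd) hd)
      exact congrArg (Sigma.mk _) (F.l_deg _ _ (key ▸ hd))

/-- The map of `tΔ`-sets induced by a map of simplicial sets with labels. -/
noncomputable def Hom.toTDeltaSet (F : Hom S T) : S.toTDeltaSet ⟶ T.toTDeltaSet where
  app a := ↾ (F.app (a := a.unop))
  naturality a b θ := by
    ext x
    exact F.app_map θ.unop x

end LabelledSSet

/-! ## Stratified simplicial sets -/

/-- The stratified simplicial set with underlying simplicial set `X` in which the marked simplices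
are the degenerate ones and those satisfying `M`, each of them marked once. -/
def stratify (X : SSet.{u}) (M : ∀ {m : ℕ}, X.obj (op (.mk (m + 1))) → Prop) : LabelledSSet.{u} where
  X := X
  Label {m} x := ULift.{u} (PLift (x ∈ X.degenerate (m + 1) ∨ M x))
  deg _ hx := ⟨⟨Or.inl hx⟩⟩

/-- A simplicial map that sends the simplices satisfying `M` to marked ones induces a map of
stratified simplicial sets. -/
def stratifyHom {X Y : SSet.{u}} (f : X ⟶ Y) (M : ∀ {m : ℕ}, X.obj (op (.mk (m + 1))) → Prop)
    (M' : ∀ {m : ℕ}, Y.obj (op (.mk (m + 1))) → Prop)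
    (h : ∀ {m : ℕ} (x : X.obj (op (.mk (m + 1)))), M x → M' (f.app _ x)) :
    LabelledSSet.Hom (stratify X M) (stratify Y M') where
  f := f
  l x hx := ⟨⟨hx.down.down.imp (fun hd => SSet.degenerate_app_apply hd f) (h x)⟩⟩
  l_deg _ _ _ := rfl

/-- The set of vertices of a simplex of `Δ[n]`. -/
def vertexSet {n k : ℕ} (x : (SSet.stdSimplex.{u}.obj (.mk n)).obj (op (.mk k))) : Set (Fin (n + 1)) :=
  Set.range (fun i => x i)

/-- `Δ[n]` with marked simplices the degenerate ones and those whose vertex set is in `P`;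
a nondegenerate simplex of `Δ[n]` is determined by its vertex set. -/
noncomputable def markedSimplex (n : ℕ) (P : Set (Set (Fin (n + 1)))) : TDeltaSet.{u} :=
  (stratify (SSet.stdSimplex.{u}.obj (.mk n)) (fun x => vertexSet x ∈ P)).toTDeltaSet

/-- The map between two stratifications of `Δ[n]` that is the identity on simplices. -/
noncomputable def markedSimplexInclusion (n : ℕ) {P Q : Set (Set (Fin (n + 1)))} (h : P ⊆ Q) :
    markedSimplex.{u} n P ⟶ markedSimplex.{u} n Q :=
  (stratifyHom (𝟙 (SSet.stdSimplex.{u}.obj (.mk n))) _ _ (fun _ hx => h hx)).toTDeltaSet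

/-! ## Elementary anodyne extensions -/

/-- Marked vertex sets of `Δᵏ[m]`: those that contain `{k-1, k, k+1} ∩ [m]`. -/
def admissibleMarking (m : ℕ) (k : Fin (m + 1)) : Set (Set (Fin (m + 1))) :=
  {S | ∀ j : Fin (m + 1), ((j : ℕ) + 1 = k ∨ j = k ∨ (j : ℕ) = k + 1) → j ∈ S}

/-- Marked vertex sets of `Δᵏ[m]'`: moreover the `(k-1)`-st and the `(k+1)`-st face. -/
def admissibleMarking' (m : ℕ) (k : Fin (m + 1)) : Set (Set (Fin (m + 1))) :=
  admissibleMarking m k ∪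
    {S | ∃ j : Fin (m + 1), ((j : ℕ) + 1 = k ∨ (j : ℕ) = k + 1) ∧ S = {j}ᶜ}

/-- Marked vertex sets of `Δᵏ[m]''`: moreover the `k`-th face. -/
def admissibleMarking'' (m : ℕ) (k : Fin (m + 1)) : Set (Set (Fin (m + 1))) :=
  admissibleMarking' m k ∪ {{k}ᶜ}

/-- The complicial horn `Λᵏ[m]`: the horn, with the simplices marked that are marked
in `Δᵏ[m]`. -/
noncomputable def complicialHorn (m : ℕ) (k : Fin (m + 1)) : TDeltaSet.{u} :=
  (stratify ((SSet.horn.{u} m k : SSet.Subcomplex _) : SSet.{u})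
    (fun x => vertexSet x.1 ∈ admissibleMarking m k)).toTDeltaSet

/-- The complicial horn extension `Λᵏ[m] ⟶ Δᵏ[m]`. -/
noncomputable def complicialHornExtension (m : ℕ) (k : Fin (m + 1)) :
    complicialHorn.{u} m k ⟶ markedSimplex.{u} m (admissibleMarking m k) :=
  (stratifyHom (SSet.horn.{u} m k).ι (fun x => vertexSet x.1 ∈ admissibleMarking m k)
    (fun x => vertexSet x ∈ admissibleMarking m k) (fun _ hx => hx)).toTDeltaSet

/-- The complicial thinness extension `Δᵏ[m]' ⟶ Δᵏ[m]''`. -/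
noncomputable def thinnessExtension (m : ℕ) (k : Fin (m + 1)) :
    markedSimplex.{u} m (admissibleMarking' m k) ⟶ markedSimplex.{u} m (admissibleMarking'' m k) :=
  markedSimplexInclusion m Set.subset_union_left

/-- The triviality extension `Δ[l] ⟶ Δ[l]_t`; in `Δ[l]_t` the top simplex is marked as well. -/
noncomputable def trivialityExtension (l : ℕ) :
    markedSimplex.{u} l ∅ ⟶ markedSimplex.{u} l {Set.univ} :=
  markedSimplexInclusion l (Set.empty_subset _)

/-- The intersection of a vertex set of `Δ[p+3] = Δ[p-1] ⋆ Δ[3]` with the factor `Δ[3]`. -/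
def lastPart (p : ℕ) (S : Set (Fin (p + 3 + 1))) : Set (Fin 4) :=
  {i | (⟨p + i, by omega⟩ : Fin (p + 3 + 1)) ∈ S}

/-- Marked vertex sets of `Δ[3]_eq`: all `2`- and `3`-simplices, and the edges `[02]`, `[13]`. -/
def eqMarking : Set (Set (Fin 4)) :=
  {T | 3 ≤ T.ncard ∨ T = {0, 2} ∨ T = {1, 3}}

/-- Marked vertex sets of `Δ[3]^♯`: all simplices of positive dimension. -/
def sharpMarking : Set (Set (Fin 4)) :=
  {T | 2 ≤ T.ncard}

theorem eqMarking_subset_sharpMarking : eqMarking ⊆ sharpMarking := by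
  rintro T (h | rfl | rfl)
  · exact le_trans (by norm_num) h
  · exact (Set.ncard_pair (by decide)).ge
  · exact (Set.ncard_pair (by decide)).ge

/-- The saturation extension `Δ[l] ⋆ Δ[3]_eq ⟶ Δ[l] ⋆ Δ[3]^♯` for `l = p - 1 ≥ -1`.
The join has underlying simplicial set `Δ[l] ⋆ Δ[3] = Δ[l+4]`, and a simplex of a join is marked
if and only if one of its two components is marked. As only degenerate simplices of `Δ[l]` are
marked, a nondegenerate simplex is marked if and only if its component in `Δ[3]` is marked. -/
noncomputable def saturationExtension (p : ℕ) :
    markedSimplex.{u} (p + 3) {S | lastPart p S ∈ eqMarking} ⟶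
      markedSimplex.{u} (p + 3) {S | lastPart p S ∈ sharpMarking} :=
  markedSimplexInclusion (p + 3) (fun _ hS => eqMarking_subset_sharpMarking hS)

/-- The elementary anodyne extensions for `(∞,n)`-categories. -/
inductive ElementaryAnodyne (n : ℕ) : MorphismProperty TDeltaSet.{u}
  | horn (m : ℕ) (hm : 1 ≤ m) (k : Fin (m + 1)) :
      ElementaryAnodyne n (complicialHornExtension.{u} m k)
  | thinness (m : ℕ) (hm : 2 ≤ m) (k : Fin (m + 1)) :
      ElementaryAnodyne n (thinnessExtension.{u} m k)
  | triviality (l : ℕ) (hl : n < l) :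
      ElementaryAnodyne n (trivialityExtension.{u} l)
  | saturation (p : ℕ) :
      ElementaryAnodyne n (saturationExtension.{u} p)

/-- `n`-precomplicial sets, the fibrant objects of the model structure for `(∞,n)`-categories:
`tΔ`-sets with the right lifting property with respect to the elementary anodyne extensions. -/
def IsPrecomplicial (n : ℕ) (X : TDeltaSet.{u}) : Prop :=
  ∀ ⦃A B : TDeltaSet.{u}⦄ (i : A ⟶ B), ElementaryAnodyne n i →
    ∀ f : A ⟶ X, ∃ g : B ⟶ X, i ≫ g = f

/-- Anodyne extensions: retracts of transfinite compositions of pushouts of elementary anodyne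
extensions. -/
def AnodyneExtension (n : ℕ) : MorphismProperty TDeltaSet.{u} :=
  (MorphismProperty.transfiniteCompositions.{u} (ElementaryAnodyne.{u} n).pushouts).retracts

/-! ## Weak equivalences of the model structure for `(∞,n)`-categories

The model structure has the monomorphisms as cofibrations and the `n`-precomplicial sets as fibrant
objects. The projection `X × J ⟶ X`, for the interval `J` below, is a trivial fibration, so that
`X × J` is a cylinder object of `X`, and all objects are cofibrant. Hence `f : X ⟶ Y` is a weak
equivalence if and only if it induces a bijection `[Y, Z] → [X, Z]` on `J`-homotopy classes of maps
for every `n`-precomplicial set `Z`. -/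

/-- The interval `J`: its `m`-simplices are all sequences of `m+1` vertices in a two-element set,
and all simplices of positive dimension are marked, each once. -/
def interval : TDeltaSet.{u} where
  obj a := Fin (a.unop.base.len + 1) → ULift.{u} Bool
  map θ := ↾ fun s => s ∘ (TDelta.Hom.val θ.unop).toOrderHom

/-- The inclusion `X ⟶ X × J` at an endpoint of the interval. -/
def cylinderEnd (X : TDeltaSet.{u}) (e : Bool) : X ⟶ FunctorToTypes.prod X interval.{u} where
  app _ := ↾ fun x => (x, fun _ => ⟨e⟩)

/-- There is a homotopy `X × J ⟶ Z` from `f` to `g`. -/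
def Homotopic {X Z : TDeltaSet.{u}} (f g : X ⟶ Z) : Prop :=
  ∃ H : FunctorToTypes.prod X interval.{u} ⟶ Z,
    cylinderEnd X false ≫ H = f ∧ cylinderEnd X true ≫ H = g

/-- Weak equivalences of the model structure for `(∞,n)`-categories: precomposition with `f` is
surjective and injective on homotopy classes of maps into `n`-precomplicial sets. -/
def IsWeakEquivalence (n : ℕ) {X Y : TDeltaSet.{u}} (f : X ⟶ Y) : Prop :=
  ∀ Z : TDeltaSet.{u}, IsPrecomplicial n Z →
    (∀ h : X ⟶ Z, ∃ g : Y ⟶ Z, Relation.EqvGen Homotopic (f ≫ g) h) ∧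
    (∀ g g' : Y ⟶ Z, Relation.EqvGen Homotopic (f ≫ g) (f ≫ g') →
      Relation.EqvGen Homotopic g g')

/-! ## The Street–Duskin nerve of a `2`-category -/

/-- A simplex of shape `I` of the Street–Duskin nerve of `C`: objects `xᵢ`, `1`-morphisms
`fᵢⱼ : xᵢ ⟶ xⱼ` for `i ≤ j` and `2`-morphisms `fᵢₖ ⟶ fᵢⱼ ≫ fⱼₖ` for `i ≤ j ≤ k`, which are
identities in the degenerate cases `i = j` and `j = k`, and which satisfy the relation that the two
pasting composites of each `3`-simplex `i ≤ j ≤ k ≤ l` agree. For `I = [m]` this is a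
`2`-functor `𝒪₂[m] ⟶ C` out of the `2`-truncated oriental, written out on generators. -/
@[ext]
structure NerveSimplex (I : Type) [Preorder I] (C : Type u) [Bicategory.{w, v} C] :
    Type (max u v w) where
  obj : I → C
  map : ∀ i j : I, i ≤ j → (obj i ⟶ obj j)
  cell : ∀ (i j k : I) (hij : i ≤ j) (hjk : j ≤ k),
    map i k (hij.trans hjk) ⟶ map i j hij ≫ map j k hjk
  map_self : ∀ i, map i i le_rfl = 𝟙 (obj i)
  cell_left : ∀ (i j : I) (hij : i ≤ j),
    cell i i j le_rfl hij ≫ eqToHom (map_self i) ▷ map i j hij ≫ (λ_ (map i j hij)).hom =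
      𝟙 (map i j hij)
  cell_right : ∀ (i j : I) (hij : i ≤ j),
    cell i j j hij le_rfl ≫ map i j hij ◁ eqToHom (map_self j) ≫ (ρ_ (map i j hij)).hom =
      𝟙 (map i j hij)
  cell_assoc : ∀ (i j k l : I) (hij : i ≤ j) (hjk : j ≤ k) (hkl : k ≤ l),
    cell i j l hij (hjk.trans hkl) ≫ map i j hij ◁ cell j k l hjk hkl =
      cell i k l (hij.trans hjk) hkl ≫ cell i j k hij hjk ▷ map k l hkl ≫
        (α_ (map i j hij) (map j k hjk) (map k l hkl)).hom

section Nerves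

variable (C : Type u) [Bicategory.{w, v} C]

variable {C} in
/-- The action of a monotone map on simplices. -/
def NerveSimplex.reindex {I J : Type} [Preorder I] [Preorder J] (θ : I →o J)
    (σ : NerveSimplex J C) : NerveSimplex I C where
  obj i := σ.obj (θ i)
  map i j h := σ.map (θ i) (θ j) (θ.monotone h)
  cell i j k hij hjk := σ.cell (θ i) (θ j) (θ k) (θ.monotone hij) (θ.monotone hjk)
  map_self i := σ.map_self (θ i)
  cell_left i j h := σ.cell_left (θ i) (θ j) (θ.monotone h)
  cell_right i j h := σ.cell_right (θ i) (θ j) (θ.monotone h)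
  cell_assoc i j k l hij hjk hkl :=
    σ.cell_assoc (θ i) (θ j) (θ k) (θ l) (θ.monotone hij) (θ.monotone hjk) (θ.monotone hkl)

/-- The Street–Duskin nerve of `C`. -/
def streetNerve : SSet.{max u v w} where
  obj n := NerveSimplex (Fin (n.unop.len + 1)) C
  map θ := ↾ NerveSimplex.reindex θ.unop.toOrderHom

variable {C}

/-- A `1`-morphism that is an identity. -/
def IsIdentity {x y : C} (f : x ⟶ y) : Prop := ∃ h : x = y, f = h ▸ 𝟙 x

/-- A `2`-morphism that is an identity. -/
def IsIdentity₂ {x y : C} {f g : x ⟶ y} (α : f ⟶ g) : Prop := ∃ h : f = g, α = eqToHom h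

/-- A `1`-morphism that is an isomorphism, i.e. has a strict inverse. -/
def IsIsomorphism {x y : C} (f : x ⟶ y) : Prop := ∃ g : y ⟶ x, f ≫ g = 𝟙 x ∧ g ≫ f = 𝟙 y

/-- The edge `f₀₁` of a `1`-simplex of the nerve. -/
def edge (σ : NerveSimplex (Fin 2) C) : σ.obj 0 ⟶ σ.obj 1 := σ.map 0 1 (by decide)

/-- The `2`-morphism `f₀₂ ⟶ f₀₁ ≫ f₁₂` of a `2`-simplex of the nerve. -/
def triangle (σ : NerveSimplex (Fin 3) C) :
    σ.map 0 2 (by decide) ⟶ σ.map 0 1 (by decide) ≫ σ.map 1 2 (by decide) :=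
  σ.cell 0 1 2 (by decide) (by decide)

/-- Markings of the Roberts–Street nerve: the `1`-simplices given by identities, the `2`-simplices
given by identity `2`-morphisms, and all simplices of dimension at least `3`. -/
def rsMarked : ∀ {m : ℕ}, (streetNerve C).obj (op (.mk (m + 1))) → Prop
  | 0, σ => IsIdentity (edge σ)
  | 1, σ => IsIdentity₂ (triangle σ)
  | _ + 2, _ => True

/-- Labels of the natural nerve: a label of a `1`-simplex is a completion of its `1`-morphism to an
adjoint equivalence (as left adjoint), a `2`-simplex has exactly one label if its
`2`-morphism is invertible and none otherwise, and a simplex of dimension at least `3`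
has exactly one label. -/
def NaturalLabel : ∀ {m : ℕ}, (streetNerve C).obj (op (.mk (m + 1))) → Type (max u v w)
  | 0, σ => ULift.{max u v w} {e : Bicategory.Equivalence (σ.obj 0) (σ.obj 1) // e.hom = edge σ}
  | 1, σ => ULift.{max u v w} (PLift (IsIso (triangle σ)))
  | _ + 2, _ => PUnit

/-- The identity adjoint equivalence on an identity `1`-morphism. -/
def identityEquivalence {x y : C} (f : x ⟶ y) (hf : IsIdentity f) :
    {e : Bicategory.Equivalence x y // e.hom = f} :=
  ⟨hf.fst ▸ Bicategory.Equivalence.id x, by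
    obtain ⟨h, hf⟩ := hf
    subst h
    exact hf.symm⟩

theorem NerveSimplex.isIdentity_map {I : Type} [Preorder I] (σ : NerveSimplex I C) (i j : I)
    (h : i ≤ j) (e : i = j) : IsIdentity (σ.map i j h) := by
  subst e
  exact ⟨rfl, σ.map_self i⟩

section

variable [Bicategory.Strict C]

theorem isIdentity₂_of_comp_eqToHom {x y : C} {f g : x ⟶ y} (α : f ⟶ g) (h : g = f)
    (hα : α ≫ eqToHom h = 𝟙 f) : IsIdentity₂ α := by
  subst h
  exact ⟨rfl, by simpa using hα⟩

theorem NerveSimplex.isIdentity₂_cell_left {I : Type} [Preorder I] (σ : NerveSimplex I C)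
    (i j k : I) (hij : i ≤ j) (hjk : j ≤ k) (e : i = j) :
    IsIdentity₂ (σ.cell i j k hij hjk) := by
  subst e
  have h := σ.cell_left i k hjk
  rw [Bicategory.eqToHom_whiskerRight, Bicategory.Strict.leftUnitor_eqToIso, eqToIso.hom,
    eqToHom_trans] at h
  exact isIdentity₂_of_comp_eqToHom _ _ h

theorem NerveSimplex.isIdentity₂_cell_right {I : Type} [Preorder I] (σ : NerveSimplex I C)
    (i j k : I) (hij : i ≤ j) (hjk : j ≤ k) (e : j = k) :
    IsIdentity₂ (σ.cell i j k hij hjk) := by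
  subst e
  have h := σ.cell_right i j hij
  rw [Bicategory.whiskerLeft_eqToHom, Bicategory.Strict.rightUnitor_eqToIso, eqToIso.hom,
    eqToHom_trans] at h
  exact isIdentity₂_of_comp_eqToHom _ _ h

theorem rsMarked_of_degenerate {m : ℕ} (σ : (streetNerve C).obj (op (.mk (m + 1))))
    (hσ : σ ∈ (streetNerve C).degenerate (m + 1)) : rsMarked σ := by
  obtain ⟨k, hk, θ, τ, rfl⟩ := hσ
  match m, hk, θ with
  | 0, hk, θ =>
    obtain rfl : k = 0 := by omega
    exact NerveSimplex.isIdentity_map (C := C) τ _ _ _ (Subsingleton.elim (α := Fin 1) _ _)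
  | 1, hk, θ =>
    have h01 : θ.toOrderHom 0 ≤ θ.toOrderHom 1 := θ.toOrderHom.monotone (by decide)
    have h12 : θ.toOrderHom 1 ≤ θ.toOrderHom 2 := θ.toOrderHom.monotone (by decide)
    by_cases h : θ.toOrderHom 0 = θ.toOrderHom 1
    · exact NerveSimplex.isIdentity₂_cell_left (C := C) τ _ _ _ h01 h12 h
    · refine NerveSimplex.isIdentity₂_cell_right (C := C) τ _ _ _ h01 h12 ?_
      have h0 := (θ.toOrderHom 0).isLt
      have h2 := (θ.toOrderHom 2).isLt
      simp only [SimplexCategory.len_mk] at h0 h2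
      rw [Fin.ext_iff] at h ⊢
      rw [Fin.le_def] at h01 h12
      omega
  | _ + 2, _, _ => trivial

/-- The label in the natural nerve of a marked simplex of the Roberts–Street nerve: the identity
adjoint equivalence for `1`-simplices, and the unique label in higher dimensions. -/
def naturalLabelOfRSMarked : ∀ {m : ℕ} (σ : (streetNerve C).obj (op (.mk (m + 1)))),
    rsMarked σ → NaturalLabel σ
  | 0, σ, h => ⟨identityEquivalence (edge σ) h⟩
  | 1, σ, h => ⟨⟨by obtain ⟨e, h⟩ := h; rw [h]; infer_instance⟩⟩
  | _ + 2, _, _ => PUnit.unit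

variable (C)

/-- The Roberts–Street nerve as a stratified simplicial set. -/
def robertsStreetLabelled : LabelledSSet.{max u v w} := stratify (streetNerve C) rsMarked

/-- The natural nerve as a simplicial set with labels. -/
def naturalLabelled : LabelledSSet.{max u v w} where
  X := streetNerve C
  Label := NaturalLabel
  deg σ hσ := naturalLabelOfRSMarked σ (rsMarked_of_degenerate σ hσ)

/-- The Roberts–Street nerve `N^RS₂(C)`. -/
noncomputable def robertsStreetNerve : TDeltaSet.{max u v w} :=
  (robertsStreetLabelled C).toTDeltaSet

/-- The natural nerve `N♮₂(C)`. -/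
noncomputable def naturalNerve : TDeltaSet.{max u v w} := (naturalLabelled C).toTDeltaSet

/-- The canonical inclusion `N^RS₂(C) ⟶ N♮₂(C)`: the identity on simplices, with
simplices witnessed by identities regarded as marked simplices of the natural nerve. -/
noncomputable def nerveInclusion : robertsStreetNerve C ⟶ naturalNerve C :=
  LabelledSSet.Hom.toTDeltaSet (S := robertsStreetLabelled C) (T := naturalLabelled C)
    { f := 𝟙 _
      l := fun σ h => naturalLabelOfRSMarked σ (h.down.down.elim (rsMarked_of_degenerate σ) id)
      l_deg := fun _ _ _ => rfl }

end

end Nerves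

/-!
A `tΔ`-set amounts to a simplicial set with labels, and a map of `tΔ`-sets is a simplicial map
together with a choice of images of the labels that are not forced by degeneracies
(`TDeltaSet.exists_hom_of_rel`; that the forced choices are consistent is the Eilenberg–Zilber
lemma). Therefore lifting along an inclusion of two stratifications of `Δ[n]` only means that, for
every `n`-simplex, the faces in the larger marking have labels as soon as those in the smaller one
do (`TDeltaSet.lift_markedSimplexInclusion_iff`).

*The natural nerve.* A simplex has a label iff it is an edge given by an equivalence, a triangle
with invertible `2`-morphism, or of dimension at least `3`. The thinness and saturation extensions
lift by the two-out-of-three and two-out-of-six properties. A complicial horn of dimension `2` is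
filled by composing with a quasi-inverse, one of dimension `3` by solving the pasting relation for
the missing `2`-morphism, one of dimension `4` by deducing the missing pasting relation from the
other four, and in higher dimensions there is nothing to choose or check
(`NerveSimplex.HornFamily.hasFiller`). This gives `isPrecomplicial_naturalNerve`.

*Generation of labels.* The labels of the natural nerve arise from those of the Roberts–Street nerve
in three rounds of elementary extensions. In the first one, a triangle with invertible `2`-morphism
whose last edge is an identity is exhibited as a face of a simplex of shape `Δ[0] ⋆ Δ[3]_eq`
(`NerveSimplex.exists_saturation_one`). In the second one, an arbitrary triangle with invertible
`2`-morphism `f₀₂ ⟶ f₀₁ ≫ f₁₂` is obtained by the thinness extension for `Δ[3]` from the first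
round, comparing it to the triangle of the composite `f₀₁ ≫ f₁₂` (`NerveSimplex.exists_thinness`).
In the third one, an equivalence `f` with quasi-inverse `g` is an edge of a simplex of shape
`Δ[3]_eq` with spine `f`, `g`, `f` (`NerveSimplex.exists_saturation_zero`).

*The Roberts–Street nerve.* If it is precomplicial, the same simplices show that isomorphisms and
invertible `2`-morphisms are identities. Conversely, if they are, every simplex marked in the
natural nerve is marked in the Roberts–Street nerve, which is thus a retract of the natural nerve.

*The inclusion.* As labels of the natural nerve are generated by elementary extensions, maps and
homotopies into precomplicial sets extend along the inclusion, with prescribed extensions at the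
ends of a homotopy; this gives `isWeakEquivalence_nerveInclusion`. Attaching all the elementary
extensions of the three rounds to the Roberts–Street nerve, in a well-order that refines the rounds,
is a transfinite composition of pushouts (`CellFamily.transfiniteCompositions_inclusion`). In the
third round there is one extension for each edge and each of its completions to an adjoint
equivalence. The result maps onto the natural nerve, and the natural nerve maps back to it by
choosing preimages of labels, so that the inclusion is a retract
(`anodyneExtension_nerveInclusion`).
-/

/-! ### Maps of `tΔ`-sets -/

namespace TDelta

/-- The morphism `[m] ⟶ [n]` of `tΔ` given by a monotone map. -/
def pl {m n : ℕ} (θ : SimplexCategory.mk m ⟶ SimplexCategory.mk n) : plain m ⟶ plain n :=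
  (⟨θ, fun h => h.elim⟩ : Hom (plain m) (plain n))

/-- The morphism `φ : [m+1] ⟶ [m+1]_t`. -/
def ph (m : ℕ) : plain (m + 1) ⟶ marked m :=
  (⟨𝟙 (SimplexCategory.mk (m + 1)), fun h => h.elim⟩ : Hom (plain (m + 1)) (marked m))

/-- The morphism `[m+1]_t ⟶ [n]` given by a monotone map that is not injective. -/
def ze {m n : ℕ} (θ : SimplexCategory.mk (m + 1) ⟶ SimplexCategory.mk n)
    (hθ : ¬ Function.Injective θ.toOrderHom) : marked m ⟶ plain n :=
  (⟨θ, fun _ h => (hθ h).elim⟩ : Hom (marked m) (plain n))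

theorem ph_ze {m n : ℕ} (θ : SimplexCategory.mk (m + 1) ⟶ SimplexCategory.mk n)
    (hθ : ¬ Function.Injective θ.toOrderHom) : ph m ≫ ze θ hθ = pl θ :=
  Subtype.ext (Category.id_comp θ)

theorem ze_pl {m n k : ℕ} (θ : SimplexCategory.mk (m + 1) ⟶ SimplexCategory.mk n)
    (ψ : SimplexCategory.mk n ⟶ SimplexCategory.mk k)
    (hθ : ¬ Function.Injective θ.toOrderHom) (hθψ : ¬ Function.Injective (θ ≫ ψ).toOrderHom) :
    ze (θ ≫ ψ) hθψ = ze θ hθ ≫ pl ψ := rfl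

theorem pl_comp {m n k : ℕ} (θ : SimplexCategory.mk m ⟶ SimplexCategory.mk n)
    (ψ : SimplexCategory.mk n ⟶ SimplexCategory.mk k) : pl (θ ≫ ψ) = pl θ ≫ pl ψ := rfl

/-- The inclusion of the simplex category into `tΔ`. -/
def plainFunctor : SimplexCategory ⥤ TDelta where
  obj n := plain n.len
  map θ := pl θ

theorem not_injective_comp {a b c : SimplexCategory} (θ : a ⟶ b) (ψ : b ⟶ c)
    (hθ : ¬ Function.Injective θ.toOrderHom) : ¬ Function.Injective (θ ≫ ψ).toOrderHom :=
  fun h => hθ fun _ _ hxy => h (congrArg ψ.toOrderHom hxy)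

end TDelta

open TDelta

namespace TDeltaSet

variable {A B E : TDeltaSet.{u}}

/-- The simplicial set of unmarked simplices of a `tΔ`-set. -/
abbrev sset (A : TDeltaSet.{u}) : SSet.{u} := plainFunctor.op ⋙ A

theorem map_map {a b c : TDelta} (θ : a ⟶ b) (ψ : b ⟶ c) (x : A.obj (op c)) :
    A.map θ.op (A.map ψ.op x) = A.map (θ ≫ ψ).op x := by
  rw [op_comp, A.map_comp]; rfl

theorem app_map (f : A ⟶ B) {a b : TDelta} (θ : a ⟶ b) (x : A.obj (op b)) :
    f.app (op a) (A.map θ.op x) = B.map θ.op (f.app (op b) x) :=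
  NatTrans.naturality_apply f _ _

theorem map_ph_ze {m n : ℕ} (θ : SimplexCategory.mk (m + 1) ⟶ SimplexCategory.mk n)
    (hθ : ¬ Function.Injective θ.toOrderHom) (b : A.obj (op (plain n))) :
    A.map (ph m).op (A.map (ze θ hθ).op b) = A.map (pl θ).op b := by
  rw [map_map, ph_ze]

/-- Every degenerate labelled simplex comes from a nondegenerate simplex along a surjection. -/
theorem exists_nonDegenerate_ze {m n : ℕ}
    (θ : SimplexCategory.mk (m + 1) ⟶ SimplexCategory.mk n)
    (hθ : ¬ Function.Injective θ.toOrderHom) (b : A.obj (op (plain n))) :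
    ∃ (k : ℕ) (f : SimplexCategory.mk (m + 1) ⟶ SimplexCategory.mk k) (_ : Epi f)
      (hf : ¬ Function.Injective f.toOrderHom) (z : A.obj (op (plain k)))
      (_ : z ∈ A.sset.nonDegenerate k),
      A.map (ze θ hθ).op b = A.map (ze f hf).op z := by
  let p := Limits.factorThruImage θ
  let q := Limits.image.ι θ
  have hpq : p ≫ q = θ := Limits.image.fac θ
  have hp : ¬ Function.Injective p.toOrderHom := by
    intro h
    apply hθ
    rw [← hpq]
    exact (SimplexCategory.mono_iff_injective.1 (inferInstance : Mono q)).comp h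
  obtain ⟨k, ρ, hρ, z, hz', hz⟩ : ∃ (k : ℕ)
      (ρ : SimplexCategory.mk (Limits.image θ).len ⟶ SimplexCategory.mk k) (_ : Epi ρ)
      (z : A.obj (op (plain k))) (_ : z ∈ A.sset.nonDegenerate k),
      A.map (pl q).op b = A.map (pl ρ).op z := by
    obtain ⟨k, ρ, hρ, z, hz⟩ := A.sset.exists_nonDegenerate (n := (Limits.image θ).len)
      (A.map (pl q).op b)
    exact ⟨k, ρ, hρ, z.1, z.2, hz⟩
  refine ⟨k, p ≫ ρ, epi_comp _ _, not_injective_comp _ _ hp, z, hz', ?_⟩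
  have h1 : ze θ hθ = ze p hp ≫ pl q := Subtype.ext hpq.symm
  rw [h1, ze_pl p ρ hp, ← map_map, ← map_map, hz]

/-- The label of a degenerate simplex that is induced by a degeneracy depends only on the simplex:
this is a consequence of the Eilenberg–Zilber lemma. -/
theorem map_ze_eq {m n n' : ℕ} (θ : SimplexCategory.mk (m + 1) ⟶ SimplexCategory.mk n)
    (hθ : ¬ Function.Injective θ.toOrderHom) (b : A.obj (op (plain n)))
    (θ' : SimplexCategory.mk (m + 1) ⟶ SimplexCategory.mk n')
    (hθ' : ¬ Function.Injective θ'.toOrderHom) (b' : A.obj (op (plain n')))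
    (h : A.map (pl θ).op b = A.map (pl θ').op b') :
    A.map (ze θ hθ).op b = A.map (ze θ' hθ').op b' := by
  rw [← map_ph_ze θ hθ, ← map_ph_ze θ' hθ'] at h
  obtain ⟨k, f, _, hf, z, hz, e⟩ := exists_nonDegenerate_ze θ hθ b
  obtain ⟨k', f', _, hf', z', hz', e'⟩ := exists_nonDegenerate_ze θ' hθ' b'
  rw [e, e'] at h ⊢
  rw [map_ph_ze, map_ph_ze] at h
  obtain rfl := A.sset.unique_nonDegenerate_dim (A.map (pl f).op z) f ⟨z, hz⟩ rfl f' ⟨z', hz'⟩ h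
  obtain rfl := congrArg Subtype.val (A.sset.unique_nonDegenerate_simplex (A.map (pl f).op z) f
    ⟨z, hz⟩ rfl f' ⟨z', hz'⟩ h)
  obtain rfl := A.sset.unique_nonDegenerate_map (A.map (pl f).op z) f ⟨z, hz⟩ rfl f' ⟨z, hz⟩ h
  rfl

/-- A labelled simplex is degenerate if it is induced by a degeneracy from an unmarked simplex. -/
def IsDegenerate {m : ℕ} (y : A.obj (op (marked m))) : Prop :=
  ∃ (n : ℕ) (θ : SimplexCategory.mk (m + 1) ⟶ SimplexCategory.mk n)
    (hθ : ¬ Function.Injective θ.toOrderHom) (b : A.obj (op (plain n))),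
    y = A.map (ze θ hθ).op b

/-- An unmarked simplex that has a label. -/
def IsLabelled {m : ℕ} (a : A.obj (op (plain (m + 1)))) : Prop :=
  ∃ y : A.obj (op (marked m)), A.map (ph m).op y = a

theorem IsLabelled.app {m : ℕ} {a : A.obj (op (plain (m + 1)))} (h : IsLabelled a) (f : A ⟶ B) :
    IsLabelled (f.app _ a) := by
  obtain ⟨y, rfl⟩ := h
  exact ⟨f.app _ y, (app_map f _ _).symm⟩

/-- A map between the simplicial sets of unmarked simplices of two `tΔ`-sets. -/
structure PlainMap (A E : TDeltaSet.{u}) where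
  app : ∀ n, A.obj (op (plain n)) → E.obj (op (plain n))
  comm : ∀ {m n : ℕ} (θ : SimplexCategory.mk m ⟶ SimplexCategory.mk n) (b : A.obj (op (plain n))),
    app m (A.map (pl θ).op b) = E.map (pl θ).op (app n b)

/-- The data of a map of `tΔ`-sets: a map of the unmarked simplices and a map of the labels. -/
def homMk (s : PlainMap A E) (l : ∀ m, A.obj (op (marked m)) → E.obj (op (marked m)))
    (h1 : ∀ m y, E.map (ph m).op (l m y) = s.app (m + 1) (A.map (ph m).op y))
    (h2 : ∀ m n (θ : SimplexCategory.mk (m + 1) ⟶ SimplexCategory.mk n)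
      (hθ : ¬ Function.Injective θ.toOrderHom) (b : A.obj (op (plain n))),
      l m (A.map (ze θ hθ).op b) = E.map (ze θ hθ).op (s.app n b)) : A ⟶ E where
  app a := match a with
    | ⟨plain n⟩ => ↾ s.app n
    | ⟨marked m⟩ => ↾ l m
  naturality := by
    rintro ⟨b⟩ ⟨a⟩ θ
    obtain ⟨θ, rfl⟩ : ∃ θ' : a ⟶ b, θ = θ'.op := ⟨θ.unop, rfl⟩
    ext x
    cases a with
    | plain m =>
      cases b with
      | plain n => exact s.comm θ.1 x
      | marked n =>
        obtain ⟨ψ, rfl⟩ : ∃ ψ : SimplexCategory.mk m ⟶ SimplexCategory.mk (n + 1),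
          θ = pl ψ ≫ ph n := ⟨θ.1, Subtype.ext (Category.comp_id _).symm⟩
        change s.app m (A.map (pl ψ ≫ ph n).op x) = E.map (pl ψ ≫ ph n).op (l n x)
        rw [← map_map, ← map_map, s.comm, h1]
    | marked m =>
      by_cases hθ : Function.Injective (Hom.val θ).toOrderHom
      · obtain rfl := Hom.prop θ trivial hθ
        obtain rfl : θ = 𝟙 _ := Subtype.ext (eq_id_of_injective _ hθ)
        change l m (A.map (𝟙 _) x) = E.map (𝟙 _) (l m x)
        rw [A.map_id, E.map_id]
        rfl
      · cases b with
        | plain n => exact h2 m n θ.1 hθ x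
        | marked n =>
          obtain ⟨ψ, hψ, rfl⟩ : ∃ (ψ : SimplexCategory.mk (m + 1) ⟶ SimplexCategory.mk (n + 1))
            (hψ : ¬ Function.Injective ψ.toOrderHom), θ = ze ψ hψ ≫ ph n :=
            ⟨θ.1, hθ, Subtype.ext (Category.comp_id _).symm⟩
          change l m (A.map (ze ψ hψ ≫ ph n).op x) = E.map (ze ψ hψ ≫ ph n).op (l n x)
          rw [← map_map, ← map_map, h2, h1]

theorem hom_ext {f g : A ⟶ E}
    (h1 : ∀ n (a : A.obj (op (plain n))), f.app _ a = g.app _ a)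
    (h2 : ∀ m (y : A.obj (op (marked m))), ¬ IsDegenerate y → f.app _ y = g.app _ y) : f = g := by
  ext a x
  obtain ⟨a⟩ := a
  change f.app _ x = g.app _ x
  cases a with
  | plain n => exact h1 n x
  | marked m =>
    by_cases h : IsDegenerate x
    · obtain ⟨n, θ, hθ, b, rfl⟩ := h
      rw [app_map, app_map, h1]
    · exact h2 m x h

/-- A map of unmarked simplices extends to labels as soon as every nondegenerate labelled simplex
is sent to a simplex that has a label; the latter may be chosen freely. -/
theorem exists_hom_of_rel (s : PlainMap A E)
    (R : ∀ m, A.obj (op (marked m)) → E.obj (op (marked m)) → Prop)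
    (h : ∀ m y, ¬ IsDegenerate y → ∃ e, E.map (ph m).op e =
      s.app (m + 1) (A.map (ph m).op y) ∧ R m y e) :
    ∃ g : A ⟶ E, (∀ n (a : A.obj (op (plain n))), g.app _ a = s.app n a) ∧
      ∀ m y, ¬ IsDegenerate y → R m y (g.app _ y) := by
  classical
  have key : ∀ m (y : A.obj (op (marked m))), ∃ e : E.obj (op (marked m)),
      E.map (ph m).op e = s.app (m + 1) (A.map (ph m).op y) ∧
      (¬ IsDegenerate y → R m y e) ∧
      ∀ n (θ : SimplexCategory.mk (m + 1) ⟶ SimplexCategory.mk n)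
        (hθ : ¬ Function.Injective θ.toOrderHom) (b : A.obj (op (plain n))),
        y = A.map (ze θ hθ).op b → e = E.map (ze θ hθ).op (s.app n b) := by
    intro m y
    by_cases hy : IsDegenerate y
    · have hy' := hy
      obtain ⟨n, θ, hθ, b, rfl⟩ := hy
      refine ⟨E.map (ze θ hθ).op (s.app n b), ?_, fun h => (h hy').elim, ?_⟩
      · rw [map_ph_ze, map_ph_ze, s.comm]
      · intro n' θ' hθ' b' e
        apply map_ze_eq
        rw [← s.comm, ← s.comm, ← map_ph_ze θ hθ, ← map_ph_ze θ' hθ', e]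
    · obtain ⟨e, he, hR⟩ := h m y hy
      exact ⟨e, he, fun _ => hR, fun n θ hθ b e => (hy ⟨n, θ, hθ, b, e⟩).elim⟩
  choose l hl hR hd using key
  exact ⟨homMk s l hl (fun m n θ hθ b => hd m _ n θ hθ b rfl), fun _ _ => rfl, fun m y => hR m y⟩

/-- If a monomorphism of `tΔ`-sets sends a labelled simplex to a degenerate one, it is
degenerate. -/
theorem isDegenerate_of_app (i : A ⟶ B) (hi : ∀ a, Function.Injective (i.app a)) {m : ℕ}
    {y : A.obj (op (marked m))} (hy : IsDegenerate (i.app _ y)) : IsDegenerate y := by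
  obtain ⟨n, θ, hθ, b, e⟩ := hy
  let si : A.sset ⟶ B.sset := Functor.whiskerLeft plainFunctor.op i
  have : Mono si := by
    have : ∀ a, Mono (si.app a) := fun a => (mono_iff_injective _).2 (hi _)
    exact NatTrans.mono_of_mono_app si
  have e' : i.app _ (A.map (ph m).op y) = B.map (pl θ).op b := by
    rw [app_map, e, map_ph_ze]
  have h1 : si.app (op (.mk (m + 1))) (A.map (ph m).op y : A.obj (op (plain (m + 1)))) ∈
      B.sset.degenerate (m + 1) := by
    have h : B.sset.map θ.op b ∈ B.sset.degenerate (m + 1) :=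
      LabelledSSet.degenerate_of_not_injective B.sset θ hθ b
    exact e' ▸ h
  have h2 := (SSet.degenerate_iff_of_mono (n := m + 1) si
    (A.map (ph m).op y : A.obj (op (plain (m + 1))))).1 h1
  obtain ⟨k, hk, ψ, c, hc⟩ : ∃ (k : ℕ) (_ : k < m + 1)
      (ψ : SimplexCategory.mk (m + 1) ⟶ SimplexCategory.mk k)
      (c : A.obj (op (plain k))), A.map (pl ψ).op c = A.map (ph m).op y := by
    obtain ⟨k, hk, ψ, c, hc⟩ := h2
    exact ⟨k, hk, ψ, c, hc⟩
  have hψ : ¬ Function.Injective ψ.toOrderHom := fun h => by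
    have := Fintype.card_le_of_injective _ h
    simp at this
    omega
  refine ⟨k, ψ, hψ, c, hi _ ?_⟩
  rw [e, app_map]
  apply map_ze_eq
  rw [← map_ph_ze θ hθ, ← e, ← app_map, ← app_map, hc]

/-- Extension of a map `u` along a monomorphism `i`, given an extension `s` to the unmarked
simplices. -/
theorem exists_extension (i : A ⟶ B) (hi : ∀ a, Function.Injective (i.app a)) (u : A ⟶ E)
    (s : PlainMap B E)
    (hs : ∀ n (a : A.obj (op (plain n))), s.app n (i.app _ a) = u.app _ a)
    (h : ∀ m (y : B.obj (op (marked m))), ¬ IsDegenerate y → (∀ a, i.app _ a ≠ y) →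
      IsLabelled (s.app (m + 1) (B.map (ph m).op y))) :
    ∃ g : B ⟶ E, i ≫ g = u ∧ ∀ n (a : B.obj (op (plain n))), g.app _ a = s.app n a := by
  obtain ⟨g, hg1, hg2⟩ := exists_hom_of_rel s (fun m y e => ∀ a, i.app _ a = y → e = u.app _ a) (by
    intro m y hy
    by_cases hy' : ∃ a, i.app _ a = y
    · obtain ⟨a, rfl⟩ := hy'
      refine ⟨u.app _ a, ?_, fun a' ha' => by rw [hi _ ha']⟩
      rw [← app_map, ← app_map, hs]
    · push Not at hy'
      obtain ⟨e, he⟩ := h m y hy hy'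
      exact ⟨e, he, fun a ha => (hy' a ha).elim⟩)
  refine ⟨g, hom_ext (fun n a => ?_) (fun m y hy => ?_), hg1⟩
  · exact (hg1 n _).trans (hs n a)
  · exact hg2 m (i.app _ y) (fun h => hy (isDegenerate_of_app i hi h)) y rfl

end TDeltaSet

/-! ### Simplicial sets with labels and stratifications of standard simplices -/

namespace LabelledSSet

variable (S : LabelledSSet.{u})

/-- The labelled simplex given by a simplex and one of its labels. -/
def lab {m : ℕ} (x : S.X.obj (op (.mk (m + 1)))) (l : S.Label x) :
    S.toTDeltaSet.obj (op (marked m)) := (⟨x, l⟩ : Σ x : S.X.obj (op (.mk (m + 1))), S.Label x)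

/-- An unmarked simplex, as an element of the associated `tΔ`-set. -/
def unm {m : ℕ} (x : S.X.obj (op (.mk m))) : S.toTDeltaSet.obj (op (plain m)) := x

/-- The simplex underlying an unmarked simplex of the associated `tΔ`-set. -/
def sim {m : ℕ} (x : S.toTDeltaSet.obj (op (plain m))) : S.X.obj (op (.mk m)) := x

theorem exists_lab {m : ℕ} (y : S.toTDeltaSet.obj (op (marked m))) : ∃ x l, y = S.lab x l :=
  ⟨y.1, y.2, rfl⟩

theorem map_ph_lab {m : ℕ} (x : S.X.obj (op (.mk (m + 1)))) (l : S.Label x) :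
    S.toTDeltaSet.map (ph m).op (S.lab x l) = S.unm x := by
  change S.X.map (𝟙 (SimplexCategory.mk (m + 1))).op x = x
  rw [op_id, S.X.map_id]
  rfl

theorem map_ze_unm {m n : ℕ} (θ : SimplexCategory.mk (m + 1) ⟶ SimplexCategory.mk n)
    (hθ : ¬ Function.Injective θ.toOrderHom) (x : S.X.obj (op (.mk n))) :
    S.toTDeltaSet.map (ze θ hθ).op (S.unm x) =
      S.lab (S.X.map θ.op x) (S.deg _ (degenerate_of_not_injective S.X θ hθ x)) :=
  S.map_of_not_injective (b := .plain n) (ze θ hθ) hθ x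

theorem isLabelled_iff {m : ℕ} (x : S.X.obj (op (.mk (m + 1)))) :
    TDeltaSet.IsLabelled (S.unm x) ↔ Nonempty (S.Label x) := by
  constructor
  · rintro ⟨y, hy⟩
    obtain ⟨x', l, rfl⟩ := S.exists_lab y
    rw [map_ph_lab] at hy
    obtain rfl : x' = x := hy
    exact ⟨l⟩
  · rintro ⟨l⟩
    exact ⟨S.lab x l, S.map_ph_lab x l⟩

theorem isDegenerate_lab {m : ℕ} (x : S.X.obj (op (.mk (m + 1))))
    (hx : x ∈ S.X.degenerate (m + 1)) :
    TDeltaSet.IsDegenerate (S.lab x (S.deg x hx)) := by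
  have hx' := hx
  obtain ⟨k, hk, θ, z, hz⟩ := hx'
  have hθ : ¬ Function.Injective θ.toOrderHom := fun h => by
    have := Fintype.card_le_of_injective _ h
    simp at this
    omega
  refine ⟨k, θ, hθ, S.unm z, ?_⟩
  rw [map_ze_unm]
  exact deg_congr hz.symm _ _

theorem isDegenerate_iff {m : ℕ} (x : S.X.obj (op (.mk (m + 1)))) (l : S.Label x) :
    TDeltaSet.IsDegenerate (S.lab x l) ↔
      ∃ hx : x ∈ S.X.degenerate (m + 1), l = S.deg x hx := by
  constructor
  · rintro ⟨n, θ, hθ, b, h⟩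
    have h' : (⟨x, l⟩ : Σ x : S.X.obj (op (.mk (m + 1))), S.Label x) =
        ⟨S.X.map θ.op b, S.deg _ (degenerate_of_not_injective S.X θ hθ b)⟩ :=
      h.trans (S.map_ze_unm θ hθ b)
    obtain ⟨rfl, h2⟩ := Sigma.mk.inj_iff.1 h'
    exact ⟨_, eq_of_heq h2⟩
  · rintro ⟨hx, rfl⟩
    exact S.isDegenerate_lab x hx

/-- The unmarked part of a map of simplicial sets with labels. -/
def Hom.toPlainMap {S T : LabelledSSet.{u}} (f : S.X ⟶ T.X) :
    TDeltaSet.PlainMap S.toTDeltaSet T.toTDeltaSet where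
  app _ x := T.unm (f.app _ (S.sim x))
  comm θ b := NatTrans.naturality_apply f θ.op b

end LabelledSSet

theorem stratify_label_eq {X : SSet.{u}} {M : ∀ {m : ℕ}, X.obj (op (.mk (m + 1))) → Prop} {m : ℕ}
    {x : X.obj (op (.mk (m + 1)))} (l l' : (stratify X M).Label x) : l = l' := by
  obtain ⟨⟨l⟩⟩ := l
  obtain ⟨⟨l'⟩⟩ := l'
  rfl

namespace TDeltaSet

variable {A E : TDeltaSet.{u}}

/-- The faces of an unmarked simplex whose vertex sets are in `P` have labels. -/
def FacesLabelled {n : ℕ} (P : Set (Set (Fin (n + 1)))) (a : E.obj (op (plain n))) : Prop :=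
  ∀ m (x : SimplexCategory.mk (m + 1) ⟶ SimplexCategory.mk n), Function.Injective x.toOrderHom →
    Set.range x.toOrderHom ∈ P → IsLabelled (E.map (pl x).op a)

/-- A simplex of the standard simplex, as a simplex of a stratification of it. -/
def face {n k : ℕ} (P : Set (Set (Fin (n + 1)))) (x : SimplexCategory.mk k ⟶ SimplexCategory.mk n) :
    (markedSimplex.{u} n P).obj (op (plain k)) :=
  (SSet.stdSimplex.objEquiv.symm x : (SSet.stdSimplex.{u}.obj (.mk n)).obj (op (.mk k)))

theorem exists_face {n k : ℕ} {P : Set (Set (Fin (n + 1)))}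
    (y : (markedSimplex.{u} n P).obj (op (plain k))) : ∃ x, y = face P x :=
  ⟨SSet.stdSimplex.objEquiv (n := .mk n) (m := op (.mk k)) y, rfl⟩

theorem map_face {n k l : ℕ} (P : Set (Set (Fin (n + 1))))
    (x : SimplexCategory.mk k ⟶ SimplexCategory.mk n)
    (θ : SimplexCategory.mk l ⟶ SimplexCategory.mk k) :
    (markedSimplex.{u} n P).map (pl θ).op (face P x) = face P (θ ≫ x) := rfl

/-- The map from the unmarked simplices of a stratification of the standard simplex that is given by
a simplex. -/
def PlainMap.ofSimplex {n : ℕ} (P : Set (Set (Fin (n + 1)))) (a : E.obj (op (plain n))) :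
    PlainMap (markedSimplex.{u} n P) E where
  app k x := E.map (pl (SSet.stdSimplex.objEquiv (n := .mk n) (m := op (.mk k)) x)).op a
  comm {k l} θ x := by
    obtain ⟨x, rfl⟩ := exists_face x
    rw [map_face]
    change E.map (pl (θ ≫ x)).op a = E.map (pl θ).op (E.map (pl x).op a)
    rw [map_map, pl_comp]

theorem PlainMap.ofSimplex_app {n : ℕ} (P : Set (Set (Fin (n + 1)))) (a : E.obj (op (plain n)))
    {k : ℕ} (x : SimplexCategory.mk k ⟶ SimplexCategory.mk n) :
    (PlainMap.ofSimplex P a).app k (face P x) = E.map (pl x).op a := rfl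

/-- A labelled simplex of a stratification of the standard simplex is degenerate or given by a
face. -/
theorem exists_face_of_not_isDegenerate {n m : ℕ} {P : Set (Set (Fin (n + 1)))}
    (y : (markedSimplex.{u} n P).obj (op (marked m))) (hy : ¬ IsDegenerate y) :
    ∃ x : SimplexCategory.mk (m + 1) ⟶ SimplexCategory.mk n, Function.Injective x.toOrderHom ∧
      Set.range x.toOrderHom ∈ P ∧ (markedSimplex.{u} n P).map (ph m).op y = face P x := by
  obtain ⟨x, l, rfl⟩ := LabelledSSet.exists_lab _ y
  have hx : x ∉ (SSet.stdSimplex.{u}.obj (.mk n)).degenerate (m + 1) := by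
    intro hx
    exact hy ((LabelledSSet.isDegenerate_iff _ x l).2 ⟨hx, rfl⟩)
  refine ⟨SSet.stdSimplex.objEquiv x, ?_, l.down.down.resolve_left hx,
    LabelledSSet.map_ph_lab _ x l⟩
  by_contra hx'
  apply hx
  have := LabelledSSet.degenerate_of_not_injective (SSet.stdSimplex.{u}.obj (.mk n))
    (SSet.stdSimplex.objEquiv x) hx' (SSet.stdSimplex.objEquiv.symm (𝟙 _))
  rw [SSet.stdSimplex.map_objEquiv_symm, Quiver.Hom.unop_op, Category.comp_id] at this
  exact this

theorem exists_hom_markedSimplex {n : ℕ} (P : Set (Set (Fin (n + 1)))) (a : E.obj (op (plain n)))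
    (h : FacesLabelled P a) : ∃ g : markedSimplex.{u} n P ⟶ E,
      ∀ k (x : SimplexCategory.mk k ⟶ SimplexCategory.mk n),
        g.app _ (face P x) = E.map (pl x).op a := by
  obtain ⟨g, hg, -⟩ := exists_hom_of_rel (PlainMap.ofSimplex P a) (fun _ _ _ => True) (by
    intro m y hy
    obtain ⟨x, hx, hxP, e⟩ := exists_face_of_not_isDegenerate y hy
    obtain ⟨l, hl⟩ := h m x hx hxP
    exact ⟨l, by rw [hl, e]; rfl, trivial⟩)
  exact ⟨g, fun k x => hg k _⟩

theorem isLabelled_face {n : ℕ} {P : Set (Set (Fin (n + 1)))} {m : ℕ}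
    (x : SimplexCategory.mk (m + 1) ⟶ SimplexCategory.mk n) (hx : Set.range x.toOrderHom ∈ P) :
    IsLabelled (face.{u} P x) :=
  (LabelledSSet.isLabelled_iff (stratify (SSet.stdSimplex.{u}.obj (.mk n))
    (fun x => vertexSet x ∈ P)) (SSet.stdSimplex.objEquiv.symm x)).2 ⟨⟨⟨Or.inr hx⟩⟩⟩

theorem markedSimplexInclusion_injective {n : ℕ} {P Q : Set (Set (Fin (n + 1)))} (h : P ⊆ Q) (a) :
    Function.Injective ((markedSimplexInclusion.{u} n h).app a) := by
  obtain ⟨a⟩ := a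
  cases a with
  | plain k => exact fun _ _ h => h
  | marked k =>
    intro y y' e
    obtain ⟨x, l, rfl⟩ := LabelledSSet.exists_lab _ y
    obtain ⟨x', l', rfl⟩ := LabelledSSet.exists_lab _ y'
    obtain rfl : x = x' := congrArg Sigma.fst e
    exact congrArg _ (stratify_label_eq l l')

theorem markedSimplexInclusion_face {n : ℕ} {P Q : Set (Set (Fin (n + 1)))} (h : P ⊆ Q) {k : ℕ}
    (x : SimplexCategory.mk k ⟶ SimplexCategory.mk n) :
    (markedSimplexInclusion.{u} n h).app _ (face P x) = face Q x := rfl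

/-- A `tΔ`-set has the right lifting property against an inclusion between two stratifications of
the standard simplex if and only if the corresponding labels exist. -/
theorem lift_markedSimplexInclusion_iff {n : ℕ} {P Q : Set (Set (Fin (n + 1)))} (h : P ⊆ Q) :
    (∀ f : markedSimplex.{u} n P ⟶ E, ∃ g : markedSimplex.{u} n Q ⟶ E,
      markedSimplexInclusion.{u} n h ≫ g = f) ↔
    ∀ a : E.obj (op (plain n)), FacesLabelled P a → FacesLabelled Q a := by
  constructor
  · intro H a ha m x _ hxQ
    obtain ⟨f, hf⟩ := exists_hom_markedSimplex P a ha
    obtain ⟨g, rfl⟩ := H f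
    have := (isLabelled_face.{u} x hxQ).app g
    rw [← markedSimplexInclusion_face h x] at this
    rw [← hf]
    exact this
  · intro H f
    have hf : ∀ k (x : SimplexCategory.mk k ⟶ SimplexCategory.mk n),
        E.map (pl x).op (f.app _ (face P (𝟙 _))) = f.app _ (face P x) := by
      intro k x
      rw [← app_map, map_face, Category.comp_id]
    have ha : FacesLabelled Q (f.app _ (face P (𝟙 _))) := by
      apply H
      intro m x _ hx
      rw [hf]
      exact (isLabelled_face.{u} x hx).app f
    obtain ⟨g, hg, -⟩ := exists_extension (markedSimplexInclusion.{u} n h)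
      (markedSimplexInclusion_injective h) f
      (PlainMap.ofSimplex Q (f.app _ (face P (𝟙 _)))) (by
        intro k x
        obtain ⟨x, rfl⟩ := exists_face x
        rw [markedSimplexInclusion_face, PlainMap.ofSimplex_app, hf]) (by
        intro m y hy _
        obtain ⟨x, hx, hxQ, e⟩ := exists_face_of_not_isDegenerate y hy
        rw [e, PlainMap.ofSimplex_app]
        exact ha m x hx hxQ)
    exact ⟨g, hg⟩

end TDeltaSet

/-! ### Equivalences in a bicategory -/

section Bicat

variable {C : Type u} [Bicategory.{w, v} C]

/-- A `1`-morphism that is the left adjoint of an adjoint equivalence. -/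
def IsEquivalence₁ {x y : C} (f : x ⟶ y) : Prop :=
  Nonempty {e : Bicategory.Equivalence x y // e.hom = f}

theorem IsEquivalence₁.of_isos {x y : C} {f : x ⟶ y} {g : y ⟶ x} (η : 𝟙 x ≅ f ≫ g)
    (e : g ≫ f ≅ 𝟙 y) :
    IsEquivalence₁ f :=
  ⟨⟨.mkOfAdjointifyCounit η e, rfl⟩⟩

theorem IsEquivalence₁.exists_inverse {x y : C} {f : x ⟶ y} (hf : IsEquivalence₁ f) :
    ∃ g : y ⟶ x, IsEquivalence₁ g ∧ Nonempty (𝟙 x ≅ f ≫ g) ∧ Nonempty (g ≫ f ≅ 𝟙 y) := by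
  obtain ⟨e, rfl⟩ := hf
  exact ⟨e.inv, .of_isos e.counit.symm e.unit.symm, ⟨e.unit⟩, ⟨e.counit⟩⟩

theorem IsEquivalence₁.of_iso {x y : C} {f f' : x ⟶ y} (hf : IsEquivalence₁ f) (φ : f ≅ f') :
    IsEquivalence₁ f' := by
  obtain ⟨g, -, ⟨η⟩, ⟨e⟩⟩ := hf.exists_inverse
  exact .of_isos (η ≪≫ Bicategory.whiskerRightIso φ g)
    ((Bicategory.whiskerLeftIso g φ).symm ≪≫ e)

theorem IsEquivalence₁.id (x : C) : IsEquivalence₁ (𝟙 x) := ⟨⟨.id x, rfl⟩⟩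

theorem IsEquivalence₁.comp {x y z : C} {f : x ⟶ y} {g : y ⟶ z} (hf : IsEquivalence₁ f)
    (hg : IsEquivalence₁ g) :
    IsEquivalence₁ (f ≫ g) := by
  obtain ⟨f', -, ⟨η⟩, ⟨e⟩⟩ := hf.exists_inverse
  obtain ⟨g', -, ⟨η'⟩, ⟨e'⟩⟩ := hg.exists_inverse
  refine .of_isos (g := g' ≫ f') ?_ ?_
  · exact η ≪≫ Bicategory.whiskerLeftIso f ((λ_ f').symm ≪≫ Bicategory.whiskerRightIso η' f' ≪≫
      α_ _ _ _) ≪≫ (α_ _ _ _).symm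
  · exact α_ _ _ _ ≪≫ Bicategory.whiskerLeftIso g' ((α_ _ _ _).symm ≪≫
      Bicategory.whiskerRightIso e g ≪≫ λ_ g) ≪≫ e'

theorem IsEquivalence₁.of_left_right {x y : C} {g : x ⟶ y} {a b : y ⟶ x} (e : a ≫ g ≅ 𝟙 y)
    (η : 𝟙 x ≅ g ≫ b) : IsEquivalence₁ g :=
  have φ : b ≅ a := (λ_ b).symm ≪≫ Bicategory.whiskerRightIso e.symm b ≪≫ α_ _ _ _ ≪≫
    Bicategory.whiskerLeftIso a η.symm ≪≫ ρ_ a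
  .of_isos (η ≪≫ Bicategory.whiskerLeftIso g φ) e

theorem IsEquivalence₁.of_comp_left {x y z : C} {f : x ⟶ y} {g : y ⟶ z} (hf : IsEquivalence₁ f)
    (hfg : IsEquivalence₁ (f ≫ g)) : IsEquivalence₁ g := by
  obtain ⟨f', hf', -, ⟨e⟩⟩ := hf.exists_inverse
  exact (hf'.comp hfg).of_iso ((α_ _ _ _).symm ≪≫ Bicategory.whiskerRightIso e g ≪≫ λ_ g)

theorem IsEquivalence₁.of_comp_right {x y z : C} {f : x ⟶ y} {g : y ⟶ z} (hg : IsEquivalence₁ g)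
    (hfg : IsEquivalence₁ (f ≫ g)) : IsEquivalence₁ f := by
  obtain ⟨g', hg', ⟨η⟩, -⟩ := hg.exists_inverse
  exact (hfg.comp hg').of_iso (α_ _ _ _ ≪≫ Bicategory.whiskerLeftIso f η.symm ≪≫ ρ_ f)

/-- Equivalences satisfy the two-out-of-six property. -/
theorem IsEquivalence₁.two_of_six {x y z t : C} {f : x ⟶ y} {g : y ⟶ z} {h : z ⟶ t}
    (hfg : IsEquivalence₁ (f ≫ g)) (hgh : IsEquivalence₁ (g ≫ h)) : IsEquivalence₁ g := by
  obtain ⟨k, -, -, ⟨e⟩⟩ := hfg.exists_inverse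
  obtain ⟨l, -, ⟨η⟩, -⟩ := hgh.exists_inverse
  exact .of_left_right (a := k ≫ f) (b := h ≫ l) (α_ _ _ _ ≪≫ e) (η ≪≫ α_ _ _ _)

theorem IsEquivalence₁.isEquivalence_precomposing {x y : C} {f : x ⟶ y} (hf : IsEquivalence₁ f)
    (z : C) :
    ((Bicategory.precomposing x y z).obj f).IsEquivalence := by
  obtain ⟨g, -, ⟨η⟩, ⟨e⟩⟩ := hf.exists_inverse
  exact (CategoryTheory.Equivalence.mk ((Bicategory.precomposing x y z).obj f)
    ((Bicategory.precomposing y x z).obj g)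
    ((Bicategory.leftUnitorNatIso y z).symm ≪≫ (Bicategory.precomposing y y z).mapIso e.symm ≪≫
      Bicategory.associatorNatIsoRight g f z)
    ((Bicategory.associatorNatIsoRight f g z).symm ≪≫
      (Bicategory.precomposing x x z).mapIso η.symm ≪≫
        Bicategory.leftUnitorNatIso x z)).isEquivalence_functor

theorem IsEquivalence₁.isEquivalence_postcomposing {x y : C} {f : x ⟶ y} (hf : IsEquivalence₁ f)
    (z : C) :
    ((Bicategory.postcomposing z x y).obj f).IsEquivalence := by
  obtain ⟨g, -, ⟨η⟩, ⟨e⟩⟩ := hf.exists_inverse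
  exact (CategoryTheory.Equivalence.mk ((Bicategory.postcomposing z x y).obj f)
    ((Bicategory.postcomposing z y x).obj g)
    ((Bicategory.rightUnitorNatIso z x).symm ≪≫ (Bicategory.postcomposing z x x).mapIso η ≪≫
      (Bicategory.associatorNatIsoLeft z f g).symm)
    (Bicategory.associatorNatIsoLeft z g f ≪≫
      (Bicategory.postcomposing z y y).mapIso e ≪≫
        Bicategory.rightUnitorNatIso z y)).isEquivalence_functor

theorem IsEquivalence₁.whiskerLeft_injective {x y z : C} {f : x ⟶ y} (hf : IsEquivalence₁ f)
    {g h : y ⟶ z}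
    {α β : g ⟶ h} (e : f ◁ α = f ◁ β) : α = β :=
  have := hf.isEquivalence_precomposing z
  ((Bicategory.precomposing x y z).obj f).map_injective e

theorem IsEquivalence₁.whiskerRight_injective {x y z : C} {f : x ⟶ y} (hf : IsEquivalence₁ f)
    {g h : z ⟶ x}
    {α β : g ⟶ h} (e : α ▷ f = β ▷ f) : α = β :=
  have := hf.isEquivalence_postcomposing z
  ((Bicategory.postcomposing z x y).obj f).map_injective e

theorem IsEquivalence₁.whiskerLeft_surjective {x y z : C} {f : x ⟶ y} (hf : IsEquivalence₁ f)
    {g h : y ⟶ z}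
    (α : f ≫ g ⟶ f ≫ h) : ∃ β : g ⟶ h, f ◁ β = α :=
  have := hf.isEquivalence_precomposing z
  ((Bicategory.precomposing x y z).obj f).map_surjective α

theorem IsEquivalence₁.whiskerRight_surjective {x y z : C} {f : x ⟶ y} (hf : IsEquivalence₁ f)
    {g h : z ⟶ x}
    (α : g ≫ f ⟶ h ≫ f) : ∃ β : g ⟶ h, β ▷ f = α :=
  have := hf.isEquivalence_postcomposing z
  ((Bicategory.postcomposing z x y).obj f).map_surjective α

theorem IsEquivalence₁.isIso_of_whiskerLeft {x y z : C} {f : x ⟶ y} (hf : IsEquivalence₁ f)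
    {g h : y ⟶ z}
    {α : g ⟶ h} (e : IsIso (f ◁ α)) : IsIso α :=
  have := hf.isEquivalence_precomposing z
  have : IsIso (((Bicategory.precomposing x y z).obj f).map α) := e
  isIso_of_reflects_iso α ((Bicategory.precomposing x y z).obj f)

theorem IsEquivalence₁.isIso_of_whiskerRight {x y z : C} {f : x ⟶ y} (hf : IsEquivalence₁ f)
    {g h : z ⟶ x}
    {α : g ⟶ h} (e : IsIso (α ▷ f)) : IsIso α :=
  have := hf.isEquivalence_postcomposing z
  have : IsIso (((Bicategory.postcomposing z x y).obj f).map α) := e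
  isIso_of_reflects_iso α ((Bicategory.postcomposing z x y).obj f)

theorem IsIdentity.isEquivalence₁ {x y : C} {f : x ⟶ y} (hf : IsIdentity f) : IsEquivalence₁ f := by
  obtain ⟨rfl, rfl⟩ := hf
  exact .id x

theorem IsIdentity₂.isIso {x y : C} {f g : x ⟶ y} {α : f ⟶ g} (hα : IsIdentity₂ α) : IsIso α := by
  obtain ⟨rfl, rfl⟩ := hα
  infer_instance

theorem IsIdentity₂.eq {x y : C} {f g : x ⟶ y} {α β : f ⟶ g} (hα : IsIdentity₂ α)
    (hβ : IsIdentity₂ β) : α = β := by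
  obtain ⟨rfl, rfl⟩ := hα
  obtain ⟨_, rfl⟩ := hβ
  rfl

end Bicat

/-! ### Simplices of the Street–Duskin nerve -/

namespace NerveSimplex

section

variable {C : Type u} [Bicategory.{w, v} C] {I J : Type} [Preorder I] [Preorder J]

/-- The `2`-morphisms of a simplex of the nerve, for given objects and `1`-morphisms, with their
laws. -/
structure Cells (o : I → C) (f : ∀ i j : I, i ≤ j → (o i ⟶ o j)) where
  cell : ∀ (i j k : I) (hij : i ≤ j) (hjk : j ≤ k), f i k (hij.trans hjk) ⟶ f i j hij ≫ f j k hjk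
  map_self : ∀ i, f i i le_rfl = 𝟙 (o i)
  cell_left : ∀ (i j : I) (hij : i ≤ j),
    cell i i j le_rfl hij ≫ eqToHom (map_self i) ▷ f i j hij ≫ (λ_ (f i j hij)).hom =
      𝟙 (f i j hij)
  cell_right : ∀ (i j : I) (hij : i ≤ j),
    cell i j j hij le_rfl ≫ f i j hij ◁ eqToHom (map_self j) ≫ (ρ_ (f i j hij)).hom =
      𝟙 (f i j hij)
  cell_assoc : ∀ (i j k l : I) (hij : i ≤ j) (hjk : j ≤ k) (hkl : k ≤ l),
    cell i j l hij (hjk.trans hkl) ≫ f i j hij ◁ cell j k l hjk hkl =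
      cell i k l (hij.trans hjk) hkl ≫ cell i j k hij hjk ▷ f k l hkl ≫
        (α_ (f i j hij) (f j k hjk) (f k l hkl)).hom

/-- The simplex of the nerve with given objects, `1`-morphisms and `2`-morphisms. -/
def Cells.simplex {o : I → C} {f : ∀ i j : I, i ≤ j → (o i ⟶ o j)} (D : Cells o f) :
    NerveSimplex I C where
  obj := o
  map := f
  cell := D.cell
  map_self := D.map_self
  cell_left := D.cell_left
  cell_right := D.cell_right
  cell_assoc := D.cell_assoc

/-- The `2`-morphisms of a simplex of the nerve. -/
def cells (σ : NerveSimplex I C) : Cells σ.obj σ.map where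
  cell := σ.cell
  map_self := σ.map_self
  cell_left := σ.cell_left
  cell_right := σ.cell_right
  cell_assoc := σ.cell_assoc

theorem Cells.map_eq {o : I → C} {f f' : ∀ i j : I, i ≤ j → (o i ⟶ o j)} {D : Cells o f}
    {D' : Cells o f'} (h : D.simplex = D'.simplex) : f = f' := by
  have := congrArg (fun σ : NerveSimplex I C =>
    (⟨σ.obj, σ.map⟩ : Σ o : I → C, ∀ i j : I, i ≤ j → (o i ⟶ o j))) h
  exact eq_of_heq (Sigma.mk.inj_iff.1 this).2

theorem Cells.cell_eq {o : I → C} {f : ∀ i j : I, i ≤ j → (o i ⟶ o j)} {D D' : Cells o f}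
    (h : D.simplex = D'.simplex) : D.cell = D'.cell := by
  have := congrArg (fun σ : NerveSimplex I C =>
    (⟨⟨σ.obj, σ.map⟩, σ.cell⟩ : Σ p : (Σ o : I → C, ∀ i j : I, i ≤ j → (o i ⟶ o j)),
      ∀ (i j k : I) (hij : i ≤ j) (hjk : j ≤ k),
        p.2 i k (hij.trans hjk) ⟶ p.2 i j hij ≫ p.2 j k hjk)) h
  exact eq_of_heq (Sigma.mk.inj_iff.1 this).2

theorem Cells.simplex_eq {o : I → C} {f : ∀ i j : I, i ≤ j → (o i ⟶ o j)} {D D' : Cells o f}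
    (h : D.cell = D'.cell) : D.simplex = D'.simplex := by
  obtain ⟨c, _, _, _, _⟩ := D
  obtain ⟨c', _, _, _, _⟩ := D'
  obtain rfl : c = c' := h
  rfl

theorem exists_cells_of_obj (σ : NerveSimplex I C) (o : I → C) (h : σ.obj = o) :
    ∃ (f : ∀ i j : I, i ≤ j → (o i ⟶ o j)) (D : Cells o f), D.simplex = σ := by
  subst h
  exact ⟨σ.map, σ.cells, rfl⟩

/-- The action of a monotone map on the `2`-morphisms of a simplex. -/
def Cells.reindex {o : I → C} {f : ∀ i j : I, i ≤ j → (o i ⟶ o j)} (D : Cells o f) (θ : J →o I) :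
    Cells (o ∘ θ) (fun i j h => f (θ i) (θ j) (θ.monotone h)) :=
  (NerveSimplex.reindex θ D.simplex).cells

/-- Replaces the `1`-morphisms of a simplex by isomorphic ones. -/
def transport (σ : NerveSimplex I C) (f : ∀ i j : I, i ≤ j → (σ.obj i ⟶ σ.obj j))
    (φ : ∀ i j h, f i j h ≅ σ.map i j h) (hf : ∀ i, f i i le_rfl = 𝟙 _)
    (hφ : ∀ i, (φ i i le_rfl).hom = eqToHom ((hf i).trans (σ.map_self i).symm)) :
    NerveSimplex I C where
  obj := σ.obj
  map := f
  cell i j k hij hjk := (φ i k (hij.trans hjk)).hom ≫ σ.cell i j k hij hjk ≫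
    (φ i j hij).inv ▷ _ ≫ _ ◁ (φ j k hjk).inv
  map_self := hf
  cell_left i j hij := by
    have h1 := σ.cell_left i j hij
    have h2 : (φ i i le_rfl).inv ≫ eqToHom (hf i) = eqToHom (σ.map_self i) := by
      rw [Iso.inv_comp_eq, hφ, eqToHom_trans]
    simp only [Category.assoc]
    rw [Bicategory.whisker_exchange_assoc, ← Bicategory.comp_whiskerRight_assoc, h2,
      Bicategory.leftUnitor_naturality, reassoc_of% h1,
      Iso.hom_inv_id]
  cell_right i j hij := by
    have h1 := σ.cell_right i j hij
    have h2 : (φ j j le_rfl).inv ≫ eqToHom (hf j) = eqToHom (σ.map_self j) := by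
      rw [Iso.inv_comp_eq, hφ, eqToHom_trans]
    simp only [Category.assoc]
    rw [← Bicategory.whiskerLeft_comp_assoc, h2, ← Bicategory.whisker_exchange_assoc,
      Bicategory.rightUnitor_naturality, reassoc_of% h1, Iso.hom_inv_id]
  cell_assoc i j k l hij hjk hkl := by
    have h1 := σ.cell_assoc i j k l hij hjk hkl
    simp only [Category.assoc, Bicategory.whiskerLeft_comp, Bicategory.comp_whiskerRight]
    rw [← Bicategory.whiskerLeft_comp_assoc, Iso.inv_hom_id, Bicategory.whiskerLeft_id,
      Category.id_comp, ← Bicategory.whisker_exchange_assoc, reassoc_of% h1,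
      Bicategory.whisker_exchange_assoc, ← Bicategory.comp_whiskerRight_assoc (φ i k _).inv,
      Iso.inv_hom_id, Bicategory.id_whiskerRight, Category.id_comp]
    simp only [Bicategory.whiskerRight_comp, Bicategory.whisker_assoc, Category.assoc,
      Iso.inv_hom_id, Iso.hom_inv_id_assoc, Category.comp_id]
    rw [Bicategory.whisker_exchange_assoc, Bicategory.whisker_exchange_assoc]
    simp only [Bicategory.comp_whiskerLeft, Category.assoc, Iso.inv_hom_id_assoc,
      ← Bicategory.whiskerLeft_comp, Bicategory.whisker_exchange]

end

section

variable {C : Type u} [Bicategory.{w, v} C] [Bicategory.Strict C] {I : Type} [Preorder I]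

/-- The simplex of the nerve given by a strictly functorial family of `1`-morphisms. -/
def ofFunctor (o : I → C) (f : ∀ i j : I, i ≤ j → (o i ⟶ o j)) (h1 : ∀ i, f i i le_rfl = 𝟙 (o i))
    (h2 : ∀ i j k hij hjk, f i k (le_trans hij hjk) = f i j hij ≫ f j k hjk) :
    NerveSimplex I C where
  obj := o
  map := f
  cell i j k hij hjk := eqToHom (h2 i j k hij hjk)
  map_self := h1
  cell_left i j hij := by simp [Bicategory.Strict.leftUnitor_eqToIso]
  cell_right i j hij := by simp [Bicategory.Strict.rightUnitor_eqToIso]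
  cell_assoc i j k l hij hjk hkl := by simp [Bicategory.Strict.associator_eqToIso]

theorem whiskerLeft_of_eq_id {x y : C} {m : x ⟶ x} (hm : m = 𝟙 x) {f g : x ⟶ y} (α : f ⟶ g) :
    m ◁ α = eqToHom (by rw [hm, Bicategory.Strict.id_comp]) ≫ α ≫
      eqToHom (by rw [hm, Bicategory.Strict.id_comp]) := by
  subst hm
  simp [Bicategory.Strict.leftUnitor_eqToIso]

theorem whiskerRight_of_eq_id {x y : C} {m : y ⟶ y} (hm : m = 𝟙 y) {f g : x ⟶ y} (α : f ⟶ g) :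
    α ▷ m = eqToHom (by rw [hm, Bicategory.Strict.comp_id]) ≫ α ≫
      eqToHom (by rw [hm, Bicategory.Strict.comp_id]) := by
  subst hm
  simp [Bicategory.Strict.rightUnitor_eqToIso]

end

section

variable {C : Type u} [Bicategory.{w, v} C] [Bicategory.Strict C] {I : Type} [LinearOrder I]

/-- The `2`-morphisms of a simplex are determined by those for strictly increasing triples, which
have to satisfy the relation for strictly increasing quadruples. -/
theorem exists_cells_of_lt (o : I → C) (f : ∀ i j : I, i ≤ j → (o i ⟶ o j))
    (h1 : ∀ i, f i i le_rfl = 𝟙 (o i))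
    (c : ∀ (i j k : I) (hij : i < j) (hjk : j < k),
      f i k (hij.trans hjk).le ⟶ f i j hij.le ≫ f j k hjk.le)
    (h2 : ∀ (i j k l : I) (hij : i < j) (hjk : j < k) (hkl : k < l),
      c i j l hij (hjk.trans hkl) ≫ f i j hij.le ◁ c j k l hjk hkl =
        c i k l (hij.trans hjk) hkl ≫ c i j k hij hjk ▷ f k l hkl.le ≫
          (α_ (f i j hij.le) (f j k hjk.le) (f k l hkl.le)).hom) :
    ∃ D : Cells o f, ∀ i j k hij hjk,
      D.cell i j k (le_of_lt hij) (le_of_lt hjk) = c i j k hij hjk := by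
  let d : ∀ (i j k : I) (hij : i ≤ j) (hjk : j ≤ k),
      f i k (hij.trans hjk) ⟶ f i j hij ≫ f j k hjk := fun i j k hij hjk =>
    if h : i = j then eqToHom (by subst h; rw [h1, Bicategory.Strict.id_comp])
    else if h' : j = k then eqToHom (by subst h'; rw [h1, Bicategory.Strict.comp_id])
    else c i j k (lt_of_le_of_ne hij h) (lt_of_le_of_ne hjk h')
  have d1 : ∀ i j h h', d i i j h h' = eqToHom (by rw [h1, Bicategory.Strict.id_comp]) :=
    fun i j h h' => dif_pos rfl
  have d2 : ∀ i j h h', d i j j h h' = eqToHom (by rw [h1, Bicategory.Strict.comp_id]) := by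
    intro i j h h'
    by_cases e : i = j
    · subst e
      exact d1 _ _ _ _
    · exact (dif_neg e).trans (dif_pos rfl)
  have d3 : ∀ i j k hij hjk, d i j k (le_of_lt hij) (le_of_lt hjk) = c i j k hij hjk :=
    fun i j k hij hjk => (dif_neg hij.ne).trans (dif_neg hjk.ne)
  clear_value d
  refine ⟨⟨d, h1, ?_, ?_, ?_⟩, d3⟩
  · intro i j hij
    simp [d1, Bicategory.Strict.leftUnitor_eqToIso]
  · intro i j hij
    simp [d2, Bicategory.Strict.rightUnitor_eqToIso]
  · intro i j k l hij hjk hkl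
    rcases hij.eq_or_lt with rfl | hij
    · rw [d1, d1, whiskerLeft_of_eq_id (h1 i)]
      simp [Bicategory.Strict.associator_eqToIso]
    rcases hjk.eq_or_lt with rfl | hjk
    · rw [d1, d2]
      simp [Bicategory.Strict.associator_eqToIso]
    rcases hkl.eq_or_lt with rfl | hkl
    · rw [d2, d2, whiskerRight_of_eq_id (h1 k)]
      simp [Bicategory.Strict.associator_eqToIso]
    rw [d3 i j l hij (hjk.trans hkl), d3 j k l hjk hkl, d3 i k l (hij.trans hjk) hkl,
      d3 i j k hij hjk, h2 _ _ _ _ hij hjk hkl]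

end

end NerveSimplex

/-! ### Labels of faces of simplices of the nerves -/

namespace SimplexCategory

/-- The monotone map with two given values. -/
def pairHom {n : ℕ} (i j : Fin (n + 1)) (h : i ≤ j) :
    SimplexCategory.mk 1 ⟶ SimplexCategory.mk n :=
  SimplexCategory.mkHom ⟨![i, j], by
    intro a b hab
    fin_cases a <;> fin_cases b <;> first | exact le_rfl | exact h | exact absurd hab (by decide)⟩

/-- The monotone map with three given values. -/
def tripleHom {n : ℕ} (i j k : Fin (n + 1)) (h : i ≤ j) (h' : j ≤ k) :
    SimplexCategory.mk 2 ⟶ SimplexCategory.mk n :=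
  SimplexCategory.mkHom ⟨![i, j, k], by
    intro a b hab
    fin_cases a <;> fin_cases b <;>
      first | exact le_rfl | exact h | exact h' | exact h.trans h' | exact absurd hab (by decide)⟩

theorem range_pairHom {n : ℕ} (i j : Fin (n + 1)) (h : i ≤ j) :
    Set.range (pairHom i j h).toOrderHom = {i, j} := by
  refine (Set.ext fun x => ?_ : Set.range ![i, j] = _)
  simp [eq_comm, or_comm]

theorem range_tripleHom {n : ℕ} (i j k : Fin (n + 1)) (h : i ≤ j) (h' : j ≤ k) :
    Set.range (tripleHom i j k h h').toOrderHom = {i, j, k} := by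
  refine (Set.ext fun x => ?_ : Set.range ![i, j, k] = _)
  simp [eq_comm, or_comm, or_left_comm]

theorem injective_of_lt {m n : ℕ} (x : SimplexCategory.mk m ⟶ SimplexCategory.mk n)
    (h : ∀ i : Fin m, x.toOrderHom i.castSucc < x.toOrderHom i.succ) :
    Function.Injective x.toOrderHom :=
  (Fin.strictMono_iff_lt_succ.2 h).injective

theorem injective_pairHom {n : ℕ} {i j : Fin (n + 1)} (h : i < j) :
    Function.Injective (pairHom i j h.le).toOrderHom := by
  apply injective_of_lt
  intro a
  fin_cases a
  exact h

theorem injective_tripleHom {n : ℕ} {i j k : Fin (n + 1)} (h : i < j) (h' : j < k) :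
    Function.Injective (tripleHom i j k h.le h'.le).toOrderHom := by
  apply injective_of_lt
  intro a
  fin_cases a
  · exact h
  · exact h'

theorem exists_pairHom {n : ℕ} (x : SimplexCategory.mk 1 ⟶ SimplexCategory.mk n) :
    ∃ (i j : Fin (n + 1)) (h : i ≤ j), x = pairHom i j h := by
  refine ⟨x.toOrderHom 0, x.toOrderHom 1, x.toOrderHom.monotone (by decide), ?_⟩
  ext a
  fin_cases a <;> rfl

theorem exists_tripleHom {n : ℕ} (x : SimplexCategory.mk 2 ⟶ SimplexCategory.mk n) :
    ∃ (i j k : Fin (n + 1)) (h : i ≤ j) (h' : j ≤ k), x = tripleHom i j k h h' := by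
  refine ⟨x.toOrderHom 0, x.toOrderHom 1, x.toOrderHom 2, x.toOrderHom.monotone (by decide),
    x.toOrderHom.monotone (by decide), ?_⟩
  ext a
  fin_cases a <;> rfl

/-- A condition on injective monotone maps which is void for domains of dimension at least `3`
amounts to conditions on pairs and on triples. -/
theorem forall_injective_iff {n : ℕ} (P : Set (Set (Fin (n + 1))))
    (Q : ∀ m, (SimplexCategory.mk (m + 1) ⟶ SimplexCategory.mk n) → Prop)
    (hQ : ∀ m x, Q (m + 2) x) :
    (∀ m x, Function.Injective x.toOrderHom → Set.range x.toOrderHom ∈ P → Q m x) ↔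
      (∀ i j (h : i < j), {i, j} ∈ P → Q 0 (pairHom i j h.le)) ∧
      (∀ i j k (h : i < j) (h' : j < k), {i, j, k} ∈ P → Q 1 (tripleHom i j k h.le h'.le)) := by
  constructor
  · intro H
    exact ⟨fun i j h hP => H 0 _ (injective_pairHom h) (by rwa [range_pairHom]),
      fun i j k h h' hP => H 1 _ (injective_tripleHom h h') (by rwa [range_tripleHom])⟩
  · rintro ⟨H1, H2⟩ m x hx hP
    match m, x with
    | 0, x =>
      obtain ⟨i, j, h, rfl⟩ := exists_pairHom x
      have hij : i ≠ j := fun e => by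
        have := @hx (0 : Fin 2) (1 : Fin 2) e
        exact absurd this (by decide)
      rw [range_pairHom] at hP
      exact H1 i j (lt_of_le_of_ne h hij) hP
    | 1, x =>
      obtain ⟨i, j, k, h, h', rfl⟩ := exists_tripleHom x
      have hij : i ≠ j := fun e => by
        have := @hx (0 : Fin 3) (1 : Fin 3) e
        exact absurd this (by decide)
      have hjk : j ≠ k := fun e => by
        have := @hx (1 : Fin 3) (2 : Fin 3) e
        exact absurd this (by decide)
      rw [range_tripleHom] at hP
      exact H2 i j k (lt_of_le_of_ne h hij) (lt_of_le_of_ne h' hjk) hP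
    | m + 2, x => exact hQ m x

end SimplexCategory

open SimplexCategory

namespace NerveSimplex

variable {C : Type u} [Bicategory.{w, v} C]

/-- A simplex of the nerve as an unmarked simplex of the Roberts–Street nerve. -/
def toRS {n : ℕ} (σ : NerveSimplex (Fin (n + 1)) C) : (robertsStreetNerve C).obj (op (plain n)) :=
  (robertsStreetLabelled C).unm (m := n) σ

variable [Bicategory.Strict C]

/-- A simplex of the nerve as an unmarked simplex of the natural nerve. -/
def toNatural {n : ℕ} (σ : NerveSimplex (Fin (n + 1)) C) : (naturalNerve C).obj (op (plain n)) :=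
  (naturalLabelled C).unm (m := n) σ

theorem exists_toNatural {n : ℕ} (a : (naturalNerve C).obj (op (plain n))) :
    ∃ σ, a = toNatural σ := ⟨a, rfl⟩

theorem isLabelled_toNatural_one (σ : NerveSimplex (Fin 2) C) :
    TDeltaSet.IsLabelled (toNatural σ) ↔ IsEquivalence₁ (edge σ) := by
  refine (LabelledSSet.isLabelled_iff (naturalLabelled C) (m := 0) σ).trans ?_
  exact ⟨fun ⟨l⟩ => ⟨l.down⟩, fun ⟨l⟩ => ⟨⟨l⟩⟩⟩

theorem isLabelled_toNatural_two (σ : NerveSimplex (Fin 3) C) :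
    TDeltaSet.IsLabelled (toNatural σ) ↔ IsIso (triangle σ) := by
  refine (LabelledSSet.isLabelled_iff (naturalLabelled C) (m := 1) σ).trans ?_
  exact ⟨fun ⟨l⟩ => l.down.down, fun l => ⟨⟨⟨l⟩⟩⟩⟩

theorem isLabelled_toNatural {m : ℕ} (σ : NerveSimplex (Fin (m + 2 + 1 + 1)) C) :
    TDeltaSet.IsLabelled (toNatural σ) :=
  (LabelledSSet.isLabelled_iff (naturalLabelled C) (m := m + 2) σ).2 ⟨PUnit.unit⟩

theorem isLabelled_toRS_iff {m : ℕ} (σ : NerveSimplex (Fin (m + 1 + 1)) C) :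
    TDeltaSet.IsLabelled (toRS σ) ↔ rsMarked (m := m) σ := by
  refine (LabelledSSet.isLabelled_iff (robertsStreetLabelled C) (m := m) σ).trans ?_
  exact ⟨fun ⟨l⟩ => l.down.down.elim (rsMarked_of_degenerate _) id, fun l => ⟨⟨⟨Or.inr l⟩⟩⟩⟩

theorem facesLabelled_toNatural_iff {n : ℕ} (P : Set (Set (Fin (n + 1))))
    (σ : NerveSimplex (Fin (n + 1)) C) : TDeltaSet.FacesLabelled P (toNatural σ) ↔
      (∀ i j (h : i < j), {i, j} ∈ P → IsEquivalence₁ (σ.map i j h.le)) ∧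
      (∀ i j k (h : i < j) (h' : j < k), {i, j, k} ∈ P → IsIso (σ.cell i j k h.le h'.le)) := by
  refine (forall_injective_iff P (fun m x => TDeltaSet.IsLabelled
    ((naturalNerve C).map (pl x).op (toNatural σ))) ?_).trans (and_congr ?_ ?_)
  · exact fun m x => isLabelled_toNatural _
  · exact forall₃_congr fun i j h => imp_congr_right fun _ => isLabelled_toNatural_one _
  · exact forall_congr' fun i => forall_congr' fun j => forall_congr' fun k =>
      forall_congr' fun h => forall_congr' fun h' => imp_congr_right fun _ =>
        isLabelled_toNatural_two _

theorem facesLabelled_toRS_iff {n : ℕ} (P : Set (Set (Fin (n + 1))))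
    (σ : NerveSimplex (Fin (n + 1)) C) : TDeltaSet.FacesLabelled P (toRS σ) ↔
      (∀ i j (h : i < j), {i, j} ∈ P → IsIdentity (σ.map i j h.le)) ∧
      (∀ i j k (h : i < j) (h' : j < k), {i, j, k} ∈ P →
        IsIdentity₂ (σ.cell i j k h.le h'.le)) := by
  refine (forall_injective_iff P (fun m x => TDeltaSet.IsLabelled
    ((robertsStreetNerve C).map (pl x).op (toRS σ))) ?_).trans (and_congr ?_ ?_)
  · exact fun m x => (isLabelled_toRS_iff (m := m + 2) _).2 trivial
  · exact forall₃_congr fun i j h => imp_congr_right fun _ => isLabelled_toRS_iff (m := 0) _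
  · exact forall_congr' fun i => forall_congr' fun j => forall_congr' fun k =>
      forall_congr' fun h => forall_congr' fun h' => imp_congr_right fun _ =>
        isLabelled_toRS_iff (m := 1) _

end NerveSimplex

/-! ### Thinness and saturation for the natural nerve -/

namespace NerveSimplex

section

variable {C : Type u} [Bicategory.{w, v} C] {I : Type} [Preorder I] (σ : NerveSimplex I C)

theorem isIso_cell_iff (i j k l : I) (hij : i ≤ j) (hjk : j ≤ k) (hkl : k ≤ l) :
    IsIso (σ.cell i j l hij (hjk.trans hkl) ≫ σ.map i j hij ◁ σ.cell j k l hjk hkl) ↔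
    IsIso (σ.cell i k l (hij.trans hjk) hkl ≫ σ.cell i j k hij hjk ▷ σ.map k l hkl) := by
  rw [σ.cell_assoc, ← Category.assoc]
  exact ⟨fun h => IsIso.of_isIso_comp_right _
    (α_ (σ.map i j hij) (σ.map j k hjk) (σ.map k l hkl)).hom, fun h => inferInstance⟩

theorem isEquivalence₁_map_iff {i j k : I} {hij : i ≤ j} {hjk : j ≤ k}
    (h : IsIso (σ.cell i j k hij hjk)) :
    IsEquivalence₁ (σ.map i k (hij.trans hjk)) ↔ IsEquivalence₁ (σ.map i j hij ≫ σ.map j k hjk) :=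
  ⟨fun h' => h'.of_iso (asIso (σ.cell i j k hij hjk)),
    fun h' => h'.of_iso (asIso (σ.cell i j k hij hjk)).symm⟩

/-- Saturation for triangles with vertices `i < a < b < c < d`. If `x`, `y`, `z` denote the
whiskered `2`-morphisms of `{i,a,b}`, `{i,b,c}` and `{i,c,d}`, the hypotheses say that `y ≫ x` and
`z ≫ y` are invertible, so that `y` is a monomorphism and a split epimorphism. -/
theorem isIso_cell_of_saturation {i a b c d : I} (hia : i ≤ a) (hab : a ≤ b) (hbc : b ≤ c)
    (hcd : c ≤ d) (hbc' : IsEquivalence₁ (σ.map b c hbc)) (hcd' : IsEquivalence₁ (σ.map c d hcd))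
    (habc : IsIso (σ.cell a b c hab hbc)) (hbcd : IsIso (σ.cell b c d hbc hcd))
    (habd : IsIso (σ.cell a b d hab (hbc.trans hcd)))
    (hac : IsIso (σ.cell i a c hia (hab.trans hbc)))
    (hbd : IsIso (σ.cell i b d (hia.trans hab) (hbc.trans hcd))) :
    IsIso (σ.cell i a b hia hab) ∧ IsIso (σ.cell i b c (hia.trans hab) hbc) ∧
    IsIso (σ.cell i c d ((hia.trans hab).trans hbc) hcd) ∧
    IsIso (σ.cell i a d hia ((hab.trans hbc).trans hcd)) := by
  have e1 := (σ.isIso_cell_iff i a b c hia hab hbc).1 inferInstance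
  have e2 := (σ.isIso_cell_iff i b c d (hia.trans hab) hbc hcd).1 inferInstance
  have h1 : IsIso (σ.cell i b c (hia.trans hab) hbc) := by
    apply hcd'.isIso_of_whiskerRight
    have : IsSplitEpi (σ.cell i b c (hia.trans hab) hbc ▷ σ.map c d hcd) :=
      ⟨⟨⟨inv (σ.cell i c d ((hia.trans hab).trans hbc) hcd ≫
        σ.cell i b c (hia.trans hab) hbc ▷ σ.map c d hcd) ≫
        σ.cell i c d ((hia.trans hab).trans hbc) hcd, by simp⟩⟩⟩
    have e3 : IsIso ((σ.cell i b c (hia.trans hab) hbc ▷ σ.map c d hcd) ≫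
        (σ.cell i a b hia hab ▷ σ.map b c hbc) ▷ σ.map c d hcd) := by
      rw [← Bicategory.comp_whiskerRight]
      infer_instance
    have : Mono (σ.cell i b c (hia.trans hab) hbc ▷ σ.map c d hcd) := mono_of_mono _
      ((σ.cell i a b hia hab ▷ σ.map b c hbc) ▷ σ.map c d hcd)
    exact isIso_of_mono_of_isSplitEpi _
  have h2 : IsIso (σ.cell i a b hia hab) :=
    hbc'.isIso_of_whiskerRight (IsIso.of_isIso_comp_left (σ.cell i b c (hia.trans hab) hbc) _)
  have h3 : IsIso (σ.cell i c d ((hia.trans hab).trans hbc) hcd) :=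
    IsIso.of_isIso_comp_right _ (σ.cell i b c (hia.trans hab) hbc ▷ σ.map c d hcd)
  have e4 := (σ.isIso_cell_iff i a b d hia hab (hbc.trans hcd)).2 inferInstance
  exact ⟨h2, h1, h3, IsIso.of_isIso_comp_right _ (σ.map i a hia ◁ σ.cell a b d hab (hbc.trans hcd))⟩

end

variable {C : Type u} [Bicategory.{w, v} C] [Bicategory.Strict C]

/-- Only the cases `m = 2` and `m = 3` have content. They are the two-out-of-three properties of
equivalences and of invertible `2`-morphisms; at an outer vertex `k`, the latter have to be
cancelled after whiskering with an equivalence. -/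
theorem facesLabelled_thinness {m : ℕ} (hm : 2 ≤ m) (k : Fin (m + 1))
    (a : (naturalNerve C).obj (op (plain m)))
    (ha : TDeltaSet.FacesLabelled (admissibleMarking' m k) a) :
    TDeltaSet.FacesLabelled (admissibleMarking'' m k) a := by
  obtain ⟨σ, hσ⟩ := exists_toNatural a
  rw [hσ, facesLabelled_toNatural_iff] at ha ⊢
  obtain ⟨h1, h2⟩ := ha
  constructor
  · rintro i j hij (hP | hP)
    · exact h1 i j hij hP
    have hk : ∀ x, (x = i ∨ x = j) ↔ x ≠ k := fun x => Set.ext_iff.1 hP x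
    have hi := (hk i).1 (.inl rfl)
    have hj := (hk j).1 (.inr rfl)
    obtain rfl : m = 2 := by
      have a0 := hk ⟨0, by omega⟩
      have a1 := hk ⟨1, by omega⟩
      have a2 := hk ⟨2, by omega⟩
      by_contra
      have a3 := hk ⟨3, by omega⟩
      simp only [Fin.ext_iff, ne_eq] at a0 a1 a2 a3
      omega
    have hc : IsIso (σ.cell 0 1 2 (by decide) (by decide)) := h2 _ _ _ (by decide) (by decide)
      (.inl fun x _ => by fin_cases x <;> simp)
    have he := σ.isEquivalence₁_map_iff hc
    have e0 : ({1, 2} : Set (Fin 3)) = {0}ᶜ := by ext x; fin_cases x <;> simp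
    have e1 : ({0, 2} : Set (Fin 3)) = {1}ᶜ := by ext x; fin_cases x <;> simp
    have e2 : ({0, 1} : Set (Fin 3)) = {2}ᶜ := by ext x; fin_cases x <;> simp
    have hcases : ∀ k i j : Fin 3, i < j → i ≠ k → j ≠ k → (k = 0 ∧ i = 1 ∧ j = 2) ∨
      (k = 1 ∧ i = 0 ∧ j = 2) ∨ (k = 2 ∧ i = 0 ∧ j = 1) := by decide
    obtain ⟨rfl, rfl, rfl⟩ | ⟨rfl, rfl, rfl⟩ | ⟨rfl, rfl, rfl⟩ := hcases k i j hij hi hj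
    · refine (h1 0 1 (by decide) (.inl ?_)).of_comp_left (he.1 (h1 0 2 (by decide)
        (.inr ⟨1, by decide, e1⟩)))
      simp only [admissibleMarking, Set.mem_ofPred_eq, Set.mem_insert_iff, Set.mem_singleton_iff]
      decide
    · exact he.2 ((h1 0 1 (by decide) (.inr ⟨2, by decide, e2⟩)).comp
        (h1 1 2 (by decide) (.inr ⟨0, by decide, e0⟩)))
    · refine (h1 1 2 (by decide) (.inl ?_)).of_comp_right (he.1 (h1 0 2 (by decide)
        (.inr ⟨1, by decide, e1⟩)))
      simp only [admissibleMarking, Set.mem_ofPred_eq, Set.mem_insert_iff, Set.mem_singleton_iff]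
      decide
  · rintro i j l hij hjl (hP | hP)
    · exact h2 i j l hij hjl hP
    have hk : ∀ x, (x = i ∨ x = j ∨ x = l) ↔ x ≠ k := fun x => Set.ext_iff.1 hP x
    have hi := (hk i).1 (.inl rfl)
    have hj := (hk j).1 (.inr (.inl rfl))
    have hl := (hk l).1 (.inr (.inr rfl))
    obtain rfl : m = 3 := by
      rw [ne_eq, Fin.ext_iff] at hi hj hl
      have a0 := hk ⟨0, by omega⟩
      have a1 := hk ⟨1, by omega⟩
      have a2 := hk ⟨2, by omega⟩
      have a3 := hk ⟨3, by omega⟩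
      by_contra
      have a4 := hk ⟨4, by omega⟩
      simp only [Fin.ext_iff, ne_eq] at a0 a1 a2 a3 a4
      omega
    have he := σ.isIso_cell_iff 0 1 2 3 (by decide) (by decide) (by decide)
    have e0 : ({1, 2, 3} : Set (Fin 4)) = {0}ᶜ := by ext x; fin_cases x <;> simp
    have e1 : ({0, 2, 3} : Set (Fin 4)) = {1}ᶜ := by ext x; fin_cases x <;> simp
    have e2 : ({0, 1, 3} : Set (Fin 4)) = {2}ᶜ := by ext x; fin_cases x <;> simp
    have e3 : ({0, 1, 2} : Set (Fin 4)) = {3}ᶜ := by ext x; fin_cases x <;> simp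
    have hcases : ∀ k i j l : Fin 4, i < j → j < l → i ≠ k → j ≠ k → l ≠ k →
      (k = 0 ∧ i = 1 ∧ j = 2 ∧ l = 3) ∨ (k = 1 ∧ i = 0 ∧ j = 2 ∧ l = 3) ∨
      (k = 2 ∧ i = 0 ∧ j = 1 ∧ l = 3) ∨ (k = 3 ∧ i = 0 ∧ j = 1 ∧ l = 2) := by decide
    obtain ⟨rfl, rfl, rfl, rfl⟩ | ⟨rfl, rfl, rfl, rfl⟩ | ⟨rfl, rfl, rfl, rfl⟩ |
      ⟨rfl, rfl, rfl, rfl⟩ := hcases k i j l hij hjl hi hj hl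
    · have c012 := h2 0 1 2 (by decide) (by decide)
        (.inl (by
          simp only [admissibleMarking, Set.mem_ofPred_eq, Set.mem_insert_iff,
            Set.mem_singleton_iff]
          decide))
      have c013 := h2 0 1 3 (by decide) (by decide)
        (.inl (by
          simp only [admissibleMarking, Set.mem_ofPred_eq, Set.mem_insert_iff,
            Set.mem_singleton_iff]
          decide))
      have c023 := h2 0 2 3 (by decide) (by decide) (.inr ⟨1, by decide, e1⟩)
      have f01 := h1 0 1 (by decide) (.inl (by
          simp only [admissibleMarking, Set.mem_ofPred_eq, Set.mem_insert_iff,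
            Set.mem_singleton_iff]
          decide))
      have := he.2 inferInstance
      exact f01.isIso_of_whiskerLeft (IsIso.of_isIso_comp_left (σ.cell 0 1 3 _ _) _)
    · have c012 := h2 0 1 2 (by decide) (by decide)
        (.inl (by
          simp only [admissibleMarking, Set.mem_ofPred_eq, Set.mem_insert_iff,
            Set.mem_singleton_iff]
          decide))
      have c013 := h2 0 1 3 (by decide) (by decide) (.inr ⟨2, by decide, e2⟩)
      have c123 := h2 1 2 3 (by decide) (by decide) (.inr ⟨0, by decide, e0⟩)
      have := he.1 inferInstance
      exact IsIso.of_isIso_comp_right _ (σ.cell 0 1 2 _ _ ▷ σ.map 2 3 _)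
    · have c123 := h2 1 2 3 (by decide) (by decide)
        (.inl (by
          simp only [admissibleMarking, Set.mem_ofPred_eq, Set.mem_insert_iff,
            Set.mem_singleton_iff]
          decide))
      have c012 := h2 0 1 2 (by decide) (by decide) (.inr ⟨3, by decide, e3⟩)
      have c023 := h2 0 2 3 (by decide) (by decide) (.inr ⟨1, by decide, e1⟩)
      have := he.2 inferInstance
      exact IsIso.of_isIso_comp_right _ (σ.map 0 1 _ ◁ σ.cell 1 2 3 _ _)
    · have c123 := h2 1 2 3 (by decide) (by decide)
        (.inl (by
          simp only [admissibleMarking, Set.mem_ofPred_eq, Set.mem_insert_iff,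
            Set.mem_singleton_iff]
          decide))
      have c023 := h2 0 2 3 (by decide) (by decide)
        (.inl (by
          simp only [admissibleMarking, Set.mem_ofPred_eq, Set.mem_insert_iff,
            Set.mem_singleton_iff]
          decide))
      have c013 := h2 0 1 3 (by decide) (by decide) (.inr ⟨2, by decide, e2⟩)
      have f23 := h1 2 3 (by decide) (.inl (by
          simp only [admissibleMarking, Set.mem_ofPred_eq, Set.mem_insert_iff,
            Set.mem_singleton_iff]
          decide))
      have := he.1 inferInstance
      exact f23.isIso_of_whiskerRight
        (IsIso.of_isIso_comp_left (σ.cell 0 2 3 _ _) _)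

theorem facesLabelled_triviality {n : ℕ} (hn : 2 < n) (a : (naturalNerve C).obj (op (plain n))) :
    TDeltaSet.FacesLabelled {Set.univ} a := by
  obtain ⟨σ, hσ⟩ := exists_toNatural a
  rw [hσ, facesLabelled_toNatural_iff]
  constructor
  · intro i j hij hP
    have hk : ∀ x, (x = i ∨ x = j) ↔ True := fun x => Set.ext_iff.1 hP x
    have a0 := hk ⟨0, by omega⟩
    have a1 := hk ⟨1, by omega⟩
    have a2 := hk ⟨2, by omega⟩
    simp only [Fin.ext_iff, iff_true] at a0 a1 a2
    omega
  · intro i j k hij hjk hP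
    have hk : ∀ x, (x = i ∨ x = j ∨ x = k) ↔ True := fun x => Set.ext_iff.1 hP x
    have a0 := hk ⟨0, by omega⟩
    have a1 := hk ⟨1, by omega⟩
    have a2 := hk ⟨2, by omega⟩
    have a3 := hk ⟨3, by omega⟩
    simp only [Fin.ext_iff, iff_true] at a0 a1 a2 a3
    omega

/-- The vertices of the last factor of `Δ[p+3] = Δ[p-1] ⋆ Δ[3]`. -/
def lastVertex (p : ℕ) (i : Fin 4) : Fin (p + 3 + 1) := ⟨p + i, by omega⟩

theorem lastVertex_strictMono (p : ℕ) : StrictMono (lastVertex p) := fun _ _ h =>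
  Nat.add_lt_add_left (Fin.lt_def.1 h) p

theorem lt_or_eq_lastVertex (p : ℕ) (i : Fin (p + 3 + 1)) :
    (i : ℕ) < p ∨ ∃ a, i = lastVertex p a := by
  by_cases h : (i : ℕ) < p
  · exact .inl h
  · exact .inr ⟨⟨i - p, by omega⟩, Fin.ext (by simp [lastVertex]; omega)⟩

theorem lastPart_insert (p : ℕ) (a : Fin 4) (S : Set (Fin (p + 3 + 1))) :
    lastPart p (insert (lastVertex p a) S) = insert a (lastPart p S) := by
  ext x
  simp only [lastPart, lastVertex, Fin.ext_iff, Set.mem_ofPred_eq, Set.mem_insert_iff,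
    Nat.add_left_cancel_iff]

theorem lastPart_insert_of_lt (p : ℕ) (i : Fin (p + 3 + 1)) (hi : (i : ℕ) < p)
    (S : Set (Fin (p + 3 + 1))) : lastPart p (insert i S) = lastPart p S := by
  ext x
  have : p + (x : ℕ) ≠ i := by omega
  simp [lastPart, Fin.ext_iff, this]

theorem lastPart_singleton (p : ℕ) (a : Fin 4) : lastPart p {lastVertex p a} = {a} := by
  ext x
  simp only [lastPart, lastVertex, Fin.ext_iff, Set.mem_ofPred_eq, Set.mem_singleton_iff,
    Nat.add_left_cancel_iff]

theorem lastPart_singleton_of_lt (p : ℕ) (i : Fin (p + 3 + 1)) (hi : (i : ℕ) < p) :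
    lastPart p {i} = ∅ := by
  ext x
  have : p + (x : ℕ) ≠ i := by omega
  simp [lastPart, Fin.ext_iff, this]

theorem mem_eqMarking_of_lt {a b c : Fin 4} (h : a < b) (h' : b < c) : {a, b, c} ∈ eqMarking := by
  refine .inl (Set.ncard_eq_three.2 ⟨a, b, c, h.ne, (h.trans h').ne, h'.ne, rfl⟩).ge

theorem mem_sharpMarking_of_lt {a b : Fin 4} (h : a < b) : {a, b} ∈ sharpMarking :=
  (Set.ncard_pair h.ne).ge

theorem notMem_sharpMarking_singleton (a : Fin 4) : {a} ∉ sharpMarking := by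
  simp [sharpMarking]

/-- A condition on the pairs and triples of vertices that are marked in `Δ[p-1] ⋆ Δ[3]^♯`, in terms
of the vertices of both factors. -/
theorem forall_lastPart_sharp_iff (p : ℕ)
    (Q₁ : ∀ i j : Fin (p + 3 + 1), i < j → Prop)
    (Q₂ : ∀ i j k : Fin (p + 3 + 1), i < j → j < k → Prop) :
    ((∀ i j (h : i < j), {i, j} ∈ {S | lastPart p S ∈ sharpMarking} → Q₁ i j h) ∧
      (∀ i j k (h : i < j) (h' : j < k), {i, j, k} ∈ {S | lastPart p S ∈ sharpMarking} →
        Q₂ i j k h h')) ↔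
    (∀ a b (h : a < b), Q₁ _ _ (lastVertex_strictMono p h)) ∧
    (∀ a b c (h : a < b) (h' : b < c),
      Q₂ _ _ _ (lastVertex_strictMono p h) (lastVertex_strictMono p h')) ∧
    (∀ (i : Fin (p + 3 + 1)) (_ : (i : ℕ) < p) (a b) (h : a < b) (h' : i < lastVertex p a),
      Q₂ i _ _ h' (lastVertex_strictMono p h)) := by
  constructor
  · rintro ⟨H1, H2⟩
    refine ⟨fun a b h => H1 _ _ _ ?_, fun a b c h h' => H2 _ _ _ _ _ ?_, fun i hi a b h h' =>
      H2 _ _ _ _ _ ?_⟩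
    · simpa only [Set.mem_ofPred_eq, lastPart_insert, lastPart_singleton] using
        mem_sharpMarking_of_lt h
    · simpa only [Set.mem_ofPred_eq, lastPart_insert, lastPart_singleton] using
        eqMarking_subset_sharpMarking (mem_eqMarking_of_lt h h')
    · simpa only [Set.mem_ofPred_eq, lastPart_insert, lastPart_insert_of_lt p i hi,
        lastPart_singleton] using mem_sharpMarking_of_lt h
  · rintro ⟨H1, H2, H3⟩
    constructor
    · intro i j h hP
      obtain hi | ⟨a, rfl⟩ := lt_or_eq_lastVertex p i
      · obtain hj | ⟨b, rfl⟩ := lt_or_eq_lastVertex p j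
        · simp [lastPart_insert_of_lt p i hi, lastPart_singleton_of_lt p j hj, sharpMarking] at hP
        · simp [lastPart_insert_of_lt p i hi, lastPart_singleton, sharpMarking] at hP
      · obtain hj | ⟨b, rfl⟩ := lt_or_eq_lastVertex p j
        · simp [lastVertex, Fin.lt_def] at h; omega
        · exact H1 a b ((lastVertex_strictMono p).lt_iff_lt.1 h)
    · intro i j k h h' hP
      obtain hk | ⟨c, rfl⟩ := lt_or_eq_lastVertex p k
      · simp [lastPart_insert_of_lt p i (by omega), lastPart_insert_of_lt p j (by omega),
          lastPart_singleton_of_lt p k hk, sharpMarking] at hP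
      obtain hj | ⟨b, rfl⟩ := lt_or_eq_lastVertex p j
      · simp [lastPart_insert_of_lt p i (by omega), lastPart_insert_of_lt p j hj,
          lastPart_singleton, sharpMarking] at hP
      obtain hi | ⟨a, rfl⟩ := lt_or_eq_lastVertex p i
      · exact H3 i hi b c ((lastVertex_strictMono p).lt_iff_lt.1 h') h
      · exact H2 a b c ((lastVertex_strictMono p).lt_iff_lt.1 h)
          ((lastVertex_strictMono p).lt_iff_lt.1 h')

theorem forall_lt_fin_four (Q : ∀ a b : Fin 4, a < b → Prop)
    (h : Q 0 1 (by decide) ∧ Q 0 2 (by decide) ∧ Q 0 3 (by decide) ∧ Q 1 2 (by decide) ∧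
      Q 1 3 (by decide) ∧ Q 2 3 (by decide)) (a b : Fin 4) (hab : a < b) : Q a b hab := by
  obtain ⟨h01, h02, h03, h12, h13, h23⟩ := h
  have hcases : ∀ a b : Fin 4, a < b → (a = 0 ∧ b = 1) ∨ (a = 0 ∧ b = 2) ∨ (a = 0 ∧ b = 3) ∨
      (a = 1 ∧ b = 2) ∨ (a = 1 ∧ b = 3) ∨ (a = 2 ∧ b = 3) := by decide
  obtain ⟨rfl, rfl⟩ | ⟨rfl, rfl⟩ | ⟨rfl, rfl⟩ | ⟨rfl, rfl⟩ | ⟨rfl, rfl⟩ | ⟨rfl, rfl⟩ :=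
    hcases a b hab <;> assumption

/-- For the edges, this is the two-out-of-six property of equivalences. -/
theorem facesLabelled_saturation (p : ℕ) (a : (naturalNerve C).obj (op (plain (p + 3))))
    (ha : TDeltaSet.FacesLabelled {S | lastPart p S ∈ eqMarking} a) :
    TDeltaSet.FacesLabelled {S | lastPart p S ∈ sharpMarking} a := by
  obtain ⟨σ, hσ⟩ := exists_toNatural a
  rw [hσ, facesLabelled_toNatural_iff] at ha
  rw [hσ, facesLabelled_toNatural_iff, forall_lastPart_sharp_iff p
    (fun i j h => IsEquivalence₁ (σ.map i j h.le))
    (fun i j k h h' => IsIso (σ.cell i j k h.le h'.le))]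
  obtain ⟨h1, h2⟩ := ha
  have c : ∀ a b c (h : a < b) (h' : b < c), IsIso (σ.cell _ _ _ (lastVertex_strictMono p h).le
      (lastVertex_strictMono p h').le) := fun a b c h h' => h2 _ _ _ (lastVertex_strictMono p h)
      (lastVertex_strictMono p h') (by
    simpa only [Set.mem_ofPred_eq, lastPart_insert, lastPart_singleton] using
      mem_eqMarking_of_lt h h')
  have f02 : IsEquivalence₁ (σ.map (lastVertex p 0) (lastVertex p 2) _) :=
    h1 _ _ (lastVertex_strictMono p (by decide)) (by
      simp only [Set.mem_ofPred_eq, lastPart_insert, lastPart_singleton]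
      exact .inr (.inl rfl))
  have f13 : IsEquivalence₁ (σ.map (lastVertex p 1) (lastVertex p 3) _) :=
    h1 _ _ (lastVertex_strictMono p (by decide)) (by
      simp only [Set.mem_ofPred_eq, lastPart_insert, lastPart_singleton]
      exact .inr (.inr rfl))
  have e02 := (σ.isEquivalence₁_map_iff (c 0 1 2 (by decide) (by decide))).1 f02
  have e13 := (σ.isEquivalence₁_map_iff (c 1 2 3 (by decide) (by decide))).1 f13
  have f12 := e02.two_of_six e13
  have f01 := f12.of_comp_right e02
  have f23 := f12.of_comp_left e13
  have f03 := (σ.isEquivalence₁_map_iff (c 0 1 3 (by decide) (by decide))).2 (f01.comp f13)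
  refine ⟨forall_lt_fin_four _ ⟨f01, f02, f03, f12, f13, f23⟩, c, fun i hi => ?_⟩
  have hv : ∀ a, i < lastVertex p a := fun a => by simp [lastVertex, Fin.lt_def]; omega
  have c02 := h2 i _ _ (hv 0) (lastVertex_strictMono p (show (0 : Fin 4) < 2 by decide)) (by
      simp only [Set.mem_ofPred_eq, lastPart_insert_of_lt p i hi, lastPart_insert,
        lastPart_singleton]
      exact .inr (.inl rfl))
  have c13 := h2 i _ _ (hv 1) (lastVertex_strictMono p (show (1 : Fin 4) < 3 by decide)) (by
      simp only [Set.mem_ofPred_eq, lastPart_insert_of_lt p i hi, lastPart_insert,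
        lastPart_singleton]
      exact .inr (.inr rfl))
  obtain ⟨c01, c12, c23, c03⟩ := σ.isIso_cell_of_saturation (hv 0).le _ _ _ f12 f23
    (c 0 1 2 (by decide) (by decide)) (c 1 2 3 (by decide) (by decide))
    (c 0 1 3 (by decide) (by decide)) c02 c13
  exact forall_lt_fin_four _ ⟨fun _ => c01, fun _ => c02, fun _ => c03, fun _ => c12, fun _ => c13,
    fun _ => c23⟩

end NerveSimplex

/-! ### The relations of a `4`-simplex of the nerve -/

section Pasting

variable {C : Type u} [Bicategory.{w, v} C] {x₀ x₁ x₂ x₃ x₄ : C} {f₀₁ : x₀ ⟶ x₁} {f₀₂ : x₀ ⟶ x₂}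
  {f₀₃ : x₀ ⟶ x₃} {f₀₄ : x₀ ⟶ x₄} {f₁₂ : x₁ ⟶ x₂} {f₁₃ : x₁ ⟶ x₃} {f₁₄ : x₁ ⟶ x₄} {f₂₃ : x₂ ⟶ x₃}
  {f₂₄ : x₂ ⟶ x₄} {f₃₄ : x₃ ⟶ x₄} {c₀₁₂ : f₀₂ ⟶ f₀₁ ≫ f₁₂} {c₀₁₃ : f₀₃ ⟶ f₀₁ ≫ f₁₃}
  {c₀₁₄ : f₀₄ ⟶ f₀₁ ≫ f₁₄} {c₀₂₃ : f₀₃ ⟶ f₀₂ ≫ f₂₃} {c₀₂₄ : f₀₄ ⟶ f₀₂ ≫ f₂₄}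
  {c₀₃₄ : f₀₄ ⟶ f₀₃ ≫ f₃₄} {c₁₂₃ : f₁₃ ⟶ f₁₂ ≫ f₂₃} {c₁₂₄ : f₁₄ ⟶ f₁₂ ≫ f₂₄}
  {c₁₃₄ : f₁₄ ⟶ f₁₃ ≫ f₃₄} {c₂₃₄ : f₂₄ ⟶ f₂₃ ≫ f₃₄}

/-- The relation between the `2`-morphisms of a `3`-simplex of the nerve: its two pasting composites
agree. -/
def PastingRel (c₀₁₂ : f₀₂ ⟶ f₀₁ ≫ f₁₂) (c₀₁₃ : f₀₃ ⟶ f₀₁ ≫ f₁₃) (c₀₂₃ : f₀₃ ⟶ f₀₂ ≫ f₂₃)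
    (c₁₂₃ : f₁₃ ⟶ f₁₂ ≫ f₂₃) : Prop :=
  c₀₁₃ ≫ f₀₁ ◁ c₁₂₃ = c₀₂₃ ≫ c₀₁₂ ▷ f₂₃ ≫ (α_ f₀₁ f₁₂ f₂₃).hom

/-- The relation can be solved for each of its `2`-morphisms, under the assumptions that come from
the marking of the complicial horn at the opposite vertex. -/
theorem exists_pastingRel_zero (c₀₁₂ : f₀₂ ⟶ f₀₁ ≫ f₁₂) (c₀₁₃ : f₀₃ ⟶ f₀₁ ≫ f₁₃)
    (c₀₂₃ : f₀₃ ⟶ f₀₂ ≫ f₂₃) (h : IsEquivalence₁ f₀₁) (h' : IsIso c₀₁₃) :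
    ∃ c₁₂₃ : f₁₃ ⟶ f₁₂ ≫ f₂₃, PastingRel c₀₁₂ c₀₁₃ c₀₂₃ c₁₂₃ := by
  obtain ⟨c, hc⟩ := h.whiskerLeft_surjective
    (inv c₀₁₃ ≫ c₀₂₃ ≫ c₀₁₂ ▷ f₂₃ ≫ (α_ f₀₁ f₁₂ f₂₃).hom)
  exact ⟨c, by rw [PastingRel, hc, IsIso.hom_inv_id_assoc]⟩

theorem exists_pastingRel_one (c₀₁₂ : f₀₂ ⟶ f₀₁ ≫ f₁₂) (c₀₁₃ : f₀₃ ⟶ f₀₁ ≫ f₁₃)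
    (c₁₂₃ : f₁₃ ⟶ f₁₂ ≫ f₂₃) (h : IsIso c₀₁₂) :
    ∃ c₀₂₃ : f₀₃ ⟶ f₀₂ ≫ f₂₃, PastingRel c₀₁₂ c₀₁₃ c₀₂₃ c₁₂₃ :=
  ⟨(c₀₁₃ ≫ f₀₁ ◁ c₁₂₃) ≫ (α_ f₀₁ f₁₂ f₂₃).inv ≫ inv (c₀₁₂ ▷ f₂₃), by simp [PastingRel]⟩

theorem exists_pastingRel_two (c₀₁₂ : f₀₂ ⟶ f₀₁ ≫ f₁₂) (c₀₂₃ : f₀₃ ⟶ f₀₂ ≫ f₂₃)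
    (c₁₂₃ : f₁₃ ⟶ f₁₂ ≫ f₂₃) (h : IsIso c₁₂₃) :
    ∃ c₀₁₃ : f₀₃ ⟶ f₀₁ ≫ f₁₃, PastingRel c₀₁₂ c₀₁₃ c₀₂₃ c₁₂₃ :=
  ⟨(c₀₂₃ ≫ c₀₁₂ ▷ f₂₃ ≫ (α_ f₀₁ f₁₂ f₂₃).hom) ≫ inv (f₀₁ ◁ c₁₂₃), by simp [PastingRel]⟩

theorem exists_pastingRel_three (c₀₁₃ : f₀₃ ⟶ f₀₁ ≫ f₁₃) (c₀₂₃ : f₀₃ ⟶ f₀₂ ≫ f₂₃)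
    (c₁₂₃ : f₁₃ ⟶ f₁₂ ≫ f₂₃) (h : IsEquivalence₁ f₂₃) (h' : IsIso c₀₂₃) :
    ∃ c₀₁₂ : f₀₂ ⟶ f₀₁ ≫ f₁₂, PastingRel c₀₁₂ c₀₁₃ c₀₂₃ c₁₂₃ := by
  obtain ⟨c, hc⟩ := h.whiskerRight_surjective
    (inv c₀₂₃ ≫ c₀₁₃ ≫ f₀₁ ◁ c₁₂₃ ≫ (α_ f₀₁ f₁₂ f₂₃).inv)
  exact ⟨c, by simp [PastingRel, hc]⟩

/-! The five pasting composites of a `4`-simplex correspond to the triangulations of a pentagon with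
vertices `0, …, 4`. Each of the five relations passes between two neighbouring ones, so that each is
implied by the other four whenever the additional triangle and edge can be cancelled. The next three
lemmas rewrite the composite that is shared by two neighbouring relations from the form in which it
appears in one of them to the form in which it appears in the other. -/

theorem pasting_edge_four_two : c₀₃₄ ≫ (c₀₁₃ ≫ f₀₁ ◁ c₁₂₃) ▷ f₃₄ ≫ (α_ f₀₁ (f₁₂ ≫ f₂₃) f₃₄).hom ≫
      f₀₁ ◁ (α_ f₁₂ f₂₃ f₃₄).hom =
    (c₀₃₄ ≫ c₀₁₃ ▷ f₃₄ ≫ (α_ f₀₁ f₁₃ f₃₄).hom) ≫ f₀₁ ◁ (c₁₂₃ ▷ f₃₄ ≫ (α_ f₁₂ f₂₃ f₃₄).hom) := by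
  simp

theorem pasting_edge_three_one : (c₀₂₄ ≫ c₀₁₂ ▷ f₂₄ ≫ (α_ f₀₁ f₁₂ f₂₄).hom) ≫ f₀₁ ◁ f₁₂ ◁ c₂₃₄ =
    (c₀₂₄ ≫ f₀₂ ◁ c₂₃₄) ≫ c₀₁₂ ▷ (f₂₃ ≫ f₃₄) ≫ (α_ f₀₁ f₁₂ (f₂₃ ≫ f₃₄)).hom := by
  simp only [Category.assoc, Bicategory.whisker_exchange_assoc, Bicategory.comp_whiskerLeft,
    Iso.inv_hom_id, Category.comp_id]

theorem pasting_edge_one_four : (c₀₃₄ ≫ c₀₂₃ ▷ f₃₄ ≫ (α_ f₀₂ f₂₃ f₃₄).hom) ≫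
      c₀₁₂ ▷ (f₂₃ ≫ f₃₄) ≫ (α_ f₀₁ f₁₂ (f₂₃ ≫ f₃₄)).hom =
    c₀₃₄ ≫ (c₀₂₃ ≫ c₀₁₂ ▷ f₂₃ ≫ (α_ f₀₁ f₁₂ f₂₃).hom) ▷ f₃₄ ≫ (α_ f₀₁ (f₁₂ ≫ f₂₃) f₃₄).hom ≫
      f₀₁ ◁ (α_ f₁₂ f₂₃ f₃₄).hom := by
  simp

/-- The relation for `1 < 2 < 3 < 4`, up to whiskering, follows from the other four. -/
theorem pasting_zero (h1 : PastingRel c₀₂₃ c₀₂₄ c₀₃₄ c₂₃₄) (h2 : PastingRel c₀₁₃ c₀₁₄ c₀₃₄ c₁₃₄)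
    (h3 : PastingRel c₀₁₂ c₀₁₄ c₀₂₄ c₁₂₄) (h4 : PastingRel c₀₁₂ c₀₁₃ c₀₂₃ c₁₂₃) :
    c₀₁₄ ≫ f₀₁ ◁ (c₁₂₄ ≫ f₁₂ ◁ c₂₃₄) =
      c₀₁₄ ≫ f₀₁ ◁ (c₁₃₄ ≫ c₁₂₃ ▷ f₃₄ ≫ (α_ f₁₂ f₂₃ f₃₄).hom) := by
  rw [Bicategory.whiskerLeft_comp, ← Category.assoc, h3, pasting_edge_three_one, h1,
    pasting_edge_one_four, ← h4, pasting_edge_four_two, ← h2, Category.assoc,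
    ← Bicategory.whiskerLeft_comp]

theorem pastingRel_zero (h1 : PastingRel c₀₂₃ c₀₂₄ c₀₃₄ c₂₃₄) (h2 : PastingRel c₀₁₃ c₀₁₄ c₀₃₄ c₁₃₄)
    (h3 : PastingRel c₀₁₂ c₀₁₄ c₀₂₄ c₁₂₄) (h4 : PastingRel c₀₁₂ c₀₁₃ c₀₂₃ c₁₂₃)
    (hf : IsEquivalence₁ f₀₁) (hc : IsIso c₀₁₄) : PastingRel c₁₂₃ c₁₂₄ c₁₃₄ c₂₃₄ :=
  hf.whiskerLeft_injective ((cancel_epi c₀₁₄).1 (pasting_zero h1 h2 h3 h4))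

theorem pastingRel_one (h0 : PastingRel c₁₂₃ c₁₂₄ c₁₃₄ c₂₃₄) (h2 : PastingRel c₀₁₃ c₀₁₄ c₀₃₄ c₁₃₄)
    (h3 : PastingRel c₀₁₂ c₀₁₄ c₀₂₄ c₁₂₄) (h4 : PastingRel c₀₁₂ c₀₁₃ c₀₂₃ c₁₂₃)
    (hc : IsIso c₀₁₂) : PastingRel c₀₂₃ c₀₂₄ c₀₃₄ c₂₃₄ := by
  rw [PastingRel, ← cancel_mono (c₀₁₂ ▷ (f₂₃ ≫ f₃₄) ≫ (α_ f₀₁ f₁₂ (f₂₃ ≫ f₃₄)).hom),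
    pasting_edge_one_four, ← h4, pasting_edge_four_two, ← h2, ← pasting_edge_three_one, ← h3,
    Category.assoc, Category.assoc, ← Bicategory.whiskerLeft_comp, ← Bicategory.whiskerLeft_comp,
    h0]

theorem pastingRel_two (h0 : PastingRel c₁₂₃ c₁₂₄ c₁₃₄ c₂₃₄) (h1 : PastingRel c₀₂₃ c₀₂₄ c₀₃₄ c₂₃₄)
    (h3 : PastingRel c₀₁₂ c₀₁₄ c₀₂₄ c₁₂₄) (h4 : PastingRel c₀₁₂ c₀₁₃ c₀₂₃ c₁₂₃)
    (hc : IsIso c₁₂₃) : PastingRel c₀₁₃ c₀₁₄ c₀₃₄ c₁₃₄ := by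
  rw [PastingRel, ← cancel_mono (f₀₁ ◁ (c₁₂₃ ▷ f₃₄ ≫ (α_ f₁₂ f₂₃ f₃₄).hom)),
    ← pasting_edge_four_two, h4, ← pasting_edge_one_four, ← h1, ← pasting_edge_three_one, ← h3,
    Category.assoc, Category.assoc, ← Bicategory.whiskerLeft_comp, ← Bicategory.whiskerLeft_comp,
    h0]

theorem pastingRel_three (h0 : PastingRel c₁₂₃ c₁₂₄ c₁₃₄ c₂₃₄) (h1 : PastingRel c₀₂₃ c₀₂₄ c₀₃₄ c₂₃₄)
    (h2 : PastingRel c₀₁₃ c₀₁₄ c₀₃₄ c₁₃₄) (h4 : PastingRel c₀₁₂ c₀₁₃ c₀₂₃ c₁₂₃)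
    (hc : IsIso c₂₃₄) : PastingRel c₀₁₂ c₀₁₄ c₀₂₄ c₁₂₄ := by
  rw [PastingRel, ← cancel_mono (f₀₁ ◁ f₁₂ ◁ c₂₃₄), pasting_edge_three_one, h1,
    pasting_edge_one_four, ← h4, pasting_edge_four_two, ← h2,
    Category.assoc, Category.assoc, ← Bicategory.whiskerLeft_comp, ← Bicategory.whiskerLeft_comp,
    h0]

theorem pastingRel_four (h0 : PastingRel c₁₂₃ c₁₂₄ c₁₃₄ c₂₃₄) (h1 : PastingRel c₀₂₃ c₀₂₄ c₀₃₄ c₂₃₄)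
    (h2 : PastingRel c₀₁₃ c₀₁₄ c₀₃₄ c₁₃₄) (h3 : PastingRel c₀₁₂ c₀₁₄ c₀₂₄ c₁₂₄)
    (hf : IsEquivalence₁ f₃₄) (hc : IsIso c₀₃₄) : PastingRel c₀₁₂ c₀₁₃ c₀₂₃ c₁₂₃ := by
  apply hf.whiskerRight_injective
  rw [← cancel_mono ((α_ f₀₁ (f₁₂ ≫ f₂₃) f₃₄).hom ≫ f₀₁ ◁ (α_ f₁₂ f₂₃ f₃₄).hom),
    ← cancel_epi c₀₃₄, pasting_edge_four_two, ← h2, ← pasting_edge_one_four, ← h1,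
    ← pasting_edge_three_one, ← h3, Category.assoc, Category.assoc,
    ← Bicategory.whiskerLeft_comp, ← Bicategory.whiskerLeft_comp, h0]

end Pasting

/-! ### Fillers of complicial horns in the natural nerve -/

/-- Extension of a dependent function by a value at the only missing argument. -/
theorem exists_extend {B : Type*} {T : B → Type*} {H : B → Prop} (g : ∀ b, H b → T b) (b₀ : B)
    (h₀ : ¬ H b₀) (hB : ∀ b, H b ∨ b = b₀) (t : T b₀) :
    ∃ f : ∀ b, T b, (∀ b h, f b = g b h) ∧ f b₀ = t := by
  classical
  refine ⟨fun b => if h : H b then g b h else ((hB b).resolve_left h) ▸ t, fun b h => dif_pos h, ?_⟩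
  exact dif_neg h₀

/-- The monotone map with two given values. -/
def pairMap {n : ℕ} (i j : Fin (n + 1)) (h : i ≤ j) : Fin (1 + 1) →o Fin (n + 1) :=
  ⟨![i, j], Fin.monotone_iff_le_succ.2 fun a => by fin_cases a; exact h⟩

/-- The monotone map with three given values. -/
def tripleMap {n : ℕ} (i j k : Fin (n + 1)) (h : i ≤ j) (h' : j ≤ k) :
    Fin (2 + 1) →o Fin (n + 1) :=
  ⟨![i, j, k], Fin.monotone_iff_le_succ.2 fun a => by
    fin_cases a
    · exact h
    · exact h'⟩

/-- The monotone map with four given values. -/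
def quadMap {n : ℕ} (i j k l : Fin (n + 1)) (h : i ≤ j) (h' : j ≤ k) (h'' : k ≤ l) :
    Fin (3 + 1) →o Fin (n + 1) :=
  ⟨![i, j, k, l], Fin.monotone_iff_le_succ.2 fun a => by
    fin_cases a
    · exact h
    · exact h'
    · exact h''⟩

theorem comp_pairMap {m n : ℕ} (i j : Fin (m + 1)) (h : i ≤ j) (x : Fin (m + 1) →o Fin (n + 1)) :
    x.comp (pairMap i j h) = pairMap (x i) (x j) (x.monotone h) := by
  ext a
  fin_cases a <;> rfl

theorem comp_tripleMap {m n : ℕ} (i j k : Fin (m + 1)) (h : i ≤ j) (h' : j ≤ k)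
    (x : Fin (m + 1) →o Fin (n + 1)) :
    x.comp (tripleMap i j k h h') = tripleMap (x i) (x j) (x k) (x.monotone h) (x.monotone h') := by
  ext a
  fin_cases a <;> rfl

/-- The simplex `x` of `Δ[m]` lies in the horn `Λᵏ[m]`. -/
def IsHornFace {m n : ℕ} (k : Fin (m + 1)) (x : Fin (n + 1) →o Fin (m + 1)) : Prop :=
  ∃ j, j ≠ k ∧ ∀ i, x i ≠ j

section

variable {m : ℕ} {k : Fin (m + 1)}

theorem IsHornFace.comp {n n' : ℕ} {x : Fin (n + 1) →o Fin (m + 1)} (hx : IsHornFace k x)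
    (θ : Fin (n' + 1) →o Fin (n + 1)) : IsHornFace k (x.comp θ) := by
  obtain ⟨j, hj, h⟩ := hx
  exact ⟨j, hj, fun i => h _⟩

/-- The horn `Λᵏ[m]` contains all simplices of dimension less than `m - 1`. -/
theorem isHornFace_of_lt {n : ℕ} (h : n + 1 < m) (x : Fin (n + 1) →o Fin (m + 1)) :
    IsHornFace k x := by
  by_contra hx
  have h1 : insert k (Finset.univ.image x) = Finset.univ := by
    ext j
    simp only [Finset.mem_insert, Finset.mem_image, Finset.mem_univ, true_and, iff_true]
    by_contra hj
    push Not at hj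
    exact hx ⟨j, hj.1, hj.2⟩
  have h2 := congrArg Finset.card h1
  have h3 := Finset.card_insert_le k (Finset.univ.image x)
  have h4 : (Finset.univ.image x).card ≤ (Finset.univ : Finset (Fin (n + 1))).card :=
    Finset.card_image_le
  simp only [Finset.card_univ, Fintype.card_fin] at h2 h4
  omega

theorem eq_or_exists_of_not_isHornFace {n : ℕ} {x : Fin (n + 1) →o Fin (m + 1)}
    (hx : ¬ IsHornFace k x) (j : Fin (m + 1)) : j = k ∨ ∃ i, x i = j := by
  by_contra hj
  push Not at hj
  exact hx ⟨j, hj.1, hj.2⟩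

theorem eq_of_not_isHornFace_pairMap {i j : Fin (m + 1)} {h : i ≤ j}
    (hx : ¬ IsHornFace k (pairMap i j h)) (a : Fin (m + 1)) : a = k ∨ a = i ∨ a = j := by
  obtain ha | ⟨b, rfl⟩ := eq_or_exists_of_not_isHornFace hx a
  · exact .inl ha
  · right
    fin_cases b
    · exact .inl rfl
    · exact .inr rfl

theorem eq_of_not_isHornFace_tripleMap {i j l : Fin (m + 1)} {h : i ≤ j} {h' : j ≤ l}
    (hx : ¬ IsHornFace k (tripleMap i j l h h')) (a : Fin (m + 1)) :
    a = k ∨ a = i ∨ a = j ∨ a = l := by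
  obtain ha | ⟨b, rfl⟩ := eq_or_exists_of_not_isHornFace hx a
  · exact .inl ha
  · right
    fin_cases b
    · exact .inl rfl
    · exact .inr (.inl rfl)
    · exact .inr (.inr rfl)

theorem eq_of_not_isHornFace_quadMap {i j l q : Fin (m + 1)} {h : i ≤ j} {h' : j ≤ l} {h'' : l ≤ q}
    (hx : ¬ IsHornFace k (quadMap i j l q h h' h'')) (a : Fin (m + 1)) :
    a = k ∨ a = i ∨ a = j ∨ a = l ∨ a = q := by
  obtain ha | ⟨b, rfl⟩ := eq_or_exists_of_not_isHornFace hx a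
  · exact .inl ha
  · right
    fin_cases b
    · exact .inl rfl
    · exact .inr (.inl rfl)
    · exact .inr (.inr (.inl rfl))
    · exact .inr (.inr (.inr rfl))

end

namespace NerveSimplex

variable {C : Type u} [Bicategory.{w, v} C]

/-- A map from the complicial horn `Λᵏ[m]` to the natural nerve, as a compatible family of simplices
of the nerve. -/
structure HornFamily (C : Type u) [Bicategory.{w, v} C] (m : ℕ) (k : Fin (m + 1)) where
  F : ∀ {n : ℕ} (x : Fin (n + 1) →o Fin (m + 1)), IsHornFace k x →
    NerveSimplex (Fin (n + 1)) C
  F_comp : ∀ {n n' : ℕ} (θ : Fin (n' + 1) →o Fin (n + 1))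
    (x : Fin (n + 1) →o Fin (m + 1)) (hx : IsHornFace k x)
    (hx' : IsHornFace k (x.comp θ)), F (x.comp θ) hx' = reindex θ (F x hx)
  isEquivalence₁ : ∀ (i j : Fin (m + 1)) (h : i < j) (hx : IsHornFace k (pairMap i j h.le)),
    {i, j} ∈ admissibleMarking m k → IsEquivalence₁ (edge (F _ hx))
  isIso : ∀ (i j l : Fin (m + 1)) (h : i < j) (h' : j < l)
    (hx : IsHornFace k (tripleMap i j l h.le h'.le)),
    {i, j, l} ∈ admissibleMarking m k → IsIso (triangle (F _ hx))

namespace HornFamily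

variable {m : ℕ} {k : Fin (m + 1)} (H : HornFamily C m k)

theorem F_congr {n : ℕ} {x x' : Fin (n + 1) →o Fin (m + 1)} (e : x = x')
    (hx : IsHornFace k x) (hx' : IsHornFace k x') : H.F x hx = H.F x' hx' := by
  subst e
  rfl

/-- The objects of a filler, and those `1`-morphisms that lie in the horn. -/
theorem exists_maps (hm : 2 ≤ m) : ∃ (o : Fin (m + 1) → C)
    (p : ∀ (i j : Fin (m + 1)) (h : i ≤ j), IsHornFace k (pairMap i j h) → (o i ⟶ o j)),
    (∀ (i j : Fin (m + 1)) (h : i < j) hx, {i, j} ∈ admissibleMarking m k →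
      IsEquivalence₁ (p i j h.le hx)) ∧
    ∀ f : (∀ i j : Fin (m + 1), i ≤ j → (o i ⟶ o j)), (∀ i j h hx, f i j h = p i j h hx) →
      ∀ (n : ℕ) (x : Fin (n + 1) →o Fin (m + 1)) (hx : IsHornFace k x),
        ∃ D : Cells (I := Fin (n + 1)) (fun i => o (x i))
          (fun i j h => f (x i) (x j) (x.monotone h)),
          D.simplex = H.F x hx := by
  have hc : ∀ i, IsHornFace k (OrderHom.const (Fin (0 + 1)) i) :=
    fun i => isHornFace_of_lt (by omega) _
  let o : Fin (m + 1) → C := fun i => (H.F _ (hc i)).obj 0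
  have ho : ∀ (n : ℕ) (x : Fin (n + 1) →o Fin (m + 1)) (hx : IsHornFace k x),
      (H.F x hx).obj = fun i => o (x i) := by
    intro n x hx
    funext i
    have h1 := H.F_comp (OrderHom.const (Fin (0 + 1)) i) x hx (hx.comp _)
    have h2 := H.F_congr (x := x.comp (OrderHom.const (Fin (0 + 1)) i))
      (x' := OrderHom.const (Fin (0 + 1)) (x i)) rfl (hx.comp _) (hc _)
    have h3 := congrArg (fun σ : NerveSimplex (Fin 1) C => σ.obj 0) (h1.symm.trans h2)
    exact h3
  choose p D hD using fun (n : ℕ) (x : Fin (n + 1) →o Fin (m + 1))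
    (hx : IsHornFace k x) => exists_cells_of_obj (H.F x hx) _ (ho n x hx)
  have hp : ∀ (n n' : ℕ) (θ : Fin (n' + 1) →o Fin (n + 1))
      (x : Fin (n + 1) →o Fin (m + 1)) (hx : IsHornFace k x),
      p n' (x.comp θ) (hx.comp θ) = fun i j h =>
        p n x hx (θ i) (θ j) (θ.monotone h) := by
    intro n n' θ x hx
    refine Cells.map_eq (D := D n' (x.comp θ) (hx.comp θ)) (D' := (D n x hx).reindex θ) ?_
    exact (hD _ _ _).trans ((H.F_comp θ x hx _).trans (congrArg (reindex θ) (hD n x hx)).symm)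
  have hp' : ∀ (n : ℕ) (x x' : Fin (n + 1) →o Fin (m + 1)) (hx : IsHornFace k x)
      (hx' : IsHornFace k x') (e : x = x') (i j : Fin (n + 1)) (h : i ≤ j),
      HEq (p n x hx i j h) (p n x' hx' i j h) := by
    intro n x x' hx hx' e i j h
    subst e
    rfl
  refine ⟨o, fun i j h hx => p 1 (pairMap i j h) hx 0 1 (by decide), ?_, ?_⟩
  · intro i j h hx hP
    have := H.isEquivalence₁ i j h hx hP
    rw [← hD] at this
    exact this
  · intro f hf n x hx
    have e : (fun (i j : Fin (n + 1)) h => f (x i) (x j)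
        (x.monotone h)) = p n x hx := by
      funext i j h
      have h0 : IsHornFace k (pairMap (x i) (x j)
          (x.monotone h)) := comp_pairMap i j h x ▸ hx.comp (pairMap i j h)
      have h1 := congrFun (congrFun (congrFun (hp n 1 (pairMap i j h) x hx) 0) 1) (by decide)
      have h2 := hp' _ _ _ (hx.comp _) h0 (comp_pairMap i j h x) 0 1 (by decide)
      refine (hf _ _ _ h0).trans (Eq.trans ?_ h1)
      exact (eq_of_heq h2).symm
    rw [e]
    exact ⟨D n x hx, hD n x hx⟩

/-- Those `2`-morphisms of a filler that lie in the horn. -/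
theorem exists_cells {o : Fin (m + 1) → C} {f : ∀ i j : Fin (m + 1), i ≤ j → (o i ⟶ o j)}
    (h : ∀ (n : ℕ) (x : Fin (n + 1) →o Fin (m + 1)) (hx : IsHornFace k x),
        ∃ D : Cells (I := Fin (n + 1)) (fun i => o (x i))
          (fun i j h => f (x i) (x j) (x.monotone h)),
          D.simplex = H.F x hx) :
    ∃ c : ∀ (i j l : Fin (m + 1)) (hij : i ≤ j) (hjl : j ≤ l),
      IsHornFace k (tripleMap i j l hij hjl) →
        (f i l (hij.trans hjl) ⟶ f i j hij ≫ f j l hjl),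
      (∀ (i j l : Fin (m + 1)) (hij : i < j) (hjl : j < l) hx, {i, j, l} ∈ admissibleMarking m k →
        IsIso (c i j l hij.le hjl.le hx)) ∧
      ∀ (n : ℕ) (x : Fin (n + 1) →o Fin (m + 1)) (hx : IsHornFace k x),
        ∃ D : Cells (I := Fin (n + 1)) (fun i => o (x i))
          (fun i j h => f (x i) (x j) (x.monotone h)),
          D.simplex = H.F x hx ∧ ∀ i j l hij hjl hx', D.cell i j l hij hjl =
            c (x i) (x j) (x l) (x.monotone hij)
              (x.monotone hjl) hx' := by
  choose D hD using h
  have hp : ∀ (n n' : ℕ) (θ : Fin (n' + 1) →o Fin (n + 1))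
      (x : Fin (n + 1) →o Fin (m + 1)) (hx : IsHornFace k x),
      (D n' (x.comp θ) (hx.comp θ)).cell = fun i j l hij hjl =>
        (D n x hx).cell (θ i) (θ j) (θ l)
          (θ.monotone hij) (θ.monotone hjl) := by
    intro n n' θ x hx
    refine Cells.cell_eq (D := D n' (x.comp θ) (hx.comp θ)) (D' := (D n x hx).reindex θ) ?_
    exact (hD _ _ _).trans ((H.F_comp θ x hx _).trans (congrArg (reindex θ) (hD n x hx)).symm)
  have hp' : ∀ (n : ℕ) (x x' : Fin (n + 1) →o Fin (m + 1)) (hx : IsHornFace k x)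
      (hx' : IsHornFace k x') (e : x = x') (i j l : Fin (n + 1)) (hij : i ≤ j) (hjl : j ≤ l),
      HEq ((D n x hx).cell i j l hij hjl) ((D n x' hx').cell i j l hij hjl) := by
    intro n x x' hx hx' e i j l hij hjl
    subst e
    rfl
  refine ⟨fun i j l hij hjl hx => (D 2 (tripleMap i j l hij hjl) hx).cell 0 1 2 (by decide)
    (by decide), ?_, fun n x hx => ⟨D n x hx, hD n x hx, ?_⟩⟩
  · intro i j l hij hjl hx hP
    have := H.isIso i j l hij hjl hx hP
    rw [← hD] at this
    exact this
  · intro i j l hij hjl hx'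
    have h1 := congrFun (congrFun (congrFun (congrFun (congrFun
      (hp n 2 (tripleMap i j l hij hjl) x hx) 0) 1) 2) (by decide)) (by decide)
    have h2 := hp' _ _ _ (hx.comp _) hx' (comp_tripleMap i j l hij hjl x) 0 1 2 (by decide)
      (by decide)
    exact h1.symm.trans (eq_of_heq h2)

/-- The objects, the `1`-morphisms and the `2`-morphisms in the horn, for a horn of dimension at
least `3`. -/
theorem exists_maps_cells (hm : 3 ≤ m) : ∃ (o : Fin (m + 1) → C)
    (f : ∀ i j : Fin (m + 1), i ≤ j → (o i ⟶ o j)) (_ : ∀ i, f i i le_rfl = 𝟙 (o i))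
    (c : ∀ (i j l : Fin (m + 1)) (hij : i ≤ j) (hjl : j ≤ l),
      IsHornFace k (tripleMap i j l hij hjl) →
        (f i l (hij.trans hjl) ⟶ f i j hij ≫ f j l hjl)),
    (∀ (i j : Fin (m + 1)) (h : i < j), {i, j} ∈ admissibleMarking m k →
      IsEquivalence₁ (f i j h.le)) ∧
    (∀ (i j l : Fin (m + 1)) (hij : i < j) (hjl : j < l) hx, {i, j, l} ∈ admissibleMarking m k →
        IsIso (c i j l hij.le hjl.le hx)) ∧
      ∀ (n : ℕ) (x : Fin (n + 1) →o Fin (m + 1)) (hx : IsHornFace k x),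
        ∃ D : Cells (I := Fin (n + 1)) (fun i => o (x i))
          (fun i j h => f (x i) (x j) (x.monotone h)),
          D.simplex = H.F x hx ∧ ∀ i j l hij hjl hx', D.cell i j l hij hjl =
            c (x i) (x j) (x l) (x.monotone hij) (x.monotone hjl) hx' := by
  obtain ⟨o, p, hp, h⟩ := H.exists_maps (by omega)
  have hface : ∀ i j h, IsHornFace k (pairMap i j h) := fun i j h => isHornFace_of_lt (by omega) _
  obtain ⟨c, hc, hD⟩ := H.exists_cells (f := fun i j h => p i j h (hface i j h))
    (h (fun i j h => p i j h (hface i j h)) fun _ _ _ _ => rfl)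
  refine ⟨o, fun i j h => p i j h (hface i j h), fun i => ?_, c,
    fun i j h hP => hp i j h (hface _ _ _) hP, hc, hD⟩
  obtain ⟨D, -⟩ := hD 0 (OrderHom.const (Fin (0 + 1)) i) (isHornFace_of_lt (by omega) _)
  exact D.map_self 0

/-- A filler of a horn: a simplex of the nerve with the prescribed faces, whose `2`-morphism is
invertible if it is a triangle. -/
def HasFiller (H : HornFamily C m k) : Prop :=
  ∃ σ : NerveSimplex (Fin (m + 1)) C,
    (∀ (n : ℕ) (x : Fin (n + 1) →o Fin (m + 1)) (hx : IsHornFace k x),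
      reindex x σ = H.F x hx) ∧
    ∀ (i j l : Fin (m + 1)) (hij : i < j) (hjl : j < l),
      ¬ IsHornFace k (tripleMap i j l hij.le hjl.le) →
      {i, j, l} ∈ admissibleMarking m k → IsIso (σ.cell i j l hij.le hjl.le)

variable [Bicategory.Strict C]

/-- Reduction of the construction of a filler to finding the `2`-morphisms of the remaining
triangles and checking the remaining relations. -/
theorem hasFiller_of_cells {o : Fin (m + 1) → C} {f : ∀ i j : Fin (m + 1), i ≤ j → (o i ⟶ o j)}
    (h1 : ∀ i, f i i le_rfl = 𝟙 (o i))
    {c : ∀ (i j l : Fin (m + 1)) (hij : i ≤ j) (hjl : j ≤ l),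
      IsHornFace k (tripleMap i j l hij hjl) →
        (f i l (hij.trans hjl) ⟶ f i j hij ≫ f j l hjl)}
    (h : ∀ (n : ℕ) (x : Fin (n + 1) →o Fin (m + 1)) (hx : IsHornFace k x),
        ∃ D : Cells (I := Fin (n + 1)) (fun i => o (x i))
          (fun i j h => f (x i) (x j) (x.monotone h)),
          D.simplex = H.F x hx ∧ ∀ i j l hij hjl hx', D.cell i j l hij hjl =
            c (x i) (x j) (x l) (x.monotone hij)
              (x.monotone hjl) hx')
    (d : ∀ (i j l : Fin (m + 1)) (hij : i < j) (hjl : j < l),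
        (f i l (hij.trans hjl).le ⟶ f i j hij.le ≫ f j l hjl.le))
    (hd : ∀ i j l hij hjl hx, d i j l hij hjl = c i j l hij.le hjl.le hx)
    (hiso : ∀ (i j l : Fin (m + 1)) (hij : i < j) (hjl : j < l),
      ¬ IsHornFace k (tripleMap i j l hij.le hjl.le) →
      {i, j, l} ∈ admissibleMarking m k → IsIso (d i j l hij hjl))
    (hrel : (∀ (i j l q : Fin (m + 1)) (hij : i < j) (hjl : j < l) (hlq : l < q),
        IsHornFace k (quadMap i j l q hij.le hjl.le hlq.le) →
        PastingRel (d i j l hij hjl) (d i j q hij (hjl.trans hlq)) (d i l q (hij.trans hjl) hlq)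
          (d j l q hjl hlq)) →
      ∀ (i j l q : Fin (m + 1)) (hij : i < j) (hjl : j < l) (hlq : l < q),
        ¬ IsHornFace k (quadMap i j l q hij.le hjl.le hlq.le) →
        PastingRel (d i j l hij hjl) (d i j q hij (hjl.trans hlq)) (d i l q (hij.trans hjl) hlq)
          (d j l q hjl hlq)) : H.HasFiller := by
  have hrel' : ∀ (i j l q : Fin (m + 1)) (hij : i < j) (hjl : j < l) (hlq : l < q),
        IsHornFace k (quadMap i j l q hij.le hjl.le hlq.le) →
        PastingRel (d i j l hij hjl) (d i j q hij (hjl.trans hlq)) (d i l q (hij.trans hjl) hlq)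
          (d j l q hjl hlq) := by
    intro i j l q hij hjl hlq hx
    obtain ⟨D, -, hD⟩ := h 3 _ hx
    have hq : ∀ (a b e : Fin (3 + 1)) (hab : a ≤ b) (hbe : b ≤ e), IsHornFace k (tripleMap
        (quadMap i j l q hij.le hjl.le hlq.le a) (quadMap i j l q hij.le hjl.le hlq.le b)
        (quadMap i j l q hij.le hjl.le hlq.le e) (OrderHom.monotone _ hab)
        (OrderHom.monotone _ hbe)) := fun a b e hab hbe =>
      comp_tripleMap a b e hab hbe (quadMap i j l q hij.le hjl.le hlq.le) ▸ hx.comp _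
    have e1 := hD 0 1 2 (by decide) (by decide) (hq 0 1 2 (by decide) (by decide))
    have e2 := hD 0 1 3 (by decide) (by decide) (hq 0 1 3 (by decide) (by decide))
    have e3 := hD 0 2 3 (by decide) (by decide) (hq 0 2 3 (by decide) (by decide))
    have e4 := hD 1 2 3 (by decide) (by decide) (hq 1 2 3 (by decide) (by decide))
    have e := D.cell_assoc 0 1 2 3 (by decide) (by decide) (by decide)
    have f1 := e1.trans (hd i j l hij hjl _).symm
    have f2 := e2.trans (hd i j q hij (hjl.trans hlq) _).symm
    have f3 := e3.trans (hd i l q (hij.trans hjl) hlq _).symm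
    have f4 := e4.trans (hd j l q hjl hlq _).symm
    rw [f1, f2, f3, f4] at e
    exact e
  -- The degenerate triangles of the horn are identities, since they are degenerate on its edges.
  have hleft : ∀ (i j l : Fin (m + 1)) (hij : i ≤ j) (hjl : j ≤ l) hx, i = j →
      IsIdentity₂ (c i j l hij hjl hx) := by
    intro i j l hij hjl hx e
    subst e
    have hx' : IsHornFace k (pairMap i l hjl) := by
      obtain ⟨a, ha, h⟩ := hx
      refine ⟨a, ha, fun b => ?_⟩
      fin_cases b
      · exact h 0
      · exact h 2
    obtain ⟨D, -, hD⟩ := h 1 _ hx'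
    exact hD 0 0 1 (by decide) (by decide) hx ▸
      NerveSimplex.isIdentity₂_cell_left D.simplex 0 0 1 (by decide) (by decide) rfl
  have hright : ∀ (i j l : Fin (m + 1)) (hij : i ≤ j) (hjl : j ≤ l) hx, j = l →
      IsIdentity₂ (c i j l hij hjl hx) := by
    intro i j l hij hjl hx e
    subst e
    have hx' : IsHornFace k (pairMap i j hij) := by
      obtain ⟨a, ha, h⟩ := hx
      refine ⟨a, ha, fun b => ?_⟩
      fin_cases b
      · exact h 0
      · exact h 2
    obtain ⟨D, -, hD⟩ := h 1 _ hx'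
    exact hD 0 1 1 (by decide) (by decide) hx ▸
      NerveSimplex.isIdentity₂_cell_right D.simplex 0 1 1 (by decide) (by decide) rfl
  obtain ⟨D, hD⟩ := exists_cells_of_lt o f h1 d fun i j l q hij hjl hlq => by
    by_cases hx : IsHornFace k (quadMap i j l q hij.le hjl.le hlq.le)
    · exact hrel' i j l q hij hjl hlq hx
    · exact hrel hrel' i j l q hij hjl hlq hx
  refine ⟨D.simplex, fun n x hx => ?_, fun i j l hij hjl hx hP => ?_⟩
  · obtain ⟨D', h1, h2⟩ := h n x hx
    rw [← h1]
    refine Cells.simplex_eq (D := D.reindex x) (D' := D') ?_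
    funext i j l hij hjl
    have hx' : IsHornFace k (tripleMap (x i) (x j) (x l) (x.monotone hij) (x.monotone hjl)) :=
      comp_tripleMap i j l hij hjl x ▸ hx.comp _
    refine Eq.trans ?_ (h2 i j l hij hjl hx').symm
    rcases (x.monotone hij).eq_or_lt with e | hij'
    · exact (NerveSimplex.isIdentity₂_cell_left D.simplex _ _ _ _ _ e).eq (hleft _ _ _ _ _ hx' e)
    rcases (x.monotone hjl).eq_or_lt with e | hjl'
    · exact (NerveSimplex.isIdentity₂_cell_right D.simplex _ _ _ _ _ e).eq (hright _ _ _ _ _ hx' e)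
    · exact (hD _ _ _ hij' hjl').trans (hd _ _ _ hij' hjl' hx')
  · have := hiso i j l hij hjl hx hP
    rw [← hD] at this
    exact this

/-- The missing edge is a composite, possibly with a quasi-inverse of one of the two given edges. -/
theorem hasFiller_two {k : Fin (2 + 1)} (H : HornFamily C 2 k) : H.HasFiller := by
  obtain ⟨o, p, hp, h⟩ := H.exists_maps le_rfl
  -- the missing `1`-morphism, with an invertible `2`-morphism
  obtain ⟨f, hf, ⟨φ⟩⟩ : ∃ f : ∀ i j : Fin (2 + 1), i ≤ j → (o i ⟶ o j),
      (∀ i j h hx, f i j h = p i j h hx) ∧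
      Nonempty (f 0 2 (by decide) ≅ f 0 1 (by decide) ≫ f 1 2 (by decide)) := by
    let B := {b : Fin (2 + 1) × Fin (2 + 1) // b.1 ≤ b.2}
    have key : ∀ (b₀ : B) (hb₀ : ¬ IsHornFace k (pairMap b₀.1.1 b₀.1.2 b₀.2))
        (hB : ∀ i j h, IsHornFace k (pairMap i j h) ∨ (i = b₀.1.1 ∧ j = b₀.1.2))
        (t : o b₀.1.1 ⟶ o b₀.1.2), ∃ f : ∀ i j : Fin (2 + 1), i ≤ j → (o i ⟶ o j),
        (∀ i j h hx, f i j h = p i j h hx) ∧ f b₀.1.1 b₀.1.2 b₀.2 = t := by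
      intro b₀ hb₀ hB t
      obtain ⟨f, hf, hf'⟩ := exists_extend (B := B) (T := fun b => o b.1.1 ⟶ o b.1.2)
        (H := fun b => IsHornFace k (pairMap b.1.1 b.1.2 b.2)) (fun b => p b.1.1 b.1.2 b.2) b₀ hb₀
        (fun b => (hB _ _ b.2).imp id fun h => Subtype.ext (Prod.ext h.1 h.2)) t
      exact ⟨fun i j h => f ⟨(i, j), h⟩, fun i j h hx => hf ⟨(i, j), h⟩ hx, hf'⟩
    have hface : ∀ k i j : Fin (2 + 1), i ≤ j → (∃ a, a ≠ k ∧ i ≠ a ∧ j ≠ a) ∨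
        (k = 0 ∧ i = 1 ∧ j = 2) ∨ (k = 1 ∧ i = 0 ∧ j = 2) ∨ (k = 2 ∧ i = 0 ∧ j = 1) := by decide
    have hface' : ∀ (i j : Fin (2 + 1)) (h : i ≤ j), IsHornFace k (pairMap i j h) ∨
        (k = 0 ∧ i = 1 ∧ j = 2) ∨ (k = 1 ∧ i = 0 ∧ j = 2) ∨ (k = 2 ∧ i = 0 ∧ j = 1) := by
      intro i j h
      refine (hface k i j h).imp (fun ⟨a, ha, hi, hj⟩ => ⟨a, ha, fun b => ?_⟩) id
      fin_cases b
      · exact hi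
      · exact hj
    obtain rfl | rfl | rfl := (by decide : ∀ k : Fin (2 + 1), k = 0 ∨ k = 1 ∨ k = 2) k
    · have h01 : IsHornFace 0 (pairMap (0 : Fin (2 + 1)) 1 (by decide)) :=
        (hface' _ _ _).resolve_right (by decide)
      have h02 : IsHornFace 0 (pairMap (0 : Fin (2 + 1)) 2 (by decide)) :=
        (hface' _ _ _).resolve_right (by decide)
      obtain ⟨g, -, ⟨η⟩, -⟩ := (hp 0 1 (by decide) h01 (by
        simp only [admissibleMarking, Set.mem_ofPred_eq, Set.mem_insert_iff, Set.mem_singleton_iff]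
        decide)).exists_inverse
      obtain ⟨f, hf, hf'⟩ := key ⟨(1, 2), by decide⟩ (fun ⟨a, ha, h⟩ => by
        have h0 := h 0
        have h1 := h 1
        revert a
        decide) (fun i j h => (hface' i j h).imp id (by simp)) (g ≫ p 0 2 (by decide) h02)
      refine ⟨f, hf, ⟨?_⟩⟩
      rw [hf _ _ _ h01, hf _ _ _ h02]
      refine (λ_ _).symm ≪≫ Bicategory.whiskerRightIso η _ ≪≫ α_ _ _ _ ≪≫
        Bicategory.whiskerLeftIso _ (eqToIso hf'.symm)
    · obtain ⟨f, hf, hf'⟩ := key ⟨(0, 2), by decide⟩ (fun ⟨a, ha, h⟩ => by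
        have h0 := h 0
        have h1 := h 1
        revert a
        decide) (fun i j h => (hface' i j h).imp id (by simp))
        (p 0 1 (by decide) ((hface' _ _ _).resolve_right (by decide)) ≫
          p 1 2 (by decide) ((hface' _ _ _).resolve_right (by decide)))
      exact ⟨f, hf, ⟨eqToIso (hf'.trans (by rw [hf, hf]))⟩⟩
    · have h12 : IsHornFace 2 (pairMap (1 : Fin (2 + 1)) 2 (by decide)) :=
        (hface' _ _ _).resolve_right (by decide)
      have h02 : IsHornFace 2 (pairMap (0 : Fin (2 + 1)) 2 (by decide)) :=
        (hface' _ _ _).resolve_right (by decide)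
      obtain ⟨g, -, -, ⟨e⟩⟩ := (hp 1 2 (by decide) h12 (by
        simp only [admissibleMarking, Set.mem_ofPred_eq, Set.mem_insert_iff, Set.mem_singleton_iff]
        decide)).exists_inverse
      obtain ⟨f, hf, hf'⟩ := key ⟨(0, 1), by decide⟩ (fun ⟨a, ha, h⟩ => by
        have h0 := h 0
        have h1 := h 1
        revert a
        decide) (fun i j h => (hface' i j h).imp id (by simp)) (p 0 2 (by decide) h02 ≫ g)
      refine ⟨f, hf, ⟨?_⟩⟩
      rw [hf _ _ _ h12, hf _ _ _ h02]
      refine (ρ_ _).symm ≪≫ Bicategory.whiskerLeftIso _ e.symm ≪≫ (α_ _ _ _).symm ≪≫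
        Bicategory.whiskerRightIso (eqToIso hf'.symm) _
  have hcases : ∀ i j l : Fin (2 + 1), i < j → j < l → i = 0 ∧ j = 1 ∧ l = 2 := by decide
  have hnot : ∀ (i j l : Fin (2 + 1)) (hij : i < j) (hjl : j < l),
      ¬ IsHornFace k (tripleMap i j l hij.le hjl.le) := by
    rintro i j l hij hjl ⟨a, -, ha⟩
    obtain ⟨rfl, rfl, rfl⟩ := hcases i j l hij hjl
    exact ha a (by fin_cases a <;> rfl)
  obtain ⟨c, -, hc⟩ := H.exists_cells (h f hf)
  have h1 : ∀ i, f i i le_rfl = 𝟙 (o i) := by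
    intro i
    have hx : IsHornFace k (OrderHom.const (Fin (0 + 1)) i) := isHornFace_of_lt (by omega) _
    obtain ⟨D, -⟩ := hc 0 _ hx
    exact D.map_self 0
  have hφ : ∀ (i j l : Fin (2 + 1)) (hij : i < j) (hjl : j < l),
      Nonempty (f i l (hij.trans hjl).le ≅ f i j hij.le ≫ f j l hjl.le) := by
    intro i j l hij hjl
    obtain ⟨rfl, rfl, rfl⟩ := hcases i j l hij hjl
    exact ⟨φ⟩
  exact H.hasFiller_of_cells h1 hc (fun i j l hij hjl => (hφ i j l hij hjl).some.hom)
    (fun i j l hij hjl hx => (hnot i j l hij hjl hx).elim)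
    (fun i j l hij hjl _ _ => inferInstance)
    (fun _ i j l q hij hjl hlq => by simp only [Fin.lt_def] at hij hjl hlq; omega)

/-- The missing triangle is determined by the only relation. -/
theorem hasFiller_three {k : Fin (3 + 1)} (H : HornFamily C 3 k) : H.HasFiller := by
  obtain ⟨o, f, h1, c, hf, hc, hD⟩ := H.exists_maps_cells le_rfl
  let B := {b : Fin (3 + 1) × Fin (3 + 1) × Fin (3 + 1) // b.1 < b.2.1 ∧ b.2.1 < b.2.2}
  have key : ∀ (b₀ : B)
      (hb₀ : ¬ IsHornFace k (tripleMap b₀.1.1 b₀.1.2.1 b₀.1.2.2 b₀.2.1.le b₀.2.2.le))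
      (hB : ∀ (i j l : Fin (3 + 1)) (hij : i < j) (hjl : j < l),
        IsHornFace k (tripleMap i j l hij.le hjl.le) ∨
        (i = b₀.1.1 ∧ j = b₀.1.2.1 ∧ l = b₀.1.2.2))
      (t : f b₀.1.1 b₀.1.2.2 (b₀.2.1.trans b₀.2.2).le ⟶ f b₀.1.1 b₀.1.2.1 b₀.2.1.le ≫
        f b₀.1.2.1 b₀.1.2.2 b₀.2.2.le), ∃ d : ∀ (i j l : Fin (3 + 1)) (hij : i < j) (hjl : j < l),
        (f i l (hij.trans hjl).le ⟶ f i j hij.le ≫ f j l hjl.le),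
      (∀ i j l hij hjl hx, d i j l hij hjl = c i j l hij.le hjl.le hx) ∧
      d b₀.1.1 b₀.1.2.1 b₀.1.2.2 b₀.2.1 b₀.2.2 = t := by
    intro b₀ hb₀ hB t
    obtain ⟨d, hd, hd'⟩ := exists_extend (B := B) (T := fun b => f b.1.1 b.1.2.2
        (b.2.1.trans b.2.2).le ⟶ f b.1.1 b.1.2.1 b.2.1.le ≫ f b.1.2.1 b.1.2.2 b.2.2.le)
      (H := fun b => IsHornFace k (tripleMap b.1.1 b.1.2.1 b.1.2.2 b.2.1.le b.2.2.le))
      (fun b => c b.1.1 b.1.2.1 b.1.2.2 b.2.1.le b.2.2.le) b₀ hb₀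
      (fun b => (hB _ _ _ b.2.1 b.2.2).imp id fun h =>
        Subtype.ext (Prod.ext h.1 (Prod.ext h.2.1 h.2.2))) t
    exact ⟨fun i j l hij hjl => d ⟨(i, j, l), hij, hjl⟩,
      fun i j l hij hjl hx => hd ⟨(i, j, l), hij, hjl⟩ hx, hd'⟩
  have v : ((0 : Fin (3 + 1)) : ℕ) = 0 ∧ ((1 : Fin (3 + 1)) : ℕ) = 1 ∧ ((2 : Fin (3 + 1)) : ℕ) = 2 ∧
      ((3 : Fin (3 + 1)) : ℕ) = 3 := ⟨rfl, rfl, rfl, rfl⟩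
  have hface' : ∀ (i j l : Fin (3 + 1)) (hij : i < j) (hjl : j < l),
      IsHornFace k (tripleMap i j l hij.le hjl.le) ∨
      (k = 0 ∧ i = 1 ∧ j = 2 ∧ l = 3) ∨ (k = 1 ∧ i = 0 ∧ j = 2 ∧ l = 3) ∨
      (k = 2 ∧ i = 0 ∧ j = 1 ∧ l = 3) ∨ (k = 3 ∧ i = 0 ∧ j = 1 ∧ l = 2) := by
    intro i j l hij hjl
    by_cases hx : IsHornFace k (tripleMap i j l hij.le hjl.le)
    · exact .inl hx
    · right
      have hx := eq_of_not_isHornFace_tripleMap hx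
      have h0 := hx 0
      have h1 := hx 1
      have h2 := hx 2
      have h3 := hx 3
      simp only [Fin.ext_iff, Fin.lt_def] at hij hjl h0 h1 h2 h3 ⊢
      omega
  -- the missing `2`-morphism, solving the only relation
  obtain ⟨d, hd, hrel⟩ : ∃ d : ∀ (i j l : Fin (3 + 1)) (hij : i < j) (hjl : j < l),
        (f i l (hij.trans hjl).le ⟶ f i j hij.le ≫ f j l hjl.le),
      (∀ i j l hij hjl hx, d i j l hij hjl = c i j l hij.le hjl.le hx) ∧
      PastingRel (d 0 1 2 (by decide) (by decide)) (d 0 1 3 (by decide) (by decide))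
        (d 0 2 3 (by decide) (by decide)) (d 1 2 3 (by decide) (by decide)) := by
    have hN : ∀ (i j l : Fin (3 + 1)) (hij : i ≤ j) (hjl : j ≤ l),
        (∀ a, a ≠ k → a = i ∨ a = j ∨ a = l) → ¬ IsHornFace k (tripleMap i j l hij hjl) := by
      rintro i j l hij hjl h ⟨a, ha, h'⟩
      obtain rfl | rfl | rfl := h a ha
      · exact h' 0 rfl
      · exact h' 1 rfl
      · exact h' 2 rfl
    obtain rfl | rfl | rfl | rfl := (by decide : ∀ k : Fin (3 + 1), k = 0 ∨ k = 1 ∨ k = 2 ∨ k = 3) k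
    · have h012 := (hface' 0 1 2 (by decide) (by decide)).resolve_right (by decide)
      have h013 := (hface' 0 1 3 (by decide) (by decide)).resolve_right (by decide)
      have h023 := (hface' 0 2 3 (by decide) (by decide)).resolve_right (by decide)
      obtain ⟨t, ht⟩ := exists_pastingRel_zero (c 0 1 2 _ _ h012) (c 0 1 3 _ _ h013)
        (c 0 2 3 _ _ h023) (hf 0 1 (by decide) (by
          simp only [admissibleMarking, Set.mem_ofPred_eq, Set.mem_insert_iff,
            Set.mem_singleton_iff]
          decide)) (hc 0 1 3 (by decide) (by decide) h013 (by
          simp only [admissibleMarking, Set.mem_ofPred_eq, Set.mem_insert_iff,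
            Set.mem_singleton_iff]
          decide))
      obtain ⟨d, hd, hd'⟩ := key ⟨(1, 2, 3), by decide⟩ (hN _ _ _ _ _ (by decide))
        (fun i j l hij hjl => (hface' i j l hij hjl).imp id (by simp)) t
      refine ⟨d, hd, ?_⟩
      rw [hd _ _ _ _ _ h012, hd _ _ _ _ _ h013, hd _ _ _ _ _ h023]
      exact hd' ▸ ht
    · have h012 := (hface' 0 1 2 (by decide) (by decide)).resolve_right (by decide)
      have h013 := (hface' 0 1 3 (by decide) (by decide)).resolve_right (by decide)
      have h123 := (hface' 1 2 3 (by decide) (by decide)).resolve_right (by decide)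
      obtain ⟨t, ht⟩ := exists_pastingRel_one (c 0 1 2 _ _ h012) (c 0 1 3 _ _ h013)
        (c 1 2 3 _ _ h123) (hc 0 1 2 (by decide) (by decide) h012 (by
          simp only [admissibleMarking, Set.mem_ofPred_eq, Set.mem_insert_iff,
            Set.mem_singleton_iff]
          decide))
      obtain ⟨d, hd, hd'⟩ := key ⟨(0, 2, 3), by decide⟩ (hN _ _ _ _ _ (by decide))
        (fun i j l hij hjl => (hface' i j l hij hjl).imp id (by simp)) t
      refine ⟨d, hd, ?_⟩
      rw [hd _ _ _ _ _ h012, hd _ _ _ _ _ h013, hd _ _ _ _ _ h123]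
      exact hd' ▸ ht
    · have h012 := (hface' 0 1 2 (by decide) (by decide)).resolve_right (by decide)
      have h023 := (hface' 0 2 3 (by decide) (by decide)).resolve_right (by decide)
      have h123 := (hface' 1 2 3 (by decide) (by decide)).resolve_right (by decide)
      obtain ⟨t, ht⟩ := exists_pastingRel_two (c 0 1 2 _ _ h012) (c 0 2 3 _ _ h023)
        (c 1 2 3 _ _ h123) (hc 1 2 3 (by decide) (by decide) h123 (by
          simp only [admissibleMarking, Set.mem_ofPred_eq, Set.mem_insert_iff,
            Set.mem_singleton_iff]
          decide))
      obtain ⟨d, hd, hd'⟩ := key ⟨(0, 1, 3), by decide⟩ (hN _ _ _ _ _ (by decide))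
        (fun i j l hij hjl => (hface' i j l hij hjl).imp id (by simp)) t
      refine ⟨d, hd, ?_⟩
      rw [hd _ _ _ _ _ h012, hd _ _ _ _ _ h023, hd _ _ _ _ _ h123]
      exact hd' ▸ ht
    · have h013 := (hface' 0 1 3 (by decide) (by decide)).resolve_right (by decide)
      have h023 := (hface' 0 2 3 (by decide) (by decide)).resolve_right (by decide)
      have h123 := (hface' 1 2 3 (by decide) (by decide)).resolve_right (by decide)
      obtain ⟨t, ht⟩ := exists_pastingRel_three (c 0 1 3 _ _ h013) (c 0 2 3 _ _ h023)
        (c 1 2 3 _ _ h123) (hf 2 3 (by decide) (by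
          simp only [admissibleMarking, Set.mem_ofPred_eq, Set.mem_insert_iff,
            Set.mem_singleton_iff]
          decide)) (hc 0 2 3 (by decide) (by decide) h023 (by
          simp only [admissibleMarking, Set.mem_ofPred_eq, Set.mem_insert_iff,
            Set.mem_singleton_iff]
          decide))
      obtain ⟨d, hd, hd'⟩ := key ⟨(0, 1, 2), by decide⟩ (hN _ _ _ _ _ (by decide))
        (fun i j l hij hjl => (hface' i j l hij hjl).imp id (by simp)) t
      refine ⟨d, hd, ?_⟩
      rw [hd _ _ _ _ _ h013, hd _ _ _ _ _ h023, hd _ _ _ _ _ h123]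
      exact hd' ▸ ht
  refine H.hasFiller_of_cells h1 hD d hd (fun i j l hij hjl hx hP => ?_)
    (fun _ i j l q hij hjl hlq _ => ?_)
  · exfalso
    have hk := hP k (.inr (.inl rfl))
    have hx := eq_of_not_isHornFace_tripleMap hx
    have h0 := hx 0
    have h1 := hx 1
    have h2 := hx 2
    have h3 := hx 3
    simp only [Set.mem_insert_iff, Set.mem_singleton_iff, Fin.ext_iff, Fin.lt_def]
      at hij hjl hk h0 h1 h2 h3
    omega
  · obtain ⟨rfl, rfl, rfl, rfl⟩ : i = 0 ∧ j = 1 ∧ l = 2 ∧ q = 3 := by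
      simp only [Fin.lt_def, Fin.ext_iff] at hij hjl hlq ⊢
      omega
    exact hrel

/-- All edges and triangles lie in the horn. In dimension `4` one relation is missing, which follows
from the other four. -/
theorem hasFiller_of_four_le (hm : 4 ≤ m) : H.HasFiller := by
  obtain ⟨o, f, h1, c, hf, hc, hD⟩ := H.exists_maps_cells (by omega)
  have hface : ∀ i j l hij hjl, IsHornFace k (tripleMap i j l hij hjl) :=
    fun i j l hij hjl => isHornFace_of_lt (by omega) _
  refine H.hasFiller_of_cells h1 hD (fun i j l hij hjl => c i j l hij.le hjl.le (hface _ _ _ _ _))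
    (fun _ _ _ _ _ _ => rfl) (fun i j l hij hjl hx => (hx (hface _ _ _ _ _)).elim) ?_
  intro hrel i j l q hij hjl hlq hx
  obtain rfl : m = 4 := by
    by_contra
    exact hx (isHornFace_of_lt (by omega) _)
  have hall := eq_of_not_isHornFace_quadMap hx
  have v : ((0 : Fin (4 + 1)) : ℕ) = 0 ∧ ((1 : Fin (4 + 1)) : ℕ) = 1 ∧ ((2 : Fin (4 + 1)) : ℕ) = 2 ∧
      ((3 : Fin (4 + 1)) : ℕ) = 3 ∧ ((4 : Fin (4 + 1)) : ℕ) = 4 := ⟨rfl, rfl, rfl, rfl, rfl⟩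
  have hrel' : ∀ (i j l q : Fin (4 + 1)) (hij : i < j) (hjl : j < l) (hlq : l < q),
      (∃ a, a ≠ k ∧ i ≠ a ∧ j ≠ a ∧ l ≠ a ∧ q ≠ a) → PastingRel
        (c i j l hij.le hjl.le (hface _ _ _ _ _))
        (c i j q hij.le (hjl.trans hlq).le (hface _ _ _ _ _))
        (c i l q (hij.trans hjl).le hlq.le (hface _ _ _ _ _))
        (c j l q hjl.le hlq.le (hface _ _ _ _ _)) := by
    rintro i j l q hij hjl hlq ⟨a, ha, hi, hj, hl, hq⟩
    refine hrel i j l q hij hjl hlq ⟨a, ha, fun b => ?_⟩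
    fin_cases b
    · exact hi
    · exact hj
    · exact hl
    · exact hq
  have h0 := hall 0
  have h1 := hall 1
  have h2 := hall 2
  have h3 := hall 3
  have h4 := hall 4
  obtain rfl | rfl | rfl | rfl | rfl :=
    (by decide : ∀ k : Fin (4 + 1), k = 0 ∨ k = 1 ∨ k = 2 ∨ k = 3 ∨ k = 4) k
  · obtain ⟨rfl, rfl, rfl, rfl⟩ : i = 1 ∧ j = 2 ∧ l = 3 ∧ q = 4 := by
      simp only [Fin.lt_def, Fin.ext_iff] at hij hjl hlq h0 h1 h2 h3 h4 ⊢
      omega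
    exact pastingRel_zero (hrel' 0 2 3 4 (by decide) (by decide) (by decide) (by decide))
      (hrel' 0 1 3 4 (by decide) (by decide) (by decide) (by decide))
      (hrel' 0 1 2 4 (by decide) (by decide) (by decide) (by decide))
      (hrel' 0 1 2 3 (by decide) (by decide) (by decide) (by decide))
      (hf 0 1 (by decide) (by
        simp only [admissibleMarking, Set.mem_ofPred_eq, Set.mem_insert_iff, Set.mem_singleton_iff]
        decide))
      (hc 0 1 4 (by decide) (by decide) (hface _ _ _ _ _) (by
        simp only [admissibleMarking, Set.mem_ofPred_eq, Set.mem_insert_iff, Set.mem_singleton_iff]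
        decide))
  · obtain ⟨rfl, rfl, rfl, rfl⟩ : i = 0 ∧ j = 2 ∧ l = 3 ∧ q = 4 := by
      simp only [Fin.lt_def, Fin.ext_iff] at hij hjl hlq h0 h1 h2 h3 h4 ⊢
      omega
    exact pastingRel_one (hrel' 1 2 3 4 (by decide) (by decide) (by decide) (by decide))
      (hrel' 0 1 3 4 (by decide) (by decide) (by decide) (by decide))
      (hrel' 0 1 2 4 (by decide) (by decide) (by decide) (by decide))
      (hrel' 0 1 2 3 (by decide) (by decide) (by decide) (by decide))
      (hc 0 1 2 (by decide) (by decide) (hface _ _ _ _ _) (by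
        simp only [admissibleMarking, Set.mem_ofPred_eq, Set.mem_insert_iff, Set.mem_singleton_iff]
        decide))
  · obtain ⟨rfl, rfl, rfl, rfl⟩ : i = 0 ∧ j = 1 ∧ l = 3 ∧ q = 4 := by
      simp only [Fin.lt_def, Fin.ext_iff] at hij hjl hlq h0 h1 h2 h3 h4 ⊢
      omega
    exact pastingRel_two (hrel' 1 2 3 4 (by decide) (by decide) (by decide) (by decide))
      (hrel' 0 2 3 4 (by decide) (by decide) (by decide) (by decide))
      (hrel' 0 1 2 4 (by decide) (by decide) (by decide) (by decide))
      (hrel' 0 1 2 3 (by decide) (by decide) (by decide) (by decide))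
      (hc 1 2 3 (by decide) (by decide) (hface _ _ _ _ _) (by
        simp only [admissibleMarking, Set.mem_ofPred_eq, Set.mem_insert_iff, Set.mem_singleton_iff]
        decide))
  · obtain ⟨rfl, rfl, rfl, rfl⟩ : i = 0 ∧ j = 1 ∧ l = 2 ∧ q = 4 := by
      simp only [Fin.lt_def, Fin.ext_iff] at hij hjl hlq h0 h1 h2 h3 h4 ⊢
      omega
    exact pastingRel_three (hrel' 1 2 3 4 (by decide) (by decide) (by decide) (by decide))
      (hrel' 0 2 3 4 (by decide) (by decide) (by decide) (by decide))
      (hrel' 0 1 3 4 (by decide) (by decide) (by decide) (by decide))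
      (hrel' 0 1 2 3 (by decide) (by decide) (by decide) (by decide))
      (hc 2 3 4 (by decide) (by decide) (hface _ _ _ _ _) (by
        simp only [admissibleMarking, Set.mem_ofPred_eq, Set.mem_insert_iff, Set.mem_singleton_iff]
        decide))
  · obtain ⟨rfl, rfl, rfl, rfl⟩ : i = 0 ∧ j = 1 ∧ l = 2 ∧ q = 3 := by
      simp only [Fin.lt_def, Fin.ext_iff] at hij hjl hlq h0 h1 h2 h3 h4 ⊢
      omega
    exact pastingRel_four (hrel' 1 2 3 4 (by decide) (by decide) (by decide) (by decide))
      (hrel' 0 2 3 4 (by decide) (by decide) (by decide) (by decide))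
      (hrel' 0 1 3 4 (by decide) (by decide) (by decide) (by decide))
      (hrel' 0 1 2 4 (by decide) (by decide) (by decide) (by decide))
      (hf 3 4 (by decide) (by
        simp only [admissibleMarking, Set.mem_ofPred_eq, Set.mem_insert_iff, Set.mem_singleton_iff]
        decide))
      (hc 0 3 4 (by decide) (by decide) (hface _ _ _ _ _) (by
        simp only [admissibleMarking, Set.mem_ofPred_eq, Set.mem_insert_iff, Set.mem_singleton_iff]
        decide))

theorem hasFiller (hm : 2 ≤ m) : H.HasFiller := by
  obtain rfl | rfl | hm : m = 2 ∨ m = 3 ∨ 4 ≤ m := by omega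
  · exact H.hasFiller_two
  · exact H.hasFiller_three
  · exact H.hasFiller_of_four_le hm

end HornFamily

end NerveSimplex

namespace TDeltaSet

/-- A simplex of the standard simplex that lies in a horn, as a simplex of the complicial horn. -/
def hornFace {m n : ℕ} {k : Fin (m + 1)} (x : Fin (n + 1) →o Fin (m + 1)) (hx : IsHornFace k x) :
    (complicialHorn.{u} m k).obj (op (plain n)) :=
  (⟨SSet.stdSimplex.objEquiv.symm (SimplexCategory.mkHom x),
    (SSet.mem_horn_iff_notMem_range _ _).2 (by
      obtain ⟨j, hj, h⟩ := hx
      exact ⟨j, hj, fun ⟨i, hi⟩ => h i hi⟩)⟩ :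
    ((SSet.horn.{u} m k : SSet.Subcomplex _) : SSet.{u}).obj (op (.mk n)))

theorem exists_hornFace {m n : ℕ} {k : Fin (m + 1)}
    (y : (complicialHorn.{u} m k).obj (op (plain n))) : ∃ x hx, y = hornFace x hx := by
  obtain ⟨y, hy⟩ : ((SSet.horn.{u} m k : SSet.Subcomplex _) : SSet.{u}).obj (op (.mk n)) := y
  obtain ⟨j, hj, h⟩ := (SSet.mem_horn_iff_notMem_range _ _).1 hy
  exact ⟨(SSet.stdSimplex.objEquiv (n := .mk m) (m := op (.mk n)) y).toOrderHom,
    ⟨j, hj, fun i hi => h ⟨i, hi⟩⟩, rfl⟩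

theorem isLabelled_hornFace {m n : ℕ} {k : Fin (m + 1)} (x : Fin (n + 1 + 1) →o Fin (m + 1))
    (hx : IsHornFace k x) (h : Set.range x ∈ admissibleMarking m k) :
    IsLabelled (hornFace.{u} x hx) :=
  (LabelledSSet.isLabelled_iff (stratify ((SSet.horn.{u} m k : SSet.Subcomplex _) : SSet.{u})
    (fun x => vertexSet x.1 ∈ admissibleMarking m k)) (m := n) (hornFace.{u} x hx)).2 ⟨⟨⟨Or.inr h⟩⟩⟩

theorem complicialHornExtension_injective {m : ℕ} {k : Fin (m + 1)} (a) :
    Function.Injective ((complicialHornExtension.{u} m k).app a) := by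
  obtain ⟨a⟩ := a
  cases a with
  | plain n => exact fun x y h => Subtype.ext h
  | marked n =>
    intro x y h
    obtain ⟨x, l, rfl⟩ := LabelledSSet.exists_lab _ x
    obtain ⟨y, l', rfl⟩ := LabelledSSet.exists_lab _ y
    obtain rfl : x = y := Subtype.ext (Sigma.mk.inj_iff.1 h).1
    exact congrArg (LabelledSSet.lab _ x) (stratify_label_eq l l')

end TDeltaSet

namespace NerveSimplex

open TDeltaSet

variable {C : Type u} [Bicategory.{w, v} C] [Bicategory.Strict C] {m : ℕ} {k : Fin (m + 1)}

/-- The family of simplices given by a map from a complicial horn to the natural nerve. -/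
noncomputable def HornFamily.ofHom (f : complicialHorn m k ⟶ naturalNerve C) :
    HornFamily C m k where
  F x hx := f.app _ (hornFace x hx)
  F_comp {n n'} θ x hx hx' :=
    app_map f (pl (SimplexCategory.mkHom θ : SimplexCategory.mk n' ⟶ SimplexCategory.mk n))
      (hornFace x hx)
  isEquivalence₁ i j h hx hP :=
    (isLabelled_toNatural_one _).1 ((isLabelled_hornFace _ hx (by
      rwa [show Set.range (pairMap i j h.le) = {i, j} from
        SimplexCategory.range_pairHom i j h.le])).app f)
  isIso i j l h h' hx hP :=
    (isLabelled_toNatural_two _).1 ((isLabelled_hornFace _ hx (by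
      rwa [show Set.range (tripleMap i j l h.le h'.le) = {i, j, l} from
        SimplexCategory.range_tripleHom i j l h.le h'.le])).app f)

/-- A map from a complicial horn extends if its underlying horn has a filler with the required
labels. -/
theorem exists_lift_complicialHornExtension (f : complicialHorn m k ⟶ naturalNerve C)
    (σ : NerveSimplex (Fin (m + 1)) C)
    (h1 : ∀ (n : ℕ) (x : Fin (n + 1) →o Fin (m + 1)) (hx : IsHornFace k x),
      reindex x σ = (HornFamily.ofHom f).F x hx)
    (h2 : FacesLabelled (admissibleMarking m k) (toNatural σ)) :
    ∃ g, complicialHornExtension m k ≫ g = f := by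
  obtain ⟨g, hg, -⟩ := exists_extension (complicialHornExtension m k)
    complicialHornExtension_injective f (PlainMap.ofSimplex _ (toNatural σ)) (by
      intro n y
      obtain ⟨x, hx, rfl⟩ := exists_hornFace y
      exact h1 n x hx) (by
      intro n y hy _
      obtain ⟨x, hx, hxQ, e⟩ := exists_face_of_not_isDegenerate y hy
      rw [e, PlainMap.ofSimplex_app]
      exact h2 n x hx hxQ)
  exact ⟨g, hg⟩

theorem exists_lift_horn (hm : 1 ≤ m) (f : complicialHorn m k ⟶ naturalNerve C) :
    ∃ g, complicialHornExtension m k ≫ g = f := by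
  obtain rfl | hm : m = 1 ∨ 2 ≤ m := by omega
  -- the horn `Λᵏ[1]` is a point, and is filled by a degenerate edge
  · have hk : IsHornFace k (OrderHom.const (Fin (0 + 1)) k) := by
      revert k
      intro k _
      obtain rfl | rfl := (by decide : ∀ k : Fin (1 + 1), k = 0 ∨ k = 1) k
      · exact ⟨1, by decide, fun _ => zero_ne_one⟩
      · exact ⟨0, by decide, fun _ => one_ne_zero⟩
    let c : Fin (1 + 1) →o Fin (0 + 1) := OrderHom.const _ 0
    refine exists_lift_complicialHornExtension f
      (reindex c ((HornFamily.ofHom f).F _ hk)) ?_ ?_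
    · intro n x hx
      have hx' : x = (OrderHom.const (Fin (0 + 1)) k).comp (c.comp x) := by
        ext i
        obtain ⟨j, hj, h⟩ := hx
        exact congrArg Fin.val
          ((by decide : ∀ k j a : Fin (1 + 1), j ≠ k → a ≠ j → a = k) k j (x i) hj (h i))
      have := (HornFamily.ofHom f).F_congr hx' hx (hx' ▸ hx)
      rw [this]
      exact ((HornFamily.ofHom f).F_comp (c.comp x) _ hk _).symm
    · rw [facesLabelled_toNatural_iff]
      refine ⟨fun i j h _ => ?_, fun i j l h h' => ?_⟩
      · exact (isIdentity_map _ _ _ _ (Subsingleton.elim (α := Fin 1) _ _)).isEquivalence₁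
      · simp only [Fin.lt_def] at h h'
        omega
  · obtain ⟨σ, h1, h2⟩ := (HornFamily.ofHom f).hasFiller hm
    refine exists_lift_complicialHornExtension f σ h1 ?_
    rw [facesLabelled_toNatural_iff]
    refine ⟨fun i j h hP => ?_, fun i j l h h' hP => ?_⟩
    · have hx : IsHornFace k (pairMap i j h.le) := by
        by_contra hx
        have hall := eq_of_not_isHornFace_pairMap hx
        have hk := hP k (.inr (.inl rfl))
        have h0 := hall ⟨0, by omega⟩
        have h1 := hall ⟨1, by omega⟩
        have h2 := hall ⟨2, by omega⟩
        simp only [Set.mem_insert_iff, Set.mem_singleton_iff, Fin.ext_iff] at hk h0 h1 h2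
        omega
      have := (HornFamily.ofHom f).isEquivalence₁ i j h hx hP
      rw [← h1] at this
      exact this
    · by_cases hx : IsHornFace k (tripleMap i j l h.le h'.le)
      · have := (HornFamily.ofHom f).isIso i j l h h' hx hP
        rw [← h1] at this
        exact this
      · exact h2 i j l h h' hx hP

end NerveSimplex

/-- The natural nerve is a `2`-precomplicial set. -/
theorem isPrecomplicial_naturalNerve (C : Type u) [Bicategory.{w, v} C] [Bicategory.Strict C] :
    IsPrecomplicial 2 (naturalNerve C) := by
  intro A B i hi
  cases hi with
  | horn m hm k => exact NerveSimplex.exists_lift_horn hm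
  | thinness m hm k =>
    exact (TDeltaSet.lift_markedSimplexInclusion_iff Set.subset_union_left).2
      (NerveSimplex.facesLabelled_thinness hm k)
  | triviality l hl =>
    exact (TDeltaSet.lift_markedSimplexInclusion_iff (Set.empty_subset _)).2
      (fun a _ => NerveSimplex.facesLabelled_triviality hl a)
  | saturation p =>
    exact (TDeltaSet.lift_markedSimplexInclusion_iff (P := {S | lastPart p S ∈ eqMarking})
      (Q := {S | lastPart p S ∈ sharpMarking}) fun _ hS => eqMarking_subset_sharpMarking hS).2
        (NerveSimplex.facesLabelled_saturation p)

/-! ### Simplices witnessing that labels of the natural nerve are generated -/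

/-- A `1`-morphism together with an isomorphism to a given one. -/
structure Replacement {C : Type u} [Bicategory.{w, v} C] {x y : C} (g : x ⟶ y) where
  hom : x ⟶ y
  iso : hom ≅ g

/-- The trivial replacement. -/
def Replacement.refl {C : Type u} [Bicategory.{w, v} C] {x y : C} (g : x ⟶ y) : Replacement g :=
  ⟨g, Iso.refl g⟩

namespace NerveSimplex

section

variable {C : Type u} [Bicategory.{w, v} C] {I J : Type} [Preorder I] [Preorder J]

/-- The `2`-morphism of a triangle after replacing its `1`-morphisms by isomorphic ones. -/
def replaceCell (σ : NerveSimplex I C) (i j k : I) (hij : i ≤ j) (hjk : j ≤ k)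
    (a : Replacement (σ.map i k (hij.trans hjk))) (b : Replacement (σ.map i j hij))
    (c : Replacement (σ.map j k hjk)) : a.hom ⟶ b.hom ≫ c.hom :=
  a.iso.hom ≫ σ.cell i j k hij hjk ≫ b.iso.inv ▷ _ ≫ _ ◁ c.iso.inv

/-- Replaces the `1`-morphisms of a simplex by isomorphic ones. -/
def replace (σ : NerveSimplex I C) (q : ∀ i j h, Replacement (σ.map i j h))
    (hq : ∀ i, q i i le_rfl = .refl _) : NerveSimplex I C :=
  transport σ (fun i j h => (q i j h).hom) (fun i j h => (q i j h).iso)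
    (fun i => by rw [hq]; exact σ.map_self i) (fun i => by
      have : ∀ (a : Replacement (σ.map i i le_rfl)) (h : a.hom = 𝟙 _), a = .refl _ →
          a.iso.hom = eqToHom (h.trans (σ.map_self i).symm) := by
        rintro a h rfl
        rfl
      exact this _ (by rw [hq]; exact σ.map_self i) (hq i))

variable (σ : NerveSimplex I C) (q : ∀ i j h, Replacement (σ.map i j h))
  (hq : ∀ i, q i i le_rfl = .refl _)

theorem replaceCell_refl (i j k : I) (hij : i ≤ j) (hjk : j ≤ k) :
    replaceCell σ i j k hij hjk (.refl _) (.refl _) (.refl _) = σ.cell i j k hij hjk := by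
  change 𝟙 _ ≫ σ.cell i j k hij hjk ≫ 𝟙 (σ.map i j hij) ▷ _ ≫ _ ◁ 𝟙 (σ.map j k hjk) = _
  simp

/-- The replacement of the `1`-morphism `fᵢₖ` by `fᵢⱼ ≫ fⱼₖ` along an invertible `2`-morphism. -/
noncomputable def composite (i j k : I) (hij : i ≤ j) (hjk : j ≤ k)
    (h : IsIso (σ.cell i j k hij hjk)) :
    Replacement (σ.map i k (hij.trans hjk)) :=
  ⟨σ.map i j hij ≫ σ.map j k hjk, (asIso (σ.cell i j k hij hjk)).symm⟩

theorem isIdentity₂_replace_of_refl {i j k : I} {hij : i ≤ j} {hjk : j ≤ k}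
    (h : IsIdentity₂ (σ.cell i j k hij hjk)) (ha : q i k (hij.trans hjk) = .refl _)
    (hb : q i j hij = .refl _) (hc : q j k hjk = .refl _) :
    IsIdentity₂ ((replace σ q hq).cell i j k hij hjk) := by
  have key : ∀ a b c, a = .refl _ → b = .refl _ → c = .refl _ →
      IsIdentity₂ (replaceCell σ i j k hij hjk a b c) := by
    rintro _ _ _ rfl rfl rfl
    obtain ⟨e, he⟩ := h
    exact ⟨e, (replaceCell_refl σ i j k hij hjk).trans he⟩
  exact key _ _ _ ha hb hc

theorem isIdentity₂_replace_of_composite {i j k : I} {hij : i ≤ j} {hjk : j ≤ k}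
    (h : IsIso (σ.cell i j k hij hjk)) (ha : q i k (hij.trans hjk) = composite σ i j k hij hjk h)
    (hb : q i j hij = .refl _) (hc : q j k hjk = .refl _) :
    IsIdentity₂ ((replace σ q hq).cell i j k hij hjk) := by
  have key : ∀ a b c, a = composite σ i j k hij hjk h → b = .refl _ → c = .refl _ →
      IsIdentity₂ (replaceCell σ i j k hij hjk a b c) := by
    rintro _ _ _ rfl rfl rfl
    refine ⟨rfl, ?_⟩
    change inv (σ.cell i j k hij hjk) ≫ σ.cell i j k hij hjk ≫ 𝟙 (σ.map i j hij) ▷ _ ≫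
      _ ◁ 𝟙 (σ.map j k hjk) = 𝟙 _
    simp
  exact key _ _ _ ha hb hc

theorem isIdentity_replace_of_refl {i j : I} {hij : i ≤ j} (h : IsIdentity (σ.map i j hij))
    (ha : q i j hij = .refl _) : IsIdentity ((replace σ q hq).map i j hij) := by
  have key : ∀ a : Replacement (σ.map i j hij), a = .refl _ → IsIdentity a.hom := by
    rintro _ rfl
    exact h
  exact key _ ha

theorem isIso_replaceCell {i j k : I} {hij : i ≤ j} {hjk : j ≤ k}
    (h : IsIso (σ.cell i j k hij hjk)) (a b c) : IsIso (replaceCell σ i j k hij hjk a b c) := by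
  unfold replaceCell
  infer_instance

theorem reindex_replace (θ : J →o I)
    (h : ∀ i j (hij : i ≤ j), q (θ i) (θ j) (θ.monotone hij) = .refl _) :
    reindex θ (replace σ q hq) = reindex θ σ := by
  have key : ∀ (τ : NerveSimplex J C) (q : ∀ i j h, Replacement (τ.map i j h))
      (hq : ∀ i, q i i le_rfl = .refl _) (_ : ∀ i j h, q i j h = .refl _), replace τ q hq = τ := by
    intro τ q hq h
    obtain rfl : q = fun i j h => .refl _ := by
      funext i j h'
      exact h i j h'
    have e : (replace τ (fun i j h => .refl (τ.map i j h)) hq).cell = τ.cell := by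
      funext i j k hij hjk
      exact replaceCell_refl τ i j k hij hjk
    exact Cells.simplex_eq (o := τ.obj) (f := τ.map)
      (D := (cells (replace τ (fun i j h => .refl (τ.map i j h)) hq) : Cells τ.obj τ.map))
      (D' := τ.cells) e
  exact key (reindex θ σ) (fun i j hij => q (θ i) (θ j) (θ.monotone hij)) (fun i => hq (θ i)) h

end

section

variable {C : Type u} [Bicategory.{w, v} C] {I : Type} [LinearOrder I]

/-- Replaces one of the `1`-morphisms of a simplex. -/
theorem exists_replacement (σ : NerveSimplex I C) (q : ∀ i j h, Replacement (σ.map i j h))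
    (i₀ j₀ : I) (h₀ : i₀ ≤ j₀) (a : Replacement (σ.map i₀ j₀ h₀)) :
    ∃ q' : ∀ i j h, Replacement (σ.map i j h), q' i₀ j₀ h₀ = a ∧
      ∀ i j h, (i, j) ≠ (i₀, j₀) → q' i j h = q i j h := by
  let B := {b : I × I // b.1 ≤ b.2}
  let f : ∀ b : B, Replacement (σ.map b.1.1 b.1.2 b.2) :=
    Function.update (fun b : B => q b.1.1 b.1.2 b.2) ⟨(i₀, j₀), h₀⟩ a
  refine ⟨fun i j h => f ⟨(i, j), h⟩, Function.update_self .., fun i j h hne => ?_⟩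
  exact Function.update_of_ne (fun e => hne (congrArg Subtype.val e)) _ _

end

section

theorem forall_lt_fin_four_triple (Q : ∀ a b c : Fin 4, a < b → b < c → Prop)
    (h : Q 0 1 2 (by decide) (by decide) ∧ Q 0 1 3 (by decide) (by decide) ∧
      Q 0 2 3 (by decide) (by decide) ∧ Q 1 2 3 (by decide) (by decide))
    (a b c : Fin 4) (hab : a < b) (hbc : b < c) : Q a b c hab hbc := by
  obtain ⟨h012, h013, h023, h123⟩ := h
  obtain ⟨rfl, rfl, rfl⟩ | ⟨rfl, rfl, rfl⟩ | ⟨rfl, rfl, rfl⟩ | ⟨rfl, rfl, rfl⟩ :=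
    (by decide : ∀ a b c : Fin 4, a < b → b < c → (a = 0 ∧ b = 1 ∧ c = 2) ∨
      (a = 0 ∧ b = 1 ∧ c = 3) ∨ (a = 0 ∧ b = 2 ∧ c = 3) ∨ (a = 1 ∧ b = 2 ∧ c = 3)) a b c hab hbc <;>
    assumption

theorem eq_of_pair_mem_eqMarking {a b : Fin 4} (h : a < b) (hP : {a, b} ∈ eqMarking) :
    (a = 0 ∧ b = 2) ∨ (a = 1 ∧ b = 3) := by
  obtain hP | hP | hP := hP
  · rw [Set.ncard_pair h.ne] at hP
    omega
  · have ha : a ∈ ({0, 2} : Set (Fin 4)) := hP ▸ .inl rfl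
    have hb : b ∈ ({0, 2} : Set (Fin 4)) := hP ▸ .inr rfl
    exact (by decide : ∀ a b : Fin 4, a < b → (a = 0 ∨ a = 2) → (b = 0 ∨ b = 2) →
      (a = 0 ∧ b = 2) ∨ (a = 1 ∧ b = 3)) a b h ha hb
  · have ha : a ∈ ({1, 3} : Set (Fin 4)) := hP ▸ .inl rfl
    have hb : b ∈ ({1, 3} : Set (Fin 4)) := hP ▸ .inr rfl
    exact (by decide : ∀ a b : Fin 4, a < b → (a = 1 ∨ a = 3) → (b = 1 ∨ b = 3) →
      (a = 0 ∧ b = 2) ∨ (a = 1 ∧ b = 3)) a b h ha hb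

theorem notMem_eqMarking_singleton (a : Fin 4) : {a} ∉ eqMarking :=
  fun h => notMem_sharpMarking_singleton a (eqMarking_subset_sharpMarking h)

theorem notMem_eqMarking_empty : ∅ ∉ eqMarking :=
  fun h => absurd (eqMarking_subset_sharpMarking h) (by simp [sharpMarking])

theorem mem_lastPart_sharpMarking_one :
    {0, 1, 2} ∈ {S : Set (Fin (1 + 3 + 1)) | lastPart 1 S ∈ sharpMarking} := by
  change lastPart 1 (insert 0 (insert (lastVertex 1 0) {lastVertex 1 1})) ∈ sharpMarking
  rw [lastPart_insert_of_lt 1 0 (by decide), lastPart_insert, lastPart_singleton]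
  exact mem_sharpMarking_of_lt (by decide)

theorem notMem_lastPart_eqMarking_one :
    {0, 1, 2} ∉ {S : Set (Fin (1 + 3 + 1)) | lastPart 1 S ∈ eqMarking} := by
  change lastPart 1 (insert 0 (insert (lastVertex 1 0) {lastVertex 1 1})) ∉ eqMarking
  rw [lastPart_insert_of_lt 1 0 (by decide), lastPart_insert, lastPart_singleton]
  exact fun h => absurd (eq_of_pair_mem_eqMarking (by decide) h) (by decide)

theorem mem_lastPart_sharpMarking_zero :
    {0, 1} ∈ {S : Set (Fin (0 + 3 + 1)) | lastPart 0 S ∈ sharpMarking} := by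
  change lastPart 0 (insert (lastVertex 0 0) {lastVertex 0 1}) ∈ sharpMarking
  rw [lastPart_insert, lastPart_singleton]
  exact mem_sharpMarking_of_lt (by decide)

theorem notMem_lastPart_eqMarking_zero :
    {0, 1} ∉ {S : Set (Fin (0 + 3 + 1)) | lastPart 0 S ∈ eqMarking} := by
  change lastPart 0 (insert (lastVertex 0 0) {lastVertex 0 1}) ∉ eqMarking
  rw [lastPart_insert, lastPart_singleton]
  exact fun h => absurd (eq_of_pair_mem_eqMarking (by decide) h) (by decide)

theorem mem_admissibleMarking''_three_two :
    ({0, 1, 3} : Set (Fin (3 + 1))) ∈ admissibleMarking'' 3 2 := by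
  refine .inr (Set.ext fun x => ?_)
  exact (by decide : ∀ x : Fin (3 + 1), (x = 0 ∨ x = 1 ∨ x = 3) ↔ x ≠ 2) x

theorem notMem_admissibleMarking'_three_two :
    ({0, 1, 3} : Set (Fin (3 + 1))) ∉ admissibleMarking' 3 2 := by
  rintro (hP | ⟨a, ha, hP⟩)
  · have : (2 : Fin (3 + 1)) ∈ ({0, 1, 3} : Set _) := hP 2 (by decide)
    simp at this
  · have hall : ∀ x, (x = 0 ∨ x = 1 ∨ x = 3) ↔ x ≠ a := fun x => Set.ext_iff.1 hP x
    exact absurd ha ((by decide : ∀ a : Fin (3 + 1), (∀ x, (x = 0 ∨ x = 1 ∨ x = 3) ↔ x ≠ a) →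
      ¬ (((a : ℕ) + 1 = ((2 : Fin (3 + 1)) : ℕ) ∨ (a : ℕ) = ((2 : Fin (3 + 1)) : ℕ) + 1)))
      a hall)

/-- A condition on the pairs and triples of vertices that are marked in `Δ[p-1] ⋆ Δ[3]_eq`, in terms
of the vertices of both factors. -/
theorem forall_lastPart_eq (p : ℕ)
    (Q₁ : ∀ i j : Fin (p + 3 + 1), i < j → Prop)
    (Q₂ : ∀ i j k : Fin (p + 3 + 1), i < j → j < k → Prop)
    (H1 : Q₁ _ _ (lastVertex_strictMono p (show (0 : Fin 4) < 2 by decide)) ∧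
      Q₁ _ _ (lastVertex_strictMono p (show (1 : Fin 4) < 3 by decide)))
    (H2 : ∀ a b c (h : a < b) (h' : b < c),
      Q₂ _ _ _ (lastVertex_strictMono p h) (lastVertex_strictMono p h'))
    (H3 : ∀ (i : Fin (p + 3 + 1)) (_ : (i : ℕ) < p) (h : ∀ a, i < lastVertex p a),
      Q₂ i _ _ (h 0) (lastVertex_strictMono p (show (0 : Fin 4) < 2 by decide)) ∧
      Q₂ i _ _ (h 1) (lastVertex_strictMono p (show (1 : Fin 4) < 3 by decide))) :
    (∀ i j (h : i < j), {i, j} ∈ {S | lastPart p S ∈ eqMarking} → Q₁ i j h) ∧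
      (∀ i j k (h : i < j) (h' : j < k), {i, j, k} ∈ {S | lastPart p S ∈ eqMarking} →
        Q₂ i j k h h') := by
  constructor
  · intro i j h hP
    obtain hj | ⟨b, rfl⟩ := lt_or_eq_lastVertex p j
    · simp [lastPart_insert_of_lt p i (by omega), lastPart_singleton_of_lt p j hj,
        notMem_eqMarking_empty] at hP
    obtain hi | ⟨a, rfl⟩ := lt_or_eq_lastVertex p i
    · simp [lastPart_insert_of_lt p i hi, lastPart_singleton, notMem_eqMarking_singleton] at hP
    have hab := (lastVertex_strictMono p).lt_iff_lt.1 h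
    rw [Set.mem_ofPred_eq, lastPart_insert, lastPart_singleton] at hP
    obtain ⟨rfl, rfl⟩ | ⟨rfl, rfl⟩ := eq_of_pair_mem_eqMarking hab hP
    · exact H1.1
    · exact H1.2
  · intro i j k h h' hP
    obtain hk | ⟨c, rfl⟩ := lt_or_eq_lastVertex p k
    · simp [lastPart_insert_of_lt p i (by omega), lastPart_insert_of_lt p j (by omega),
        lastPart_singleton_of_lt p k hk, notMem_eqMarking_empty] at hP
    obtain hj | ⟨b, rfl⟩ := lt_or_eq_lastVertex p j
    · simp [lastPart_insert_of_lt p i (by omega), lastPart_insert_of_lt p j hj,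
        lastPart_singleton, notMem_eqMarking_singleton] at hP
    have hbc := (lastVertex_strictMono p).lt_iff_lt.1 h'
    obtain hi | ⟨a, rfl⟩ := lt_or_eq_lastVertex p i
    · rw [Set.mem_ofPred_eq, lastPart_insert_of_lt p i hi, lastPart_insert,
        lastPart_singleton] at hP
      have hv : ∀ a, i < lastVertex p a := fun a => by simp [lastVertex, Fin.lt_def]; omega
      obtain ⟨rfl, rfl⟩ | ⟨rfl, rfl⟩ := eq_of_pair_mem_eqMarking hbc hP
      · exact (H3 i hi hv).1
      · exact (H3 i hi hv).2
    · exact H2 a b c ((lastVertex_strictMono p).lt_iff_lt.1 h) hbc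

variable {C : Type u} [Bicategory.{w, v} C] [Bicategory.Strict C]

theorem isIso_cell_of_isIso_triangle {τ : NerveSimplex (Fin (2 + 1)) C} (h : IsIso (triangle τ))
    (i j k : Fin (2 + 1)) (hij : i ≤ j) (hjk : j ≤ k) : IsIso (τ.cell i j k hij hjk) := by
  rcases hij.eq_or_lt with e | hij'
  · exact (τ.isIdentity₂_cell_left i j k hij hjk e).isIso
  rcases hjk.eq_or_lt with e | hjk'
  · exact (τ.isIdentity₂_cell_right i j k hij hjk e).isIso
  obtain ⟨rfl, rfl, rfl⟩ := (by decide : ∀ i j k : Fin (2 + 1), i < j → j < k →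
    i = 0 ∧ j = 1 ∧ k = 2) i j k hij' hjk'
  exact h

/-- A triangle with invertible `2`-morphism whose last edge is an identity is a face of a
`4`-simplex to which the saturation extension for `Δ[0] ⋆ Δ[3]` applies in the Roberts–Street
nerve. -/
theorem exists_saturation_one (τ : NerveSimplex (Fin (2 + 1)) C)
    (h1 : IsIdentity (τ.map 1 2 (by decide))) (h2 : IsIso (triangle τ)) :
    ∃ σ : NerveSimplex (Fin (1 + 3 + 1)) C,
      ((∀ i j (h : i < j), {i, j} ∈ {S | lastPart 1 S ∈ eqMarking} → IsIdentity (σ.map i j h.le)) ∧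
      (∀ i j k (h : i < j) (h' : j < k), {i, j, k} ∈ {S | lastPart 1 S ∈ eqMarking} →
        IsIdentity₂ (σ.cell i j k h.le h'.le))) ∧
      (∀ i j k h h', IsIso (σ.cell i j k h h')) ∧
      reindex (tripleMap 0 1 2 (by decide) (by decide)) σ = τ := by
  let θ : Fin (1 + 3 + 1) →o Fin (2 + 1) := ⟨![0, 1, 2, 2, 2], by decide⟩
  let ρ := reindex θ τ
  -- `f₀₃` becomes `f₀₁ ≫ f₁₂`, so that the `2`-morphisms of `{0,1,3}` and `{0,2,4}` are identities
  obtain ⟨q, hq, hq'⟩ := exists_replacement ρ (fun _ _ _ => .refl _) 0 3 (by decide)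
    (composite ρ 0 1 3 (by decide) (by decide) h2)
  have hq₀ : ∀ i, q i i le_rfl = .refl _ := fun i => hq' _ _ _
    ((by decide : ∀ i : Fin (1 + 3 + 1), (i, i) ≠ (0, 3)) i)
  have hmap : ∀ (i j : Fin (1 + 3 + 1)) h, (i : ℕ) ≠ 0 →
      IsIdentity ((replace ρ q hq₀).map i j h) := by
    intro i j h hi
    refine isIdentity_replace_of_refl ρ q hq₀ (?_ : IsIdentity (τ.map (θ i) (θ j) _))
      (hq' i j h (by rintro ⟨⟩; exact hi rfl))
    have hij : (θ i = 1 ∧ θ j = 2) ∨ θ i = θ j := (by decide : ∀ i j : Fin (1 + 3 + 1), i ≤ j →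
      (i : ℕ) ≠ 0 → (θ i = 1 ∧ θ j = 2) ∨ θ i = θ j) i j h hi
    obtain ⟨e1, e2⟩ | e := hij
    · have key : ∀ (a b : Fin (2 + 1)) (h : a ≤ b), a = 1 → b = 2 → IsIdentity (τ.map a b h) := by
        rintro _ _ h rfl rfl
        exact h1
      exact key _ _ _ e1 e2
    · exact τ.isIdentity_map _ _ _ e
  refine ⟨replace ρ q hq₀, ?_, ?_, ?_⟩
  · refine forall_lastPart_eq 1 (fun i j h => IsIdentity ((replace ρ q hq₀).map i j h.le))
      (fun i j k h h' => IsIdentity₂ ((replace ρ q hq₀).cell i j k h.le h'.le)) ?_ ?_ ?_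
    · exact ⟨hmap (lastVertex 1 0) (lastVertex 1 2) _ (by decide),
        hmap (lastVertex 1 1) (lastVertex 1 3) _ (by decide)⟩
    · intro a b c h h'
      have hne : ∀ a i, (lastVertex 1 a, i) ≠ ((0, 3) : Fin (1 + 3 + 1) × Fin (1 + 3 + 1)) := by
        decide
      exact isIdentity₂_replace_of_refl ρ q hq₀ (τ.isIdentity₂_cell_right _ _ _ _ _
        ((by decide : ∀ a b c : Fin 4, a < b → b < c →
          θ (lastVertex 1 b) = θ (lastVertex 1 c)) a b c h h')) (hq' _ _ _ (hne _ _))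
          (hq' _ _ _ (hne _ _)) (hq' _ _ _ (hne _ _))
    · intro i hi h
      obtain rfl : i = 0 := Fin.ext (by simpa using hi)
      constructor
      · exact isIdentity₂_replace_of_composite ρ q hq₀ (i := 0) (j := 1) (k := 3) h2 hq
          (hq' 0 1 _ (by decide)) (hq' 1 3 _ (by decide))
      · exact isIdentity₂_replace_of_refl ρ q hq₀ (i := 0) (j := 2) (k := 4)
          (τ.isIdentity₂_cell_right 0 2 2 (by decide) (by decide) rfl) (hq' 0 4 _ (by decide))
          (hq' 0 2 _ (by decide)) (hq' 2 4 _ (by decide))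
  · intro i j k h h'
    exact isIso_replaceCell ρ (isIso_cell_of_isIso_triangle h2 _ _ _ _ _) _ _ _
  · rw [reindex_replace]
    · have : θ.comp (tripleMap 0 1 2 (by decide) (by decide)) = OrderHom.id := by
        ext i
        fin_cases i <;> rfl
      exact congrArg (fun θ => reindex θ τ) this
    · intro i j h
      exact hq' _ _ _ ((by decide : ∀ i j : Fin (2 + 1),
        ((![0, 1, 2] : Fin (2 + 1) → Fin (1 + 3 + 1)) i,
          (![0, 1, 2] : Fin (2 + 1) → Fin (1 + 3 + 1)) j) ≠
          (0, 3)) i j)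

/-- A triangle with invertible `2`-morphism is a face of a `3`-simplex to which the thinness
extension applies, as soon as triangles with invertible `2`-morphism whose last edge is an identity
are labelled. -/
theorem exists_thinness (τ : NerveSimplex (Fin (2 + 1)) C) (h2 : IsIso (triangle τ)) :
    ∃ σ : NerveSimplex (Fin (3 + 1)) C,
      ((∀ i j (h : i < j), {i, j} ∈ admissibleMarking' 3 2 → IsIdentity (σ.map i j h.le)) ∧
      (∀ i j k (h : i < j) (h' : j < k), {i, j, k} ∈ admissibleMarking' 3 2 →
        IsIdentity₂ (σ.cell i j k h.le h'.le) ∨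
          IsIdentity (σ.map j k h'.le) ∧ IsIso (σ.cell i j k h.le h'.le))) ∧
      (∀ i j k h h', IsIso (σ.cell i j k h h')) ∧
      reindex (tripleMap 0 1 3 (by decide) (by decide)) σ = τ := by
  let θ : Fin (3 + 1) →o Fin (2 + 1) := ⟨![0, 1, 2, 2], by decide⟩
  let ρ := reindex θ τ
  -- `f₀₂` becomes `f₀₁ ≫ f₁₂`, so that the `2`-morphism of `{0,1,2}` is an identity
  obtain ⟨q, hq, hq'⟩ := exists_replacement ρ (fun _ _ _ => .refl _) 0 2 (by decide)
    (composite ρ 0 1 2 (by decide) (by decide) h2)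
  have hq₀ : ∀ i, q i i le_rfl = .refl _ := fun i => hq' _ _ _
    ((by decide : ∀ i : Fin (3 + 1), (i, i) ≠ (0, 2)) i)
  have hiso : ∀ i j k h h', IsIso ((replace ρ q hq₀).cell i j k h h') := fun i j k h h' =>
    isIso_replaceCell ρ (isIso_cell_of_isIso_triangle h2 _ _ _ _ _) _ _ _
  refine ⟨replace ρ q hq₀, ⟨?_, ?_⟩, hiso, ?_⟩
  · rintro i j h (hP | ⟨a, -, hP⟩)
    · have h1 := hP 1 (by decide)
      have h2 := hP 2 (by decide)
      have h3 := hP 3 (by decide)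
      exact absurd h ((by decide : ∀ i j : Fin (3 + 1), (1 = i ∨ 1 = j) → (2 = i ∨ 2 = j) →
        (3 = i ∨ 3 = j) → ¬ i < j) i j h1 h2 h3)
    · have hall : ∀ x, (x = i ∨ x = j) ↔ x ≠ a := fun x => Set.ext_iff.1 hP x
      exact absurd hall ((by decide : ∀ i j a : Fin (3 + 1), ¬ ∀ x, (x = i ∨ x = j) ↔ x ≠ a) i j a)
  · intro i j k h h' hP
    obtain ⟨rfl, rfl, rfl⟩ | ⟨rfl, rfl, rfl⟩ | ⟨rfl, rfl, rfl⟩ : (i = 0 ∧ j = 1 ∧ k = 2) ∨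
        (i = 0 ∧ j = 2 ∧ k = 3) ∨ (i = 1 ∧ j = 2 ∧ k = 3) := by
      refine forall_lt_fin_four_triple (fun i j k _ _ => {i, j, k} ∈ admissibleMarking' 3 2 →
        (i = 0 ∧ j = 1 ∧ k = 2) ∨ (i = 0 ∧ j = 2 ∧ k = 3) ∨ (i = 1 ∧ j = 2 ∧ k = 3))
        ⟨?_, fun h => (notMem_admissibleMarking'_three_two h).elim, ?_, ?_⟩ i j k h h' hP <;> simp
    · exact .inl (isIdentity₂_replace_of_composite ρ q hq₀ (i := 0) (j := 1) (k := 2) h2 hq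
        (hq' 0 1 _ (by decide)) (hq' 1 2 _ (by decide)))
    · exact .inr ⟨isIdentity_replace_of_refl ρ q hq₀ (i := 2) (j := 3)
        (τ.isIdentity_map 2 2 (by decide) rfl) (hq' 2 3 _ (by decide)), hiso _ _ _ _ _⟩
    · exact .inl (isIdentity₂_replace_of_refl ρ q hq₀ (i := 1) (j := 2) (k := 3)
        (τ.isIdentity₂_cell_right 1 2 2 (by decide) (by decide) rfl) (hq' 1 3 _ (by decide))
        (hq' 1 2 _ (by decide)) (hq' 2 3 _ (by decide)))
  · rw [reindex_replace]
    · have : θ.comp (tripleMap 0 1 3 (by decide) (by decide)) = OrderHom.id := by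
        ext i
        fin_cases i <;> rfl
      exact congrArg (fun θ => reindex θ τ) this
    · intro i j h
      exact hq' _ _ _ ((by decide : ∀ i j : Fin (2 + 1),
        ((![0, 1, 3] : Fin (2 + 1) → Fin (3 + 1)) i, (![0, 1, 3] : Fin (2 + 1) → Fin (3 + 1)) j) ≠
          (0, 2)) i j)

/-- A `1`-simplex is determined by its edge. -/
theorem simplex_eq_of_edge {o : Fin (1 + 1) → C} {f f' : ∀ i j : Fin (1 + 1), i ≤ j → (o i ⟶ o j)}
    (D : Cells o f) (D' : Cells o f') (h : f 0 1 (by decide) = f' 0 1 (by decide)) :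
    D.simplex = D'.simplex := by
  obtain rfl : f = f' := by
    funext i j hij
    obtain ⟨rfl, rfl⟩ | rfl := (by decide : ∀ i j : Fin (1 + 1), i ≤ j → (i = 0 ∧ j = 1) ∨ i = j)
      i j hij
    · exact h
    · exact (D.map_self i).trans (D'.map_self i).symm
  apply Cells.simplex_eq
  funext i j k hij hjk
  obtain h | h := (by decide : ∀ i j k : Fin (1 + 1), i ≤ j → j ≤ k → i = j ∨ j = k) i j k hij hjk
  · exact (D.simplex.isIdentity₂_cell_left i j k hij hjk h).eq
      (D'.simplex.isIdentity₂_cell_left i j k hij hjk h)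
  · exact (D.simplex.isIdentity₂_cell_right i j k hij hjk h).eq
      (D'.simplex.isIdentity₂_cell_right i j k hij hjk h)

theorem eq_of_edge {s s' : NerveSimplex (Fin (1 + 1)) C} (h : s.obj = s'.obj)
    (h' : HEq (edge s) (edge s')) : s = s' := by
  obtain ⟨f, D, rfl⟩ := exists_cells_of_obj s s'.obj h
  exact simplex_eq_of_edge D s'.cells (eq_of_heq h')

/-- A `1`-simplex given by an equivalence is a face of a `3`-simplex to which the saturation
extension for `Δ[3]` applies, as soon as all triangles with invertible `2`-morphism are
labelled. -/
theorem exists_saturation_zero (s : NerveSimplex (Fin (1 + 1)) C) (hs : IsEquivalence₁ (edge s)) :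
    ∃ σ : NerveSimplex (Fin (0 + 3 + 1)) C,
      (∀ i j (h : i < j), {i, j} ∈ {S | lastPart 0 S ∈ eqMarking} → IsIdentity (σ.map i j h.le)) ∧
      (∀ i j k h h', IsIso (σ.cell i j k h h')) ∧
      reindex (pairMap 0 1 (by decide)) σ = s := by
  obtain ⟨g, -, ⟨η⟩, ⟨e⟩⟩ := hs.exists_inverse
  let F := ComposableArrows.mk₃ (edge s) g (edge s)
  let ρ : NerveSimplex (Fin (0 + 3 + 1)) C := ofFunctor F.obj (fun i j h => F.map (homOfLE h))
    (fun i => F.map_id i) (fun i j k hij hjk => F.map_comp (homOfLE hij) (homOfLE hjk))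
  -- `f₀₂` and `f₁₃` become identities
  obtain ⟨q₁, hq₁, hq₁'⟩ := exists_replacement ρ (fun _ _ _ => .refl _) 0 2 (by decide)
    ⟨𝟙 (s.obj 0), η⟩
  obtain ⟨q, hq, hq'⟩ := exists_replacement ρ q₁ 1 3 (by decide) ⟨𝟙 (s.obj 1), e.symm⟩
  have hq₀ : ∀ i, q i i le_rfl = .refl _ := fun i => (hq' _ _ _
    ((by decide : ∀ i : Fin (0 + 3 + 1), (i, i) ≠ (1, 3)) i)).trans (hq₁' _ _ _
    ((by decide : ∀ i : Fin (0 + 3 + 1), (i, i) ≠ (0, 2)) i))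
  refine ⟨replace ρ q hq₀, ?_, fun i j k h h' => ?_, ?_⟩
  · refine (forall_lastPart_eq 0 (fun i j h => IsIdentity ((replace ρ q hq₀).map i j h.le))
      (fun _ _ _ _ _ => True) ⟨?_, ?_⟩ (fun _ _ _ _ _ => trivial)
      (fun _ _ _ => ⟨trivial, trivial⟩)).1
    · have key : ∀ a : Replacement (ρ.map 0 2 (by decide)), a = ⟨𝟙 (s.obj 0), η⟩ →
          IsIdentity a.hom := by
        rintro _ rfl
        exact ⟨rfl, rfl⟩
      exact key _ ((hq' 0 2 _ (by decide)).trans hq₁)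
    · have key : ∀ a : Replacement (ρ.map 1 3 (by decide)), a = ⟨𝟙 (s.obj 1), e.symm⟩ →
          IsIdentity a.hom := by
        rintro _ rfl
        exact ⟨rfl, rfl⟩
      exact key _ hq
  · exact isIso_replaceCell ρ (IsIdentity₂.isIso
      ⟨F.map_comp (homOfLE h) (homOfLE h'), rfl⟩) _ _ _
  · have key : ∀ a : Replacement (ρ.map 0 1 (by decide)), a = .refl _ → a.hom = edge s := by
      rintro _ rfl
      rfl
    refine eq_of_edge ?_
      (heq_of_eq (key _ ((hq' 0 1 _ (by decide)).trans (hq₁' 0 1 _ (by decide)))))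
    funext i
    fin_cases i <;> rfl

end

end NerveSimplex

namespace IsPrecomplicial

variable {n : ℕ} {E : TDeltaSet.{u}}

theorem facesLabelled_saturation (H : IsPrecomplicial n E) (p : ℕ) (a : E.obj (op (plain (p + 3))))
    (ha : TDeltaSet.FacesLabelled {S | lastPart p S ∈ eqMarking} a) :
    TDeltaSet.FacesLabelled {S | lastPart p S ∈ sharpMarking} a :=
  (TDeltaSet.lift_markedSimplexInclusion_iff (P := {S | lastPart p S ∈ eqMarking})
    (Q := {S | lastPart p S ∈ sharpMarking}) fun _ hS => eqMarking_subset_sharpMarking hS).1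
    (H _ (.saturation p)) a ha

theorem facesLabelled_thinness (H : IsPrecomplicial n E) {m : ℕ} (hm : 2 ≤ m) (k : Fin (m + 1))
    (a : E.obj (op (plain m)))
    (ha : TDeltaSet.FacesLabelled (admissibleMarking' m k) a) :
    TDeltaSet.FacesLabelled (admissibleMarking'' m k) a :=
  (TDeltaSet.lift_markedSimplexInclusion_iff Set.subset_union_left).1 (H _ (.thinness m hm k)) a ha

end IsPrecomplicial

/-! ### Fibrancy of the Roberts–Street nerve -/

section

variable (C : Type u) [Bicategory.{w, v} C] [Bicategory.Strict C]

theorem nerveInclusion_injective (a) : Function.Injective ((nerveInclusion C).app a) := by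
  obtain ⟨a⟩ := a
  cases a with
  | plain k => exact fun _ _ h => h
  | marked k =>
    intro y y' e
    obtain ⟨x, l, rfl⟩ := LabelledSSet.exists_lab _ y
    obtain ⟨x', l', rfl⟩ := LabelledSSet.exists_lab _ y'
    obtain rfl : x = x' := congrArg Sigma.fst e
    exact congrArg _ (stratify_label_eq l l')

/-- The identity of the simplices, from the natural nerve to the Roberts–Street nerve. -/
def plainRetraction : TDeltaSet.PlainMap (naturalNerve C) (robertsStreetNerve C) :=
  LabelledSSet.Hom.toPlainMap (S := naturalLabelled C) (T := robertsStreetLabelled C)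
    (𝟙 (streetNerve C))

end

section

variable {C : Type u} [Bicategory.{w, v} C] [Bicategory.Strict C]

/-- The strict `3`-simplex with edges `f`, `f⁻¹`, `f` is a simplex of shape `Δ[3]_eq` of the
Roberts–Street nerve, so that `f` is marked by saturation. -/
theorem isIdentity_of_isIsomorphism (H : IsPrecomplicial 2 (robertsStreetNerve C)) {x y : C}
    (f : x ⟶ y) (hf : IsIsomorphism f) : IsIdentity f := by
  obtain ⟨g, hfg, hgf⟩ := hf
  let F := ComposableArrows.mk₃ f g f
  let σ : NerveSimplex (Fin (0 + 3 + 1)) C := .ofFunctor F.obj (fun i j h => F.map (homOfLE h))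
    (fun i => F.map_id i) (fun i j k hij hjk => F.map_comp (homOfLE hij) (homOfLE hjk))
  have hσ : ∀ i j k h h', IsIdentity₂ (σ.cell i j k h h') := fun i j k h h' =>
    ⟨F.map_comp (homOfLE h) (homOfLE h'), rfl⟩
  have h := H.facesLabelled_saturation 0 (NerveSimplex.toRS σ) (by
      rw [NerveSimplex.facesLabelled_toRS_iff]
      exact NerveSimplex.forall_lastPart_eq 0 (fun i j h => IsIdentity (σ.map i j h.le))
        (fun i j k h h' => IsIdentity₂ (σ.cell i j k h.le h'.le)) ⟨⟨rfl, hfg⟩, ⟨rfl, hgf⟩⟩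
        (fun a b c h h' => hσ _ _ _ _ _) (fun i _ h => ⟨hσ _ _ _ _ _, hσ _ _ _ _ _⟩))
  rw [NerveSimplex.facesLabelled_toRS_iff, NerveSimplex.forall_lastPart_sharp_iff 0
    (fun i j h => IsIdentity (σ.map i j h.le))
    (fun i j k h h' => IsIdentity₂ (σ.cell i j k h.le h'.le))] at h
  exact h.1 0 1 (by decide)

/-- An invertible `2`-morphism `f ⟶ g` gives a triangle with edges `f`, `g` and an identity, which
is marked by saturation. -/
theorem isIdentity₂_of_isIso (H : IsPrecomplicial 2 (robertsStreetNerve C)) {x y : C}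
    {f g : x ⟶ y} (α : f ⟶ g) (hα : IsIso α) : IsIdentity₂ α := by
  let φ : f ≅ g ≫ 𝟙 y := asIso α ≪≫ (ρ_ g).symm
  let F := ComposableArrows.mk₂ g (𝟙 y)
  let ρ : NerveSimplex (Fin (2 + 1)) C := .ofFunctor F.obj (fun i j h => F.map (homOfLE h))
    (fun i => F.map_id i) (fun i j k hij hjk => F.map_comp (homOfLE hij) (homOfLE hjk))
  obtain ⟨q, hq, hq'⟩ := NerveSimplex.exists_replacement ρ (fun _ _ _ => .refl _) 0 2 (by decide)
    ⟨f, φ⟩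
  have hq₀ : ∀ i, q i i le_rfl = .refl _ := fun i => hq' _ _ _
    ((by decide : ∀ i : Fin (2 + 1), (i, i) ≠ (0, 2)) i)
  let τ := NerveSimplex.replace ρ q hq₀
  have h1 : IsIdentity (τ.map 1 2 (by decide)) :=
    NerveSimplex.isIdentity_replace_of_refl ρ q hq₀ (i := 1) (j := 2) ⟨rfl, rfl⟩
      (hq' 1 2 _ (by decide))
  have h2 : IsIso (triangle τ) := NerveSimplex.isIso_replaceCell ρ (i := 0) (j := 1) (k := 2)
    (IsIdentity₂.isIso ⟨F.map_comp (homOfLE (by decide : (0 : Fin 3) ≤ 1))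
      (homOfLE (by decide : (1 : Fin 3) ≤ 2)),
      rfl⟩) _ _ _
  have h3 : IsIdentity₂ (triangle τ) := by
    obtain ⟨σ, ⟨hσ1, hσ2⟩, -, hσ⟩ := NerveSimplex.exists_saturation_one τ h1 h2
    have h := H.facesLabelled_saturation 1 (NerveSimplex.toRS σ)
      ((NerveSimplex.facesLabelled_toRS_iff _ _).2 ⟨hσ1, hσ2⟩)
    rw [NerveSimplex.facesLabelled_toRS_iff, NerveSimplex.forall_lastPart_sharp_iff 1
      (fun i j h => IsIdentity (σ.map i j h.le))
      (fun i j k h h' => IsIdentity₂ (σ.cell i j k h.le h'.le))] at h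
    rw [← hσ]
    exact h.2.2 0 (by decide) 0 1 (by decide) (by decide)
  have key : ∀ (a : Replacement (ρ.map 0 2 (by decide))) (b : Replacement (ρ.map 0 1 (by decide)))
      (c : Replacement (ρ.map 1 2 (by decide))), a = ⟨f, φ⟩ → b = .refl _ → c = .refl _ →
      IsIdentity₂ (NerveSimplex.replaceCell ρ 0 1 2 (by decide) (by decide) a b c) →
      IsIdentity₂ α := by
    rintro _ _ _ rfl rfl rfl ⟨e, he⟩
    replace he : (α ≫ (ρ_ g).inv) ≫ eqToHom (rfl : g ≫ 𝟙 y = g ≫ 𝟙 y) ≫ 𝟙 g ▷ 𝟙 y ≫ g ◁ 𝟙 (𝟙 y) =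
      eqToHom e := he
    have e' : f = g := e.trans (Bicategory.Strict.comp_id g)
    subst e'
    refine ⟨rfl, ?_⟩
    have he' : α ≫ eqToHom (Bicategory.Strict.comp_id f).symm =
        eqToHom (Bicategory.Strict.comp_id f).symm := by
      simpa [Bicategory.Strict.rightUnitor_eqToIso] using he.trans (rfl : _ = eqToHom
        (Bicategory.Strict.comp_id f).symm)
    exact ((comp_eqToHom_iff _ _ _).1 he').trans (eqToHom_trans _ _)
  exact key _ _ _ hq (hq' 0 1 _ (by decide)) (hq' 1 2 _ (by decide)) h3

/-- If invertible `2`-morphisms are identities, adjoint equivalences are isomorphisms. -/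
theorem IsEquivalence₁.isIsomorphism
    (H : ∀ (x y : C) (f g : x ⟶ y) (α : f ⟶ g), IsIso α → IsIdentity₂ α) {x y : C} {f : x ⟶ y}
    (hf : IsEquivalence₁ f) : IsIsomorphism f := by
  obtain ⟨g, -, ⟨η⟩, ⟨e⟩⟩ := hf.exists_inverse
  exact ⟨g, (H _ _ _ _ η.hom inferInstance).1.symm, (H _ _ _ _ e.hom inferInstance).1⟩

/-- If isomorphisms and invertible `2`-morphisms are identities, the Roberts–Street nerve is a
retract of the natural nerve. -/
theorem isPrecomplicial_robertsStreetNerve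
    (H1 : ∀ (x y : C) (f : x ⟶ y), IsIsomorphism f → IsIdentity f)
    (H2 : ∀ (x y : C) (f g : x ⟶ y) (α : f ⟶ g), IsIso α → IsIdentity₂ α) :
    IsPrecomplicial 2 (robertsStreetNerve C) := by
  obtain ⟨r, hr, -⟩ := TDeltaSet.exists_extension (nerveInclusion C) (nerveInclusion_injective C)
    (𝟙 (robertsStreetNerve C)) (plainRetraction C) (fun _ _ => rfl) (by
      intro m y _ _
      have hy : TDeltaSet.IsLabelled ((naturalNerve C).map (ph m).op y) := ⟨y, rfl⟩
      obtain ⟨σ, hσ⟩ := NerveSimplex.exists_toNatural ((naturalNerve C).map (ph m).op y)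
      rw [hσ] at hy ⊢
      refine (NerveSimplex.isLabelled_toRS_iff (m := m) σ).2 ?_
      match m, σ, hy with
      | 0, σ, hy =>
        exact H1 _ _ _ (((NerveSimplex.isLabelled_toNatural_one σ).1 hy).isIsomorphism H2)
      | 1, σ, hy => exact H2 _ _ _ _ _ ((NerveSimplex.isLabelled_toNatural_two σ).1 hy)
      | _ + 2, _, _ => trivial)
  intro A B i hi f
  obtain ⟨g, hg⟩ := isPrecomplicial_naturalNerve C i hi (f ≫ nerveInclusion C)
  exact ⟨g ≫ r, by rw [reassoc_of% hg, hr, Category.comp_id]⟩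

theorem isPrecomplicial_robertsStreetNerve_iff : IsPrecomplicial 2 (robertsStreetNerve C) ↔
    (∀ (x y : C) (f : x ⟶ y), IsIsomorphism f → IsIdentity f) ∧
    (∀ (x y : C) (f g : x ⟶ y) (α : f ⟶ g), IsIso α → IsIdentity₂ α) :=
  ⟨fun H => ⟨fun _ _ => isIdentity_of_isIsomorphism H,
    fun _ _ _ _ α hα => isIdentity₂_of_isIso H α hα⟩,
    fun H => isPrecomplicial_robertsStreetNerve H.1 H.2⟩

end

/-! ### Homotopies out of the nerves -/

section

variable {C : Type u} [Bicategory.{w, v} C]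

namespace NerveSimplex

open SimplexCategory

/-- The simplex of the cylinder on the Roberts–Street nerve given by a simplex of the nerve and a
sequence of vertices of the interval. -/
def toCylinder {n : ℕ} (σ : NerveSimplex (Fin (n + 1)) C)
    (j : Fin (n + 1) → ULift.{max u v w} Bool) :
    (FunctorToTypes.prod (robertsStreetNerve C) interval).obj (op (plain n)) := (toRS σ, j)

theorem map_toCylinder {m n : ℕ} (θ : SimplexCategory.mk m ⟶ SimplexCategory.mk n)
    (σ : NerveSimplex (Fin (n + 1)) C) (j : Fin (n + 1) → ULift.{max u v w} Bool) :
    (FunctorToTypes.prod (robertsStreetNerve C) interval).map (pl θ).op (toCylinder σ j) =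
      toCylinder (reindex θ.toOrderHom σ) (j ∘ θ.toOrderHom) := rfl

variable [Bicategory.Strict C]

theorem isLabelled_toCylinder {m : ℕ} (σ : NerveSimplex (Fin (m + 1 + 1)) C)
    (hσ : rsMarked (m := m) σ) (j : Fin (m + 1 + 1) → ULift.{max u v w} Bool) :
    TDeltaSet.IsLabelled (toCylinder σ j) := by
  obtain ⟨y, hy⟩ := (isLabelled_toRS_iff (m := m) σ).2 hσ
  exact ⟨(y, j), Prod.ext hy rfl⟩

variable {Z : TDeltaSet.{max u v w}}
  (H : FunctorToTypes.prod (robertsStreetNerve C) interval ⟶ Z)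

/-- All simplices of the cylinder over a given simplex of the nerve have images with labels. -/
def HasLabelledImage {m : ℕ} (σ : NerveSimplex (Fin (m + 1 + 1)) C) : Prop :=
  ∀ j, TDeltaSet.IsLabelled (H.app _ (toCylinder (n := m + 1) σ j))

theorem HasLabelledImage.of_rsMarked {m : ℕ} {σ : NerveSimplex (Fin (m + 1 + 1)) C}
    (hσ : rsMarked (m := m) σ) : HasLabelledImage H σ :=
  fun j => (isLabelled_toCylinder σ hσ j).app H

variable {H}

/-- If a simplex of the nerve has the faces required by an elementary anodyne extension, all its
faces marked by that extension are labelled in the image: a sequence of vertices of the interval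
extends along injective maps. -/
theorem HasLabelledImage.of_extension {n : ℕ} {P Q : Set (Set (Fin (n + 1)))}
    (hPQ : ∀ a : Z.obj (op (plain n)), TDeltaSet.FacesLabelled P a → TDeltaSet.FacesLabelled Q a)
    (σ : NerveSimplex (Fin (n + 1)) C)
    (h1 : ∀ i j (h : i < j), {i, j} ∈ P →
      HasLabelledImage H (m := 0) (reindex (pairHom i j h.le).toOrderHom σ))
    (h2 : ∀ i j k (h : i < j) (h' : j < k), {i, j, k} ∈ P →
      HasLabelledImage H (m := 1) (reindex (tripleHom i j k h.le h'.le).toOrderHom σ))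
    {m : ℕ} (x : SimplexCategory.mk (m + 1) ⟶ SimplexCategory.mk n)
    (hx : Function.Injective x.toOrderHom) (hxQ : Set.range x.toOrderHom ∈ Q) :
    HasLabelledImage H (m := m) (reindex x.toOrderHom σ) := by
  have hP := (forall_injective_iff P
    (fun m x => HasLabelledImage H (m := m) (reindex x.toOrderHom σ))
    (fun m x => .of_rsMarked H (m := m + 2) trivial)).2 ⟨h1, h2⟩
  intro j
  let j' : Fin (n + 1) → ULift.{max u v w} Bool := Function.extend x.toOrderHom j fun _ => ⟨false⟩
  have hj : j' ∘ x.toOrderHom = j := funext fun i => hx.extend_apply j (fun _ => ⟨false⟩) i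
  have h := hPQ (H.app _ (toCylinder σ j')) (by
    intro k y hy hyP
    rw [← TDeltaSet.app_map, map_toCylinder]
    exact hP k y hy hyP _) m x hx hxQ
  rw [← TDeltaSet.app_map, map_toCylinder, hj] at h
  exact h

theorem HasLabelledImage.of_isIso_triangle_of_isIdentity (hZ : IsPrecomplicial 2 Z)
    (τ : NerveSimplex (Fin (1 + 1 + 1)) C) (h1 : IsIdentity (τ.map 1 2 (by decide)))
    (h2 : IsIso (triangle τ)) : HasLabelledImage H (m := 1) τ := by
  obtain ⟨σ, ⟨hσ1, hσ2⟩, -, hσ⟩ := exists_saturation_one τ h1 h2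
  have := of_extension (H := H) (hZ.facesLabelled_saturation 1) σ
    (fun i j h hP => .of_rsMarked H (m := 0) (hσ1 i j h hP))
    (fun i j k h h' hP => .of_rsMarked H (m := 1) (hσ2 i j k h h' hP))
    (tripleHom 0 1 2 (by decide) (by decide)) (injective_tripleHom (by decide) (by decide)) (by
      rw [range_tripleHom]
      exact mem_lastPart_sharpMarking_one)
  exact hσ ▸ this

theorem HasLabelledImage.of_isIso_triangle (hZ : IsPrecomplicial 2 Z)
    (τ : NerveSimplex (Fin (1 + 1 + 1)) C) (h2 : IsIso (triangle τ)) :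
    HasLabelledImage H (m := 1) τ := by
  obtain ⟨σ, ⟨hσ1, hσ2⟩, -, hσ⟩ := exists_thinness τ h2
  have := of_extension (H := H) (hZ.facesLabelled_thinness (m := 3) (by decide) 2) σ
    (fun i j h hP => .of_rsMarked H (m := 0) (hσ1 i j h hP))
    (fun i j k h h' hP => (hσ2 i j k h h' hP).elim (fun hc => .of_rsMarked H (m := 1) hc)
      (fun hc => of_isIso_triangle_of_isIdentity hZ
        (reindex (tripleHom i j k h.le h'.le).toOrderHom σ) hc.1 hc.2))
    (tripleHom 0 1 3 (by decide) (by decide)) (injective_tripleHom (by decide) (by decide)) (by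
      rw [range_tripleHom]
      exact mem_admissibleMarking''_three_two)
  exact hσ ▸ this

theorem HasLabelledImage.of_isEquivalence₁ (hZ : IsPrecomplicial 2 Z)
    (s : NerveSimplex (Fin (0 + 1 + 1)) C) (hs : IsEquivalence₁ (edge s)) :
    HasLabelledImage H (m := 0) s := by
  obtain ⟨σ, hσ1, hσ2, hσ⟩ := exists_saturation_zero s hs
  have := of_extension (H := H) (hZ.facesLabelled_saturation 0) σ
    (fun i j h hP => .of_rsMarked H (m := 0) (hσ1 i j h hP))
    (fun i j k h h' hP => of_isIso_triangle hZ (reindex (tripleHom i j k h.le h'.le).toOrderHom σ)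
      (hσ2 i j k h.le h'.le))
    (pairHom 0 1 (by decide)) (injective_pairHom (by decide)) (by
      rw [range_pairHom]
      exact mem_lastPart_sharpMarking_zero)
  exact hσ ▸ this

/-- Maps to `2`-precomplicial sets send the simplices that are marked in the natural nerve to
labelled ones, since the labels of the natural nerve are generated by elementary anodyne
extensions. -/
theorem HasLabelledImage.of_isLabelled_toNatural (hZ : IsPrecomplicial 2 Z) {m : ℕ}
    (σ : NerveSimplex (Fin (m + 1 + 1)) C)
    (hσ : TDeltaSet.IsLabelled (toNatural (n := m + 1) σ)) : HasLabelledImage H σ := by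
  match m, σ, hσ with
  | 0, σ, hσ => exact of_isEquivalence₁ hZ σ ((isLabelled_toNatural_one σ).1 hσ)
  | 1, σ, hσ => exact of_isIso_triangle hZ σ ((isLabelled_toNatural_two σ).1 hσ)
  | m + 2, σ, hσ => exact .of_rsMarked H (m := m + 2) trivial

end NerveSimplex

variable [Bicategory.Strict C] {Z : TDeltaSet.{max u v w}}

open NerveSimplex SimplexCategory

/-- Maps from the Roberts–Street nerve to `2`-precomplicial sets extend to the natural nerve. -/
theorem exists_nerveInclusion_comp_eq (hZ : IsPrecomplicial 2 Z) (h : robertsStreetNerve C ⟶ Z) :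
    ∃ g, nerveInclusion C ≫ g = h := by
  let s : TDeltaSet.PlainMap (naturalNerve C) Z :=
    { app n a := h.app _ ((plainRetraction C).app n a)
      comm θ b := by rw [(plainRetraction C).comm, TDeltaSet.app_map] }
  obtain ⟨g, hg, -⟩ := TDeltaSet.exists_extension (nerveInclusion C) (nerveInclusion_injective C)
    h s (fun _ _ => rfl) (by
      intro m y _ _
      have hy : TDeltaSet.IsLabelled ((naturalNerve C).map (ph m).op y) := ⟨y, rfl⟩
      obtain ⟨σ, hσ⟩ := exists_toNatural ((naturalNerve C).map (ph m).op y)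
      rw [hσ] at hy ⊢
      exact HasLabelledImage.of_isLabelled_toNatural (H := FunctorToTypes.prod.fst ≫ h) hZ σ hy
        (fun _ => ⟨false⟩))
  exact ⟨g, hg⟩

/-- Homotopies between maps from the Roberts–Street nerve to `2`-precomplicial sets extend to the
natural nerve, with prescribed extensions of both ends. -/
theorem homotopic_of_nerveInclusion_comp (hZ : IsPrecomplicial 2 Z) (g g' : naturalNerve C ⟶ Z)
    (h : Homotopic (nerveInclusion C ≫ g) (nerveInclusion C ≫ g')) : Homotopic g g' := by
  obtain ⟨H, hH, hH'⟩ := h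
  let s : TDeltaSet.PlainMap (FunctorToTypes.prod (naturalNerve C) interval) Z :=
    { app n a := H.app _ ((plainRetraction C).app n a.1, a.2)
      comm θ b := TDeltaSet.app_map H (pl θ) ((plainRetraction C).app _ b.1, b.2) }
  have hs : ∀ n (a : (naturalNerve C).obj (op (plain n))),
      g.app _ a = s.app n (a, fun _ => ⟨false⟩) :=
    fun n a => (congrArg (fun f => f.app (op (plain n)) ((plainRetraction C).app n a)) hH).symm
  have hs' : ∀ n (a : (naturalNerve C).obj (op (plain n))),
      g'.app _ a = s.app n (a, fun _ => ⟨true⟩) :=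
    fun n a => (congrArg (fun f => f.app (op (plain n)) ((plainRetraction C).app n a)) hH').symm
  obtain ⟨K, hK, hK'⟩ := TDeltaSet.exists_hom_of_rel s
    (fun m y e => (y.2 = (fun _ => ⟨false⟩) → e = g.app _ y.1) ∧
      (y.2 = (fun _ => ⟨true⟩) → e = g'.app _ y.1)) (by
      rintro m ⟨y, j⟩ -
      have hne : (fun _ => ⟨false⟩ : Fin (m + 1 + 1) → ULift.{max u v w} Bool) ≠ fun _ => ⟨true⟩ :=
        fun h => Bool.false_ne_true (congrArg ULift.down (congrFun h 0))
      -- over the ends of the interval, the labels are prescribed by `g` and `g'`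
      by_cases hj : j = fun _ => ⟨false⟩
      · subst hj
        exact ⟨g.app _ y, (TDeltaSet.app_map g (ph m) y).symm.trans (hs _ _), fun _ => rfl,
          fun h => (hne h).elim⟩
      by_cases hj' : j = fun _ => ⟨true⟩
      · subst hj'
        exact ⟨g'.app _ y, (TDeltaSet.app_map g' (ph m) y).symm.trans (hs' _ _),
          fun h => (hne h.symm).elim, fun _ => rfl⟩
      have hy : TDeltaSet.IsLabelled ((naturalNerve C).map (ph m).op y) := ⟨y, rfl⟩
      obtain ⟨σ, hσ⟩ := exists_toNatural ((naturalNerve C).map (ph m).op y)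
      rw [hσ] at hy
      obtain ⟨e, he⟩ := HasLabelledImage.of_isLabelled_toNatural (H := H) hZ σ hy j
      exact ⟨e, he.trans (congrArg (fun a => s.app (m + 1) (a, j)) hσ.symm),
        fun h => (hj h).elim, fun h => (hj' h).elim⟩)
  have hdeg : ∀ m (y : (naturalNerve C).obj (op (marked m))) (j : Fin (m + 1 + 1) → _),
      ¬ TDeltaSet.IsDegenerate y → ¬ TDeltaSet.IsDegenerate
        (A := FunctorToTypes.prod (naturalNerve C) interval) (y, j) := by
    rintro m y j hy ⟨n, θ, hθ, b, e⟩
    exact hy ⟨n, θ, hθ, b.1, congrArg Prod.fst e⟩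
  refine ⟨K, TDeltaSet.hom_ext (fun n a => ?_) (fun m y hy => ?_),
    TDeltaSet.hom_ext (fun n a => ?_) (fun m y hy => ?_)⟩
  · exact (hK _ _).trans (hs n a).symm
  · exact (hK' m _ (hdeg m y _ hy)).1 rfl
  · exact (hK _ _).trans (hs' n a).symm
  · exact (hK' m _ (hdeg m y _ hy)).2 rfl

theorem homotopic_refl {X Z : TDeltaSet.{u}} (f : X ⟶ Z) : Homotopic f f :=
  ⟨FunctorToTypes.prod.fst ≫ f, rfl, rfl⟩

variable (C) in
theorem isWeakEquivalence_nerveInclusion : IsWeakEquivalence 2 (nerveInclusion C) := by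
  intro Z hZ
  -- the intermediate maps of a chain of homotopies have to be extended as well, hence the
  -- quantification over all extensions of both ends
  have key : ∀ h h' : robertsStreetNerve C ⟶ Z, Relation.EqvGen Homotopic h h' →
      ∀ g g', nerveInclusion C ≫ g = h → nerveInclusion C ≫ g' = h' →
        Relation.EqvGen Homotopic g g' := by
    intro h h' hh'
    induction hh' with
    | rel h h' hh' =>
      rintro g g' rfl rfl
      exact .rel _ _ (homotopic_of_nerveInclusion_comp hZ g g' hh')
    | refl h =>
      rintro g g' rfl hg'
      exact .rel _ _ (homotopic_of_nerveInclusion_comp hZ g g' (hg' ▸ homotopic_refl _))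
    | symm h h' _ ih => exact fun g g' hg hg' => .symm _ _ (ih g' g hg' hg)
    | trans h h' h'' _ _ ih ih' =>
      intro g g'' hg hg''
      obtain ⟨g', hg'⟩ := exists_nerveInclusion_comp_eq hZ h'
      exact .trans _ _ _ (ih g g' hg hg') (ih' g' g'' hg' hg'')
  refine ⟨fun h => ?_, fun g g' h => key _ _ h g g' rfl rfl⟩
  obtain ⟨g, rfl⟩ := exists_nerveInclusion_comp_eq hZ h
  exact ⟨g, .refl _⟩

end

/-! ### Attaching labels along elementary anodyne extensions -/

namespace TDeltaSet

variable {A B A' B' : TDeltaSet.{u}}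

theorem mem_range_of_isDegenerate (i : A ⟶ A')
    (hi : ∀ n, Function.Surjective (i.app (op (plain n)))) {m : ℕ}
    {y : A'.obj (op (marked m))} (hy : IsDegenerate y) : y ∈ Set.range (i.app (op (marked m))) := by
  obtain ⟨n, θ, hθ, b, rfl⟩ := hy
  obtain ⟨b, rfl⟩ := hi n b
  exact ⟨A.map (ze θ hθ).op b, app_map i _ _⟩

/-- A criterion for pushout squares of monomorphisms that are bijective on unmarked simplices: the
labels that are not in the image of the first monomorphism have to correspond to those that are not
in the image of the second one. -/
theorem isPushout_of_labels {f : A ⟶ B} {i : A ⟶ A'} {i' : B ⟶ B'} {g : A' ⟶ B'}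
    (w : f ≫ i' = i ≫ g) (hi : ∀ a, Function.Injective (i.app a))
    (hi' : ∀ a, Function.Injective (i'.app a))
    (hs : ∀ n, Function.Surjective (i.app (op (plain n))))
    (hs' : ∀ n, Function.Surjective (i'.app (op (plain n))))
    (h1 : ∀ m (z : A'.obj (op (marked m))), z ∉ Set.range (i.app (op (marked m))) →
      g.app _ z ∉ Set.range (i'.app (op (marked m))))
    (h2 : ∀ m (y : B'.obj (op (marked m))), y ∈ Set.range (i'.app (op (marked m))) ∨
      y ∈ Set.range (g.app (op (marked m))))
    (h3 : ∀ m (z z' : A'.obj (op (marked m))), z ∉ Set.range (i.app (op (marked m))) →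
      z' ∉ Set.range (i.app (op (marked m))) → g.app _ z = g.app _ z' → z = z') :
    IsPushout f i i' g where
  w := w
  isColimit' := ⟨Limits.evaluationJointlyReflectsColimits _ (fun ⟨a⟩ => by
    refine (Limits.isColimitMapCoconePushoutCoconeEquiv _ _).symm (IsPushout.isColimit ?_)
    change IsPushout (f.app (op a)) (i.app (op a)) (i'.app (op a)) (g.app (op a))
    have w' : ∀ x, i'.app (op a) (f.app (op a) x) = g.app (op a) (i.app (op a) x) := fun x =>
      congrArg (fun k => k.app (op a) x) w
    have : Mono (i'.app (op a)) := (mono_iff_injective _).2 (hi' _)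
    have hpb : ∀ x₂ x₃, i'.app (op a) x₂ = g.app (op a) x₃ →
        x₃ ∈ Set.range (i.app (op a)) := by
      intro x₂ x₃ h
      cases a with
      | plain n => exact hs n x₃
      | marked m =>
        by_contra hx
        exact h1 m x₃ hx ⟨x₂, h⟩
    refine Limits.Types.isPushout_of_isPullback_of_mono'
      ((Limits.Types.isPullback_iff _ _ _ _).2 ⟨?_, ?_, ?_⟩) ?_ ?_
    · exact congrArg (fun k => k.app (op a)) w
    · exact fun x y h => hi _ h.2
    · intro x₂ x₃ h
      obtain ⟨x₁, rfl⟩ := hpb x₂ x₃ h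
      exact ⟨x₁, hi' _ ((w' x₁).trans h.symm), rfl⟩
    -- a commutative square of injections is a pushout if it is bijective on complements
    · refine Set.eq_univ_of_forall fun y => ?_
      cases a with
      | plain n => exact .inl (hs' n y)
      | marked m => exact h2 m y
    · intro x y hx hy h
      cases a with
      | plain n => exact (hx (hs n x)).elim
      | marked m => exact h3 m x y hx hy h)⟩

/-- The labels of a stratification of a standard simplex are determined by the underlying
simplices. -/
theorem markedSimplex_ext {n m : ℕ} {P : Set (Set (Fin (n + 1)))}
    {z z' : (markedSimplex.{u} n P).obj (op (marked m))}
    (h : (markedSimplex.{u} n P).map (ph m).op z = (markedSimplex.{u} n P).map (ph m).op z') :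
    z = z' := by
  obtain ⟨x, l, rfl⟩ := LabelledSSet.exists_lab _ z
  obtain ⟨x', l', rfl⟩ := LabelledSSet.exists_lab _ z'
  obtain rfl : x = x' := (LabelledSSet.map_ph_lab _ x l).symm.trans
    (h.trans (LabelledSSet.map_ph_lab _ x' l'))
  exact congrArg _ (stratify_label_eq l l')

theorem face_injective {n k : ℕ} {P : Set (Set (Fin (n + 1)))}
    {x x' : SimplexCategory.mk k ⟶ SimplexCategory.mk n} (h : face.{u} P x = face P x') : x = x' :=
  SSet.stdSimplex.objEquiv.symm.injective h

theorem not_isDegenerate_of_face {n m : ℕ} {P : Set (Set (Fin (n + 1)))}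
    {z : (markedSimplex.{u} n P).obj (op (marked m))}
    {y : SimplexCategory.mk (m + 1) ⟶ SimplexCategory.mk n} (hy : Function.Injective y.toOrderHom)
    (e : (markedSimplex.{u} n P).map (ph m).op z = face P y) : ¬ IsDegenerate z := by
  rintro ⟨k, θ, hθ, b, rfl⟩
  obtain ⟨b, rfl⟩ := exists_face b
  rw [map_ph_ze, map_face] at e
  exact not_injective_comp θ b hθ (face_injective e ▸ hy)

/-- A label of a stratification of a standard simplex that is not a label of a smaller one. -/
theorem exists_face_of_notMem_range {n m : ℕ} {P Q : Set (Set (Fin (n + 1)))} (h : P ⊆ Q)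
    {z : (markedSimplex.{u} n Q).obj (op (marked m))}
    (hz : z ∉ Set.range ((markedSimplexInclusion.{u} n h).app (op (marked m)))) :
    ∃ x : SimplexCategory.mk (m + 1) ⟶ SimplexCategory.mk n, Function.Injective x.toOrderHom ∧
      Set.range x.toOrderHom ∈ Q ∧ Set.range x.toOrderHom ∉ P ∧
      (markedSimplex.{u} n Q).map (ph m).op z = face Q x := by
  have hz' : ¬ IsDegenerate z := fun hz' =>
    hz (mem_range_of_isDegenerate (markedSimplexInclusion.{u} n h) (fun _ x => ⟨x, rfl⟩) hz')
  obtain ⟨x, hx, hxQ, e⟩ := exists_face_of_not_isDegenerate z hz'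
  refine ⟨x, hx, hxQ, fun hxP => hz ?_, e⟩
  obtain ⟨z₀, hz₀⟩ := isLabelled_face.{u} x hxP
  refine ⟨z₀, markedSimplex_ext ?_⟩
  rw [← app_map, hz₀, e, markedSimplexInclusion_face]

end TDeltaSet

/-- A family of simplices of a simplicial set with labels, each with an elementary anodyne extension
between two stratifications `P i ⊆ Q i` of the standard simplex, given by sets of marked faces. -/
structure CellFamily (S : LabelledSSet.{u}) (N : ℕ) (ι : Type u) where
  dim : ι → ℕ
  P : ∀ i, Set (Set (Fin (dim i + 1)))
  Q : ∀ i, Set (Set (Fin (dim i + 1)))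
  le : ∀ i, P i ⊆ Q i
  mem : ∀ i, ElementaryAnodyne N (markedSimplexInclusion.{u} (dim i) (le i))
  simplex : ∀ i, S.X.obj (op (.mk (dim i)))

namespace CellFamily

variable {S : LabelledSSet.{u}} {N : ℕ} {ι : Type u} (K : CellFamily S N ι)

/-- A new label of a simplex: a way to write it as a face that is marked in one of the elementary
anodyne extensions. -/
structure NewLabel {m : ℕ} (x : S.X.obj (op (.mk (m + 1)))) where
  i : ι
  y : SimplexCategory.mk (m + 1) ⟶ SimplexCategory.mk (K.dim i)
  injective : Function.Injective y.toOrderHom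
  mem : Set.range y.toOrderHom ∈ K.Q i
  notMem : Set.range y.toOrderHom ∉ K.P i
  eq : S.X.map y.op (K.simplex i) = x

variable [LinearOrder ι]

/-- The simplicial set with labels obtained by attaching the new labels of index below `t`; for
`t = ⊤` all of them. -/
def attach (t : WithTop ι) : LabelledSSet.{u} where
  X := S.X
  Label x := S.Label x ⊕ {l : K.NewLabel x // (l.i : WithTop ι) < t}
  deg x hx := .inl (S.deg x hx)

/-- Inclusions between the stages of the attachment. -/
noncomputable def attachMap {s t : WithTop ι} (h : s ≤ t) :
    (K.attach s).toTDeltaSet ⟶ (K.attach t).toTDeltaSet :=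
  LabelledSSet.Hom.toTDeltaSet (S := K.attach s) (T := K.attach t)
    { f := 𝟙 S.X
      l _ := Sum.map id fun l => ⟨l.1, l.2.trans_le h⟩
      l_deg _ _ _ := rfl }

theorem attachMap_injective {s t : WithTop ι} (h : s ≤ t) (a) :
    Function.Injective ((K.attachMap h).app a) := by
  obtain ⟨a⟩ := a
  cases a with
  | plain k => exact fun _ _ h => h
  | marked k =>
    intro y y' e
    obtain ⟨x, l, rfl⟩ := LabelledSSet.exists_lab _ y
    obtain ⟨x', l', rfl⟩ := LabelledSSet.exists_lab _ y'
    obtain rfl : x = x' := congrArg Sigma.fst e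
    replace e := (Sigma.mk.inj_iff.1 e).2
    replace e := Sum.map_injective.2 ⟨fun _ _ h => h, fun l l' h => Subtype.ext
      (congrArg (fun l => l.1) h)⟩ (eq_of_heq e)
    exact congrArg ((K.attach s).lab x) e

/-- The stages of the attachment as a functor. -/
noncomputable def attachFunctor : WithTop ι ⥤ TDeltaSet.{u} where
  obj t := (K.attach t).toTDeltaSet
  map h := K.attachMap (leOfHom h)
  map_id t := by
    ext ⟨a⟩ x
    cases a with
    | plain k => rfl
    | marked k =>
      obtain ⟨x, l | l⟩ := x <;> rfl
  map_comp f g := by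
    ext ⟨a⟩ x
    cases a with
    | plain k => rfl
    | marked k =>
      obtain ⟨x, l | l⟩ := x <;> rfl

/-- The faces required by an elementary anodyne extension are labelled at the respective stage. -/
def IsAdmissible : Prop :=
  ∀ i, TDeltaSet.FacesLabelled (K.P i) ((K.attach i).unm (K.simplex i))

variable {K}

/-- The step from one stage to the next is a pushout of the elementary anodyne extension of the cell
`i`, since the labels attached at this step are the faces of the cell that are newly marked. -/
theorem exists_isPushout (hK : K.IsAdmissible) (i : ι) (t : WithTop ι) (ht : ↑i ≤ t)
    (hit : ∀ j : ι, (j : WithTop ι) < t ↔ j ≤ i) :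
    ∃ f g, IsPushout f (markedSimplexInclusion.{u} (K.dim i) (K.le i)) (K.attachMap ht) g := by
  obtain ⟨f, hf⟩ := TDeltaSet.exists_hom_markedSimplex (K.P i) _ (hK i)
  have hlt : (i : WithTop ι) < t := (hit i).2 le_rfl
  let σ : (K.attach t).toTDeltaSet.obj (op (plain (K.dim i))) := (K.attach t).unm (K.simplex i)
  -- the label attached for a face
  let lbl : ∀ (m : ℕ) (y : SimplexCategory.mk (m + 1) ⟶ SimplexCategory.mk (K.dim i))
      (_ : Function.Injective y.toOrderHom) (_ : Set.range y.toOrderHom ∈ K.Q i)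
      (_ : Set.range y.toOrderHom ∉ K.P i), (K.attach t).toTDeltaSet.obj (op (marked m)) :=
    fun m y h1 h2 h3 => (K.attach t).lab (S.X.map y.op (K.simplex i))
      (.inr ⟨⟨i, y, h1, h2, h3, rfl⟩, hlt⟩)
  obtain ⟨g, hg, hg'⟩ := TDeltaSet.exists_hom_of_rel (TDeltaSet.PlainMap.ofSimplex (K.Q i) σ)
    (fun m z e =>
      (∀ z', (markedSimplexInclusion.{u} (K.dim i) (K.le i)).app _ z' = z →
        e = (K.attachMap ht).app _ (f.app _ z')) ∧
      (∀ y h1 h2 h3, (markedSimplex.{u} (K.dim i) (K.Q i)).map (ph m).op z =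
        TDeltaSet.face (K.Q i) y → e = lbl m y h1 h2 h3)) (by
      intro m z hz
      obtain ⟨y, hy, hyQ, e⟩ := TDeltaSet.exists_face_of_not_isDegenerate z hz
      by_cases hyP : Set.range y.toOrderHom ∈ K.P i
      · obtain ⟨z₀, hz₀⟩ := TDeltaSet.isLabelled_face.{u} y hyP
        refine ⟨(K.attachMap ht).app _ (f.app _ z₀), ?_, fun z' hz' => ?_,
          fun y' _ _ h3 e' => (h3 ?_).elim⟩
        · rw [← TDeltaSet.app_map, ← TDeltaSet.app_map, hz₀, hf, e]
          exact TDeltaSet.app_map (K.attachMap ht) (pl y) _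
        · have : z' = z₀ := TDeltaSet.markedSimplexInclusion_injective (K.le i) _
            (TDeltaSet.markedSimplex_ext (by
              rw [hz', e, ← TDeltaSet.app_map, hz₀, TDeltaSet.markedSimplexInclusion_face]))
          rw [this]
        · rwa [← TDeltaSet.face_injective (e.symm.trans e')]
      · refine ⟨lbl m y hy hyQ hyP, ?_, fun z' hz' => ?_, fun y' _ _ h3 e' => ?_⟩
        · rw [e]
          exact LabelledSSet.map_ph_lab _ _ _
        · exfalso
          have hz'' : ¬ TDeltaSet.IsDegenerate z' := by
            rintro ⟨n, θ, hθ, b, rfl⟩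
            exact hz ⟨n, θ, hθ, _, hz'.symm.trans (TDeltaSet.app_map _ _ _)⟩
          obtain ⟨y', -, hyP', e'⟩ := TDeltaSet.exists_face_of_not_isDegenerate z' hz''
          rw [← hz', ← TDeltaSet.app_map, e', TDeltaSet.markedSimplexInclusion_face] at e
          exact hyP (TDeltaSet.face_injective e ▸ hyP')
        · obtain rfl := TDeltaSet.face_injective (e.symm.trans e')
          rfl)
  have hg'' : ∀ m (z : (markedSimplex.{u} (K.dim i) (K.Q i)).obj (op (marked m))) y h1 h2 h3,
      (markedSimplex.{u} (K.dim i) (K.Q i)).map (ph m).op z =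
        TDeltaSet.face (K.Q i) y → g.app _ z = lbl m y h1 h2 h3 := by
    intro m z y h1 h2 h3 e
    exact (hg' m z (TDeltaSet.not_isDegenerate_of_face h1 e)).2 y h1 h2 h3 e
  refine ⟨f, g, TDeltaSet.isPushout_of_labels ?_ (TDeltaSet.markedSimplexInclusion_injective _)
    (K.attachMap_injective ht) (fun _ x => ⟨x, rfl⟩) (fun _ x => ⟨x, rfl⟩) ?_ ?_ ?_⟩
  · refine TDeltaSet.hom_ext (fun n a => ?_) (fun m z hz => ?_)
    · obtain ⟨y, rfl⟩ := TDeltaSet.exists_face a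
      exact (congrArg ((K.attachMap ht).app _) (hf n y)).trans
        (hg n (TDeltaSet.face (K.Q i) y)).symm
    · refine ((hg' m _ fun h => hz (TDeltaSet.isDegenerate_of_app _
        (TDeltaSet.markedSimplexInclusion_injective (K.le i)) h)).1 z rfl).symm
  · rintro m z hz ⟨⟨x, l⟩, e⟩
    obtain ⟨y, hy, hyQ, hyP, ez⟩ := TDeltaSet.exists_face_of_notMem_range (K.le i) hz
    rw [hg'' m z y hy hyQ hyP ez] at e
    obtain ⟨rfl, e⟩ := Sigma.mk.inj_iff.1 e
    replace e := eq_of_heq e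
    obtain l | ⟨l, hl⟩ := l
    · exact Sum.inl_ne_inr e
    · have : l.i = i := congrArg (fun l => l.1.i) (Sum.inr_injective e)
      exact (this ▸ hl).ne rfl
  · rintro m ⟨x, l | ⟨⟨j, y, h1, h2, h3, rfl⟩, hj⟩⟩
    · exact .inl ⟨(K.attach i).lab x (.inl l), rfl⟩
    · obtain hj' | rfl := ((hit j).1 hj).lt_or_eq
      · exact .inl ⟨(K.attach i).lab _ (.inr ⟨⟨j, y, h1, h2, h3, rfl⟩,
          WithTop.coe_lt_coe.2 hj'⟩), rfl⟩
      · obtain ⟨z, hz⟩ := TDeltaSet.isLabelled_face.{u} y h2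
        exact .inr ⟨z, hg'' m z y h1 h2 h3 hz⟩
  · intro m z z' hz hz' e
    obtain ⟨y, hy, hyQ, hyP, ez⟩ := TDeltaSet.exists_face_of_notMem_range (K.le i) hz
    obtain ⟨y', hy', hyQ', hyP', ez'⟩ := TDeltaSet.exists_face_of_notMem_range (K.le i) hz'
    rw [hg'' m z y hy hyQ hyP ez, hg'' m z' y' hy' hyQ' hyP' ez'] at e
    apply TDeltaSet.markedSimplex_ext
    rw [ez, ez']
    have key : ∀ (x x' : S.X.obj (op (.mk (m + 1)))) (l : K.NewLabel x) (l' : K.NewLabel x') hl hl',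
        (K.attach t).lab x (.inr ⟨l, hl⟩) = (K.attach t).lab x' (.inr ⟨l', hl'⟩) →
        HEq l.y l'.y := by
      intro x x' l l' hl hl' e
      obtain ⟨rfl, e⟩ := Sigma.mk.inj_iff.1 e
      obtain rfl : l = l' := congrArg Subtype.val (Sum.inr_injective (eq_of_heq e))
      rfl
    exact congrArg _ (eq_of_heq (key _ _ _ _ _ _ e))

end CellFamily

namespace CellFamily

variable {S : LabelledSSet.{u}} {N : ℕ} {ι : Type u} [LinearOrder ι] {K : CellFamily S N ι}

theorem exists_attachMap_eq_of_isSuccLimit (t : WithTop ι) (ht : Order.IsSuccLimit t) (a : TDelta)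
    (y : (K.attach t).toTDeltaSet.obj (op a)) :
    ∃ (s : WithTop ι) (h : s < t) (x : (K.attach s).toTDeltaSet.obj (op a)),
      (K.attachMap h.le).app (op a) x = y := by
  obtain ⟨s, hs⟩ := not_isMin_iff.1 ht.not_isMin
  cases a with
  | plain n => exact ⟨s, hs, y, rfl⟩
  | marked m =>
    obtain ⟨x, l | ⟨l, hl⟩, rfl⟩ := LabelledSSet.exists_lab _ y
    · exact ⟨s, hs, (K.attach s).lab x (.inl l), rfl⟩
    · obtain ⟨s', hs', hs''⟩ := (ht.isSuccPrelimit.lt_iff_exists_lt).1 hl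
      exact ⟨s', hs', (K.attach s').lab x (.inr ⟨l, hs''⟩), rfl⟩

instance : K.attachFunctor.IsWellOrderContinuous where
  nonempty_isColimit t ht := by
    obtain ⟨s, hs⟩ := not_isMin_iff.1 ht.not_isMin
    have : Nonempty (Set.Iio t) := ⟨⟨s, hs⟩⟩
    refine ⟨Limits.evaluationJointlyReflectsColimits _ (fun ⟨a⟩ =>
      Limits.Types.FilteredColimit.isColimitOf' _ _ ?_ ?_)⟩
    · intro y
      obtain ⟨s, h, x, e⟩ := exists_attachMap_eq_of_isSuccLimit t ht a y
      exact ⟨⟨s, h⟩, x, e.symm⟩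
    · intro s x y h
      exact ⟨s, 𝟙 _, congrArg _ (K.attachMap_injective s.2.le _ h)⟩

variable (K) in
/-- The inclusion of a simplicial set with labels into the result of attaching all new labels. -/
noncomputable def inclusion : S.toTDeltaSet ⟶ (K.attach ⊤).toTDeltaSet :=
  LabelledSSet.Hom.toTDeltaSet (S := S) (T := K.attach ⊤)
    { f := 𝟙 S.X
      l _ := Sum.inl
      l_deg _ _ _ := rfl }

variable (K) in
/-- No labels are attached at the initial stage. -/
noncomputable def attachBotIso [OrderBot (WithTop ι)] :
    (K.attach ⊥).toTDeltaSet ≅ S.toTDeltaSet where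
  hom := LabelledSSet.Hom.toTDeltaSet (S := K.attach ⊥) (T := S)
    { f := 𝟙 S.X
      l _ := Sum.elim id fun l => (not_lt_bot l.2).elim
      l_deg _ _ _ := rfl }
  inv := LabelledSSet.Hom.toTDeltaSet (S := S) (T := K.attach ⊥)
    { f := 𝟙 S.X
      l _ := Sum.inl
      l_deg _ _ _ := rfl }
  hom_inv_id := by
    ext ⟨a⟩ x
    cases a with
    | plain k => rfl
    | marked k =>
      obtain ⟨x, l | l⟩ := x
      · rfl
      · exact (not_lt_bot l.2).elim
  inv_hom_id := by
    ext ⟨a⟩ x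
    cases a <;> rfl

/-- Attaching labels is a transfinite composition of pushouts of elementary anodyne extensions. -/
theorem transfiniteCompositions_inclusion [WellFoundedLT ι] (hK : K.IsAdmissible) :
    MorphismProperty.transfiniteCompositions.{u} (ElementaryAnodyne.{u} N).pushouts
      K.inclusion := by
  let _ : OrderBot (WithTop ι) := WellFoundedLT.toOrderBot _
  let _ : SuccOrder (WithTop ι) := .ofLinearWellFoundedLT _
  refine MorphismProperty.transfiniteCompositionsOfShape_le_transfiniteCompositions _ (WithTop ι) _
    ⟨{  F := K.attachFunctor
        isoBot := K.attachBotIso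
        incl := _
        isColimit := Limits.colimitOfDiagramTerminal Limits.isTerminalTop K.attachFunctor
        fac := by
          ext ⟨a⟩ x
          cases a <;> rfl
        map_mem := fun t ht => ?_ }⟩
  obtain ⟨i, rfl⟩ : ∃ i : ι, (i : WithTop ι) = t :=
    WithTop.ne_top_iff_exists.1 (by rintro rfl; exact ht isMax_top)
  obtain ⟨f, g, h⟩ := exists_isPushout hK i (Order.succ ↑i) (Order.le_succ _) (fun j => by
    rw [Order.lt_succ_iff_of_not_isMax ht, WithTop.coe_le_coe])
  exact MorphismProperty.pushouts_mk _ h (K.mem i)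

end CellFamily

namespace CellFamily

variable {S : LabelledSSet.{u}} {N : ℕ} {ι : Type u} [LinearOrder ι] (K : CellFamily S N ι)

theorem inclusion_injective (a) : Function.Injective (K.inclusion.app a) := by
  obtain ⟨a⟩ := a
  cases a with
  | plain k => exact fun _ _ h => h
  | marked k =>
    intro y y' e
    obtain ⟨x, l, rfl⟩ := LabelledSSet.exists_lab _ y
    obtain ⟨x', l', rfl⟩ := LabelledSSet.exists_lab _ y'
    obtain rfl : x = x' := congrArg Sigma.fst e
    exact congrArg (S.lab x) (Sum.inl_injective (eq_of_heq (Sigma.mk.inj_iff.1 e).2))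

theorem isLabelled_unm_of_label (t : WithTop ι) {m : ℕ} {x : S.X.obj (op (.mk (m + 1)))}
    (l : S.Label x) : TDeltaSet.IsLabelled ((K.attach t).unm x) :=
  ((K.attach t).isLabelled_iff x).2 ⟨.inl l⟩

theorem isLabelled_unm_of_newLabel (t : WithTop ι) {m : ℕ} {x : S.X.obj (op (.mk (m + 1)))}
    (l : K.NewLabel x) (hl : (l.i : WithTop ι) < t) : TDeltaSet.IsLabelled ((K.attach t).unm x) :=
  ((K.attach t).isLabelled_iff x).2 ⟨.inr ⟨l, hl⟩⟩

end CellFamily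

/-- A monomorphism `j` that is bijective on unmarked simplices is a retract of any
monomorphism `i` through which it factors, as soon as the second factor `r` is surjective on
labels. -/
theorem TDeltaSet.exists_retractArrow {A B Y : TDeltaSet.{u}} (j : A ⟶ Y) (i : A ⟶ B) (r : B ⟶ Y)
    (s : PlainMap Y B) (hir : i ≫ r = j) (hj : ∀ a, Function.Injective (j.app a))
    (hsj : ∀ n a, s.app n (j.app _ a) = i.app _ a) (hrs : ∀ n y, r.app _ (s.app n y) = y)
    (hr' : ∀ n, Function.Injective (r.app (op (plain n))))
    (hr : ∀ m, Function.Surjective (r.app (op (marked m)))) : Nonempty (RetractArrow j i) := by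
  obtain ⟨c, hc, hc'⟩ := exists_hom_of_rel s
    (fun m y e => r.app _ e = y ∧ ∀ z, j.app _ z = y → e = i.app _ z) (by
      intro m y hy
      obtain ⟨e, he, he'⟩ : ∃ e, r.app _ e = y ∧ ∀ z, j.app _ z = y → e = i.app _ z := by
        by_cases hz : ∃ z, j.app _ z = y
        · obtain ⟨z, rfl⟩ := hz
          exact ⟨i.app _ z, congrArg (fun f => f.app _ z) hir, fun z' h => by rw [hj _ h]⟩
        · obtain ⟨e, he⟩ := hr m y
          exact ⟨e, he, fun z h => (hz ⟨z, h⟩).elim⟩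
      refine ⟨e, hr' _ ?_, he, he'⟩
      rw [hrs, ← he, app_map])
  have hjc : j ≫ c = i := hom_ext (fun n a => (hc n _).trans (hsj n a))
    (fun m y hy => (hc' m _ fun h => hy (isDegenerate_of_app j hj h)).2 y rfl)
  have hcr : c ≫ r = 𝟙 Y := hom_ext (fun n y => (congrArg _ (hc n y)).trans (hrs n y))
    (fun m y hy => (hc' m y hy).1)
  exact ⟨{ i := Arrow.homMk (𝟙 A) c (by simp [hjc])
           r := Arrow.homMk (𝟙 A) r (by simp [hir])
           retract := by
            ext1
            · simp
            · simpa using hcr }⟩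

/-! ### The inclusion of the nerves is anodyne -/

section

variable (C : Type u) [Bicategory.{w, v} C]

/-- Indices for the elementary anodyne extensions that generate the labels of the natural nerve:
for triangles with invertible `2`-morphism whose last edge is an identity, for all triangles with
invertible `2`-morphism, and for the labels of the `1`-simplices. -/
inductive NerveCell : Type (max u v w)
  | ofIsIdentity (τ : NerveSimplex (Fin (2 + 1)) C) (h1 : IsIdentity (τ.map 1 2 (by decide)))
      (h2 : IsIso (triangle τ))
  | ofIsIso (τ : NerveSimplex (Fin (2 + 1)) C) (h2 : IsIso (triangle τ))
  | ofEdge (s : NerveSimplex (Fin (1 + 1)) C)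
      (l : ULift.{max u v w} {e : Bicategory.Equivalence (s.obj 0) (s.obj 1) // e.hom = edge s})

namespace NerveCell

variable {C}

/-- The order in which the cells are attached. -/
def rank : NerveCell C → ℕ
  | ofIsIdentity .. => 0
  | ofIsIso .. => 1
  | ofEdge .. => 2

/-- A well-order that refines the rank. -/
def rel (c d : NerveCell C) : Prop :=
  Prod.Lex (· < ·) WellOrderingRel (rank c, c) (rank d, d)

instance : IsWellOrder (NerveCell C) rel :=
  RelEmbedding.isWellOrder (s := Prod.Lex (α := ℕ) (β := NerveCell C) (· < ·) WellOrderingRel)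
    ⟨⟨fun c => (rank c, c), fun _ _ h => congrArg Prod.snd h⟩, Iff.rfl⟩

open Classical in
noncomputable instance : LinearOrder (NerveCell C) := linearOrderOfSTO rel

instance : WellFoundedLT (NerveCell C) := ⟨(inferInstance : IsWellFounded (NerveCell C) rel).wf⟩

theorem lt_of_rank_lt {c d : NerveCell C} (h : rank c < rank d) : c < d := Prod.Lex.left _ _ h

/-- The dimension of a cell. -/
def dim : NerveCell C → ℕ
  | ofIsIdentity .. => 1 + 3
  | ofIsIso .. => 3
  | ofEdge .. => 0 + 3

/-- The marked faces of the source of the elementary anodyne extension of a cell. -/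
def sourceMarking : ∀ c : NerveCell C, Set (Set (Fin (dim c + 1)))
  | ofIsIdentity .. => {S | lastPart 1 S ∈ eqMarking}
  | ofIsIso .. => admissibleMarking' 3 2
  | ofEdge .. => {S | lastPart 0 S ∈ eqMarking}

/-- The marked faces of the target of the elementary anodyne extension of a cell. -/
def targetMarking : ∀ c : NerveCell C, Set (Set (Fin (dim c + 1)))
  | ofIsIdentity .. => {S | lastPart 1 S ∈ sharpMarking}
  | ofIsIso .. => admissibleMarking'' 3 2
  | ofEdge .. => {S | lastPart 0 S ∈ sharpMarking}

theorem sourceMarking_subset : ∀ c : NerveCell C, sourceMarking c ⊆ targetMarking c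
  | ofIsIdentity .. => fun _ hS => eqMarking_subset_sharpMarking hS
  | ofIsIso .. => Set.subset_union_left
  | ofEdge .. => fun _ hS => eqMarking_subset_sharpMarking hS

theorem elementaryAnodyne : ∀ c : NerveCell C, ElementaryAnodyne.{max u v w} 2
    (markedSimplexInclusion.{max u v w} (dim c) (sourceMarking_subset c))
  | ofIsIdentity .. => .saturation 1
  | ofIsIso .. => .thinness 3 (by decide) 2
  | ofEdge .. => .saturation 0

theorem isEquivalence₁_of_label (s : NerveSimplex (Fin (1 + 1)) C)
    (l : ULift.{max u v w} {e : Bicategory.Equivalence (s.obj 0) (s.obj 1) // e.hom = edge s}) :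
    IsEquivalence₁ (edge s) := ⟨l.down⟩

variable [Bicategory.Strict C]

/-- The simplex to which the elementary anodyne extension of a cell is attached. For an edge it does
not depend on the completion `l`, which only serves as an index. -/
noncomputable def simplex : ∀ c : NerveCell C, NerveSimplex (Fin (dim c + 1)) C
  | ofIsIdentity τ h1 h2 => (NerveSimplex.exists_saturation_one τ h1 h2).choose
  | ofIsIso τ h2 => (NerveSimplex.exists_thinness τ h2).choose
  | ofEdge s l => (NerveSimplex.exists_saturation_zero s (isEquivalence₁_of_label s l)).choose

/-- The family of cells that generates the labels of the natural nerve. -/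
noncomputable def family : CellFamily (robertsStreetLabelled C) 2 (NerveCell C) where
  dim := dim
  P := sourceMarking
  Q := targetMarking
  le := sourceMarking_subset
  mem := elementaryAnodyne
  simplex := simplex

open SimplexCategory

/-- The triangle of a cell is one of the newly marked faces. -/
noncomputable def labelOfIsIdentity (τ : NerveSimplex (Fin (2 + 1)) C)
    (h1 : IsIdentity (τ.map 1 2 (by decide))) (h2 : IsIso (triangle τ)) :
    family.NewLabel (S := robertsStreetLabelled C) (m := 1) τ where
  i := ofIsIdentity τ h1 h2
  y := tripleHom (n := 1 + 3) 0 1 2 (by decide) (by decide)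
  injective := injective_tripleHom (by decide) (by decide)
  mem := (congrArg (· ∈ {S | lastPart 1 S ∈ sharpMarking}) (range_tripleHom ..)).mpr
    NerveSimplex.mem_lastPart_sharpMarking_one
  notMem := (congrArg (· ∉ {S | lastPart 1 S ∈ eqMarking}) (range_tripleHom ..)).mpr
    NerveSimplex.notMem_lastPart_eqMarking_one
  eq := (NerveSimplex.exists_saturation_one τ h1 h2).choose_spec.2.2

/-- The triangle of a cell is one of the newly marked faces. -/
noncomputable def labelOfIsIso (τ : NerveSimplex (Fin (2 + 1)) C) (h2 : IsIso (triangle τ)) :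
    family.NewLabel (S := robertsStreetLabelled C) (m := 1) τ where
  i := ofIsIso τ h2
  y := tripleHom (n := 3) 0 1 3 (by decide) (by decide)
  injective := injective_tripleHom (by decide) (by decide)
  mem := (congrArg (· ∈ admissibleMarking'' 3 2) (range_tripleHom ..)).mpr
    NerveSimplex.mem_admissibleMarking''_three_two
  notMem := (congrArg (· ∉ admissibleMarking' 3 2) (range_tripleHom ..)).mpr
    NerveSimplex.notMem_admissibleMarking'_three_two
  eq := (NerveSimplex.exists_thinness τ h2).choose_spec.2.2

/-- The edge of a cell is one of the newly marked faces. -/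
noncomputable def labelOfEdge (s : NerveSimplex (Fin (1 + 1)) C)
    (l : ULift.{max u v w} {e : Bicategory.Equivalence (s.obj 0) (s.obj 1) // e.hom = edge s}) :
    family.NewLabel (S := robertsStreetLabelled C) (m := 0) s where
  i := ofEdge s l
  y := pairHom (n := 0 + 3) 0 1 (by decide)
  injective := injective_pairHom (by decide)
  mem := (congrArg (· ∈ {S | lastPart 0 S ∈ sharpMarking}) (range_pairHom ..)).mpr
    NerveSimplex.mem_lastPart_sharpMarking_zero
  notMem := (congrArg (· ∉ {S | lastPart 0 S ∈ eqMarking}) (range_pairHom ..)).mpr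
    NerveSimplex.notMem_lastPart_eqMarking_zero
  eq := (NerveSimplex.exists_saturation_zero s (isEquivalence₁_of_label s l)).choose_spec.2.2

theorem facesLabelled_toNatural (c : NerveCell C) :
    TDeltaSet.FacesLabelled (sourceMarking c) (NerveSimplex.toNatural (simplex c)) := by
  rw [NerveSimplex.facesLabelled_toNatural_iff]
  cases c with
  | ofIsIdentity τ h1 h2 =>
    have h := (NerveSimplex.exists_saturation_one τ h1 h2).choose_spec
    exact ⟨fun i j hij hP => (h.1.1 i j hij hP).isEquivalence₁,
      fun i j k hij hjk hP => h.2.1 i j k hij.le hjk.le⟩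
  | ofIsIso τ h2 =>
    have h := (NerveSimplex.exists_thinness τ h2).choose_spec
    exact ⟨fun i j hij hP => (h.1.1 i j hij hP).isEquivalence₁,
      fun i j k hij hjk hP => h.2.1 i j k hij.le hjk.le⟩
  | ofEdge s l =>
    have h := (NerveSimplex.exists_saturation_zero s (isEquivalence₁_of_label s l)).choose_spec
    exact ⟨fun i j hij hP => (h.1 i j hij hP).isEquivalence₁,
      fun i j k hij hjk hP => h.2.1 i j k hij.le hjk.le⟩

/-- A simplex of the nerve as an unmarked simplex of a stage of the attachment. -/
noncomputable def toStage (t : WithTop (NerveCell C)) {n : ℕ} (σ : NerveSimplex (Fin (n + 1)) C) :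
    (family.attach t).toTDeltaSet.obj (op (plain n)) :=
  (family.attach t).unm (m := n) σ

theorem isLabelled_toStage_of_rsMarked (t : WithTop (NerveCell C)) {m : ℕ}
    (σ : NerveSimplex (Fin (m + 1 + 1)) C) (hσ : rsMarked (m := m) σ) :
    TDeltaSet.IsLabelled (toStage t (n := m + 1) σ) :=
  family.isLabelled_unm_of_label (S := robertsStreetLabelled C) t (m := m) ⟨⟨.inr hσ⟩⟩

theorem facesLabelled_toStage (t : WithTop (NerveCell C)) {n : ℕ} (P : Set (Set (Fin (n + 1))))
    (σ : NerveSimplex (Fin (n + 1)) C)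
    (h1 : ∀ i j (h : i < j), {i, j} ∈ P → IsIdentity (σ.map i j h.le))
    (h2 : ∀ i j k (h : i < j) (h' : j < k), {i, j, k} ∈ P → TDeltaSet.IsLabelled
      (toStage t (n := 2) (σ.reindex (tripleHom i j k h.le h'.le).toOrderHom))) :
    TDeltaSet.FacesLabelled P (toStage t σ) := by
  refine (forall_injective_iff P (fun m x => TDeltaSet.IsLabelled
    ((family.attach t).toTDeltaSet.map (pl x).op (toStage t σ))) ?_).2 ⟨?_, ?_⟩
  · exact fun m x => isLabelled_toStage_of_rsMarked t (m := m + 2) _ trivial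
  · exact fun i j h hP => isLabelled_toStage_of_rsMarked t (m := 0) _ (h1 i j h hP)
  · exact h2

/-- The faces of a cell that are required to be marked are marked in the Roberts–Street nerve or
have been marked by a cell of smaller rank. -/
theorem isAdmissible : (family (C := C)).IsAdmissible := by
  intro c
  refine facesLabelled_toStage c (sourceMarking c) (simplex c) ?_ ?_
  · cases c with
    | ofIsIdentity τ h1 h2 => exact (NerveSimplex.exists_saturation_one τ h1 h2).choose_spec.1.1
    | ofIsIso τ h2 => exact (NerveSimplex.exists_thinness τ h2).choose_spec.1.1
    | ofEdge s l =>
      exact (NerveSimplex.exists_saturation_zero s (isEquivalence₁_of_label s l)).choose_spec.1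
  · intro i j k h h' hP
    cases c with
    | ofIsIdentity τ h1 h2 =>
      exact isLabelled_toStage_of_rsMarked _ (m := 1) _
        ((NerveSimplex.exists_saturation_one τ h1 h2).choose_spec.1.2 i j k h h' hP)
    | ofIsIso τ h2 =>
      obtain hc | hc := (NerveSimplex.exists_thinness τ h2).choose_spec.1.2 i j k h h' hP
      · exact isLabelled_toStage_of_rsMarked _ (m := 1) _ hc
      · let τ' : NerveSimplex (Fin (2 + 1)) C :=
          (simplex (ofIsIso τ h2)).reindex (tripleHom i j k h.le h'.le).toOrderHom
        have h1' : IsIdentity (τ'.map 1 2 (by decide)) := hc.1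
        have h2' : IsIso (triangle τ') := hc.2
        exact family.isLabelled_unm_of_newLabel (S := robertsStreetLabelled C) _
          (labelOfIsIdentity τ' h1' h2')
          (WithTop.coe_lt_coe.2 (lt_of_rank_lt (c := ofIsIdentity τ' h1' h2')
            (d := ofIsIso τ h2) Nat.zero_lt_one))
    | ofEdge s l =>
      let τ' : NerveSimplex (Fin (2 + 1)) C :=
        (simplex (ofEdge s l)).reindex (tripleHom i j k h.le h'.le).toOrderHom
      have h2' : IsIso (triangle τ') := (NerveSimplex.exists_saturation_zero s
        (isEquivalence₁_of_label s l)).choose_spec.2.1 i j k h.le h'.le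
      exact family.isLabelled_unm_of_newLabel (S := robertsStreetLabelled C) _
          (labelOfIsIso τ' h2')
          (WithTop.coe_lt_coe.2 (lt_of_rank_lt (c := ofIsIso τ' h2')
            (d := ofEdge s l) (Nat.lt_succ_self 1)))

/-- The newly marked faces of a cell are marked in the natural nerve, as it is precomplicial. -/
theorem isLabelled_toNatural_of_newLabel {m : ℕ} {x : NerveSimplex (Fin (m + 1 + 1)) C}
    (l : family.NewLabel (S := robertsStreetLabelled C) (m := m) x) :
    TDeltaSet.IsLabelled (NerveSimplex.toNatural (n := m + 1) x) := by
  have h := (TDeltaSet.lift_markedSimplexInclusion_iff (sourceMarking_subset l.i)).1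
    (isPrecomplicial_naturalNerve C _ (elementaryAnodyne l.i)) _ (facesLabelled_toNatural l.i)
    m l.y l.injective l.mem
  exact (congrArg (fun x => TDeltaSet.IsLabelled (NerveSimplex.toNatural (n := m + 1) x))
    l.eq).mp h

/-- The label attached for a completion of an edge to an adjoint equivalence. -/
noncomputable def edgeLab (s : NerveSimplex (Fin (1 + 1)) C)
    (l : ULift.{max u v w} {e : Bicategory.Equivalence (s.obj 0) (s.obj 1) // e.hom = edge s}) :
    ((family (C := C)).attach ⊤).toTDeltaSet.obj (op (marked 0)) :=
  (family.attach ⊤).lab (m := 0) s (.inr ⟨labelOfEdge s l, WithTop.coe_lt_top _⟩)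

/-- The label of an edge in the natural nerve given by a completion to an adjoint equivalence. -/
def naturalLab (s : NerveSimplex (Fin (1 + 1)) C)
    (l : ULift.{max u v w} {e : Bicategory.Equivalence (s.obj 0) (s.obj 1) // e.hom = edge s}) :
    (naturalNerve C).obj (op (marked 0)) :=
  (naturalLabelled C).lab (m := 0) s l

theorem naturalLab_eq_of_edgeLab_eq {s s' : NerveSimplex (Fin (1 + 1)) C} {l l'}
    (h : edgeLab s l = edgeLab s' l') : naturalLab s l = naturalLab s' l' := by
  obtain ⟨rfl, h⟩ := Sigma.mk.inj_iff.1 h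
  have h' : ofEdge s l = ofEdge s l' :=
    congrArg (fun l => l.1.i) (Sum.inr_injective (eq_of_heq h))
  obtain rfl : l = l' := eq_of_heq (ofEdge.inj h').2
  rfl

theorem inclusion_ne_inr {m : ℕ} (x : (streetNerve C).obj (op (.mk (m + 1)))) (l)
    (z : (robertsStreetNerve C).obj (op (marked m))) :
    (family (C := C)).inclusion.app _ z ≠ (family.attach ⊤).lab x (.inr l) := by
  intro h
  obtain ⟨y, z⟩ := z
  obtain ⟨rfl, h⟩ := Sigma.mk.inj_iff.1 h
  exact Sum.inl_ne_inr (eq_of_heq h)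

theorem not_isDegenerate_edgeLab (s : NerveSimplex (Fin (1 + 1)) C) (l) :
    ¬ TDeltaSet.IsDegenerate (edgeLab s l) := by
  intro h
  obtain ⟨hx, h⟩ := ((family.attach ⊤).isDegenerate_iff (m := 0) _ _).1 h
  exact Sum.inr_ne_inl h

/-- The compatibility of a label of the natural nerve with the label attached for a completion of
an edge to an adjoint equivalence. -/
def IsCompatible : ∀ m, ((family (C := C)).attach ⊤).toTDeltaSet.obj (op (marked m)) →
    (naturalNerve C).obj (op (marked m)) → Prop
  | 0, y, e => ∀ s l, edgeLab s l = y → e = naturalLab s l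
  | _ + 1, _, _ => True

theorem exists_isCompatible {m : ℕ} {x : NerveSimplex (Fin (m + 1 + 1)) C}
    (y : ((family (C := C)).attach ⊤).toTDeltaSet.obj (op (marked m)))
    (hy : ((family (C := C)).attach ⊤).toTDeltaSet.map (ph m).op y =
      (family.attach ⊤).unm (m := m + 1) x)
    (hx : TDeltaSet.IsLabelled (NerveSimplex.toNatural (n := m + 1) x)) :
    ∃ e, (naturalNerve C).map (ph m).op e = NerveSimplex.toNatural (n := m + 1) x ∧
      IsCompatible m y e := by
  match m, x, y, hy, hx with
  | 0, x, y, hy, hx =>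
    by_cases h : ∃ s l, edgeLab s l = y
    · obtain ⟨s, l, rfl⟩ := h
      obtain rfl : s = x := ((family.attach ⊤).map_ph_lab (m := 0) s _).symm.trans hy
      exact ⟨naturalLab s l, LabelledSSet.map_ph_lab (naturalLabelled C) (m := 0) s l,
        fun s' l' h => (naturalLab_eq_of_edgeLab_eq h).symm⟩
    · obtain ⟨e, he⟩ := hx
      exact ⟨e, he, fun s l h' => (h ⟨s, l, h'⟩).elim⟩
  | m + 1, x, y, hy, ⟨e, he⟩ => exact ⟨e, he, trivial⟩

/-- The natural nerve receives a map from the result of attaching all cells that is the identity of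
the simplices and the expected map on the labels given by adjoint equivalences. -/
theorem exists_map_naturalNerve :
    ∃ r : ((family (C := C)).attach ⊤).toTDeltaSet ⟶ naturalNerve C,
      (family (C := C)).inclusion ≫ r = nerveInclusion C ∧
      (∀ n (σ : NerveSimplex (Fin (n + 1)) C), r.app _ (toStage ⊤ σ) = NerveSimplex.toNatural σ) ∧
      ∀ s l, r.app _ (edgeLab s l) = naturalLab s l := by
  obtain ⟨r, hr, hr'⟩ := TDeltaSet.exists_hom_of_rel
    (LabelledSSet.Hom.toPlainMap (S := (family (C := C)).attach ⊤) (T := naturalLabelled C)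
      (𝟙 (streetNerve C)))
    (fun m y e => (∀ z, (family (C := C)).inclusion.app _ z = y → e = (nerveInclusion C).app _ z) ∧
      IsCompatible m y e) (by
    intro m y hy
    obtain ⟨x, l | l, rfl⟩ := LabelledSSet.exists_lab _ y
    · refine ⟨(nerveInclusion C).app _ ((robertsStreetLabelled C).lab x l), ?_, fun z hz => ?_, ?_⟩
      · exact (LabelledSSet.map_ph_lab (naturalLabelled C) x _).trans
          (congrArg ((LabelledSSet.Hom.toPlainMap (S := family.attach ⊤)
            (T := naturalLabelled C) (𝟙 (streetNerve C))).app _)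
            ((family.attach ⊤).map_ph_lab x (.inl l)).symm)
      · obtain rfl : (robertsStreetLabelled C).lab x l = z :=
          family.inclusion_injective _ (Eq.trans rfl hz.symm)
        rfl
      · match m with
        | 0 => exact fun s l' h => (inclusion_ne_inr (m := 0) s _
            ((robertsStreetLabelled C).lab x l) h.symm).elim
        | m + 1 => trivial
    · obtain ⟨e, he, he'⟩ := exists_isCompatible (m := m) (x := x)
        ((family.attach ⊤).lab x (.inr l)) (LabelledSSet.map_ph_lab _ _ _)
        (isLabelled_toNatural_of_newLabel (m := m) l.1)
      exact ⟨e, he.trans (congrArg ((LabelledSSet.Hom.toPlainMap (S := family.attach ⊤)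
            (T := naturalLabelled C) (𝟙 (streetNerve C))).app _)
            ((family.attach ⊤).map_ph_lab x (.inr l)).symm),
        fun z hz => (inclusion_ne_inr x l z hz).elim, he'⟩)
  refine ⟨r, TDeltaSet.hom_ext (fun n a => hr n _) (fun m y hy => ?_), fun n σ => hr n _,
    fun s l => (hr' 0 _ (not_isDegenerate_edgeLab s l)).2 s l rfl⟩
  exact (hr' m (family.inclusion.app _ y) fun h =>
    hy (TDeltaSet.isDegenerate_of_app _ family.inclusion_injective h)).1 y rfl

theorem isLabelled_toStage {m : ℕ} (σ : NerveSimplex (Fin (m + 2 + 1)) C)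
    (hσ : TDeltaSet.IsLabelled (NerveSimplex.toNatural (n := m + 2) σ)) :
    TDeltaSet.IsLabelled (toStage (C := C) ⊤ (n := m + 2) σ) := by
  match m, σ, hσ with
  | 0, σ, hσ =>
    exact family.isLabelled_unm_of_newLabel (S := robertsStreetLabelled C) ⊤ (m := 1)
      (labelOfIsIso σ ((NerveSimplex.isLabelled_toNatural_two σ).1 hσ)) (WithTop.coe_lt_top _)
  | m + 1, σ, _ => exact isLabelled_toStage_of_rsMarked ⊤ (m := m + 2) σ trivial

/-- A label of the natural nerve of dimension at least `2` is determined by its simplex. -/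
theorem naturalNerve_ext {m : ℕ} {y y' : (naturalNerve C).obj (op (marked (m + 1)))}
    (h : (naturalNerve C).map (ph (m + 1)).op y = (naturalNerve C).map (ph (m + 1)).op y') :
    y = y' := by
  obtain ⟨x, l, rfl⟩ := LabelledSSet.exists_lab _ y
  obtain ⟨x', l', rfl⟩ := LabelledSSet.exists_lab _ y'
  obtain rfl : x = x' := (LabelledSSet.map_ph_lab _ x l).symm.trans
    (h.trans (LabelledSSet.map_ph_lab _ x' l'))
  match m, x, l, l' with
  | 0, x, ⟨⟨l⟩⟩, ⟨⟨l'⟩⟩ => rfl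
  | m + 1, x, ⟨⟩, ⟨⟩ => rfl

end NerveCell

end

/-- The inclusion of the nerves is a retract of the inclusion that attaches all cells. -/
theorem anodyneExtension_nerveInclusion (C : Type u) [Bicategory.{w, v} C] [Bicategory.Strict C] :
    AnodyneExtension 2 (nerveInclusion C) := by
  open NerveCell in
  obtain ⟨r, hr, hr₀, hr₁⟩ := exists_map_naturalNerve (C := C)
  obtain ⟨h⟩ := TDeltaSet.exists_retractArrow (nerveInclusion C) family.inclusion r
    (LabelledSSet.Hom.toPlainMap (S := naturalLabelled C) (T := (family (C := C)).attach ⊤)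
      (𝟙 (streetNerve C))) hr (nerveInclusion_injective C) (fun _ _ => rfl) (fun n y => hr₀ n y)
    (fun n y y' h => (hr₀ n y).symm.trans (h.trans (hr₀ n y'))) (by
      intro m y
      match m, y with
      | 0, ⟨s, l⟩ => exact ⟨edgeLab s l, hr₁ s l⟩
      | m + 1, y =>
        obtain ⟨e, he⟩ := isLabelled_toStage (m := m) ((naturalNerve C).map (ph (m + 1)).op y)
          ⟨y, rfl⟩
        refine ⟨e, naturalNerve_ext ?_⟩
        rw [← TDeltaSet.app_map, he]
        exact hr₀ _ _)
  exact ⟨_, _, _, h, CellFamily.transfiniteCompositions_inclusion isAdmissible⟩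

theorem mainTheorem4 {C : Type u} [Bicategory.{w, v} C] [Bicategory.Strict C] :
    (IsPrecomplicial 2 (robertsStreetNerve C) ↔
      (∀ (x y : C) (f : x ⟶ y), IsIsomorphism f → IsIdentity f) ∧
      (∀ (x y : C) (f g : x ⟶ y) (α : f ⟶ g), IsIso α → IsIdentity₂ α)) ∧
    IsPrecomplicial 2 (naturalNerve C) ∧
    AnodyneExtension 2 (nerveInclusion C) ∧
    IsWeakEquivalence 2 (nerveInclusion C) :=
  ⟨isPrecomplicial_robertsStreetNerve_iff, isPrecomplicial_naturalNerve C,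
    anodyneExtension_nerveInclusion C, isWeakEquivalence_nerveInclusion C⟩
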